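/- **Theorem 3.4 (HJB equation).** *Data.* Let $0=t_0<t_1<\dots<t_n<t_{n+1}=T$ and let $\emptyset\neq U\subset\mathbb R^{k_1}\times\mathbb R^{k_2}$ with coordinate projections $U_1,U_2$. Let $\mathcal P=\mathcal P(\mathbb R^d)$ be the set of Borel probability measures with the weak topology. The controlled generator is $$\mathcal G(\alpha)f=\sum_i b_i(\alpha,\cdot)\,\partial_if+\tfrac12\sum_{i,j}a_{ij}(\alpha,\cdot)\,\partial^2_{ij}f ,\qquad \langle\mathcal G^*(\alpha)\mu,f\rangle:=\int\mathcal G(\alpha)f\,d\mu ,$$ with $a(\alpha,x)$ symmetric non-negative. At $t_i$ ($1\le i\le n$) one observes $Y_i^{\beta,\mu}$, a measurable function of $(\mu,\beta,\Gamma_i)$, where $\mu$ is the state just before $t_i$ and $\Gamma_1,\dots,\Gamma_n$ are independent. The state is then updated to $K_\beta\mu:=K_\beta(\cdot\,;\mu,Y_i^{\beta,\mu})\,\mu$, where $K_\beta(\cdot\,;\mu,y)\ge0$ is a measurable kernel with $\int K_\beta(x;\mu,Y_i^{\beta,\mu})\,\mu(dx)=1$ a.s. for $\beta\in U_2$. The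 costs are a running cost $\ell(t,\mu,\alpha)$, measurement costs $h(t_i,\mu,\beta)$ and a terminal cost $g(\mu)$. *Standing assumptions.* The functions $b,a,\ell,h,g$ are measurable in all variables and bounded for $(\alpha,\beta)\in U$, $t\in[0,T]$. They are continuous in the state variable ($x$ for $b,a$; $(t,\mu)\in[0,T]\times\mathcal P$ for $\ell$; $\mu$ for $h(t_i,\cdot,\beta)$ and $g$), equicontinuously with respect to the control. For every bounded continuous $\Psi:\mathcal P\to\mathbb R$ and every $i$, the functions $\mu\mapsto\mathbb E[\Psi(K_\beta(\cdot;\mu,Y_i^{\beta,\mu})\mu)]$, $\beta\in U_2$, are equicontinuous. For $0\le r_1<r_2\le T$, $\mu\in\mathcal P$ and measurable $\alpha:[r_1,r_2]\to U_1$, the equation $d\mu_t=\mathcal G^*(\alpha_t)\mu_t\,dt$, $\mu_{r_1}=\mu$, has exactly one weakly continuous solution on $[r_1,r_2]$ in the weak sense (tested against all $f\in C_b^2(\mathbb R^d)$). *Control problem.* An admissible control $u=(\alpha,\beta)$ on $[s,T]$ consists of a measurable $U_1$-valued process $\alpha$, where $\alpha_t$ is a function of the observations made in $(s,t]$, and of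 $U_2$-valued $\beta_i$ for $t_i>s$, where $\beta_i$ is a measurable function of the observations made in $(s,t_i)$. The process $\mu^u_t$ starts at $\mu^u_s=\mu$, solves $d\mu_t=\mathcal G^*(\alpha_t)\mu_t\,dt$ between observation times, and satisfies $\mu^u_{t_i}=K_{\beta_i}(\cdot\,;\mu^u_{t_i^-},Y_i)\,\mu^u_{t_i^-}$ for $t_i>s$. Put $$J(s,\mu;u)=\mathbb E\Big[\int_s^T\ell(t,\mu^u_t,\alpha_t)\,dt+\sum_{t_i>s}h(t_i,\mu^u_{t_i^-},\beta_i)+g(\mu^u_T)\Big],$$ $V(s,\mu)=\inf_uJ(s,\mu;u)$ for $s<T$ and $V(T,\mu)=g(\mu)$. *Regularity of $V$.* On each interval $[t_i,t_{i+1})$, $i=0,\dots,n$, the value function $V$ is differentiable in $t$ (one-sided at $t_i$) and of class $\mathcal S^{1,1}(\mathcal P)$ in $\mu$. The latter means that there is a function $\frac{\delta V}{\delta\mu}(t,\mu,x)$ with $$V(t,\mu)-V(t,\nu)=\int_0^1\Big\langle\mu-\nu,\tfrac{\delta V}{\delta\mu}(t,\nu+\lambda(\mu-\nu),\cdot)\Big\rangle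 d\lambda\qquad(\mu,\nu\in\mathcal P),$$ which is $C^2$ in $x$ and, together with its first and second $x$-derivatives, jointly continuous in $(t,\mu,x)$ and bounded in $x$ locally uniformly in $(t,\mu)$. *Conclusion.* Let $\mathcal H(t,\mu,p)=\inf_{(\alpha,\beta)\in U}\{\langle\mathcal G^*(\alpha)\mu,p\rangle+\ell(t,\mu,\alpha)\}$. Then for all $\mu\in\mathcal P$: 1. $\frac{\partial V}{\partial t}(t,\mu)+\mathcal H\big(t,\mu,\frac{\delta V}{\delta\mu}(t,\mu,\cdot)\big)=0$ for $t_i\le t<t_{i+1}$, $i=0,\dots,n$; 2. the left limit $V(t_i^-,\mu)=\lim_{t\uparrow t_i}V(t,\mu)$ exists and $$V(t_i^-,\mu)=\inf_{(\alpha,\beta)\in U}\big\{h(t_i,\mu,\beta)+\mathbb E\big[V(t_i,K_\beta(\cdot\,;\mu,Y_i^{\beta,\mu})\mu)\big]\big\},\qquad i=1,\dots,n;$$ 3. $V(T,\mu)=g(\mu)$, and $V(t,\mu)\to g(\mu)$ as $t\uparrow T$. Moreover, let $u^*=(\alpha^*,\beta^*):[0,T)\times\mathcal P\to U$ be such that $u^*(t,\mu)$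 minimizes $\langle\mathcal G^*(\alpha)\mu,\frac{\delta V}{\delta\mu}(t,\mu,\cdot)\rangle+\ell(t,\mu,\alpha)$ over $(\alpha,\beta)\in U$ for $t\notin\{t_1,\dots,t_n\}$, and $u^*(t_i,\mu)$ minimizes the expression in braces in 2 over $U$. Let $s\in[0,T)$, $\mu\in\mathcal P$, and let $u$ be an admissible control on $[s,T]$ whose path $\mu^*$ started at $(s,\mu)$ satisfies $\alpha_t=\alpha^*(t,\mu^*_t)$ for $t\notin\{t_1,\dots,t_n\}$ and $\beta_i=\beta^*(t_i,\mu^*_{t_i^-})$ for $t_i>s$. Then $u$ is optimal: $J(s,\mu;u)\le J(s,\mu;u')$ for all admissible $u'$. -/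

import Mathlib

open MeasureTheory Set Filter Topology
open scoped NNReal ENNReal BoundedContinuousFunction

noncomputable section

/-- Euclidean space `ℝ^d`. -/
abbrev Eucl (d : ℕ) : Type := EuclideanSpace ℝ (Fin d)

/-- `P(ℝ^d)`: Borel probability measures with the topology of weak convergence. -/
abbrev Prob (d : ℕ) : Type := ProbabilityMeasure (Eucl d)

/-! ### Function classes and flat derivatives -/

/-- `f ∈ C_b²(ℝ^d)`: twice continuously differentiable, bounded together with its first and second
derivatives. -/
def IsCb2 {d : ℕ} (f : Eucl d → ℝ) : Prop :=
  ContDiff ℝ 2 f ∧ ∃ C : ℝ, ∀ x, |f x| ≤ C ∧ ‖fderiv ℝ f x‖ ≤ C ∧ ‖fderiv ℝ (fderiv ℝ f) x‖ ≤ C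

/-- The convex combination `r μ + (1 - r) ν`. -/
def mixture {d : ℕ} (r : unitInterval) (μ ν : Prob d) : Prob d :=
  ⟨ENNReal.ofReal (r : ℝ) • (μ : Measure (Eucl d))
      + ENNReal.ofReal (1 - (r : ℝ)) • (ν : Measure (Eucl d)), ⟨by
    have h0 : (0 : ℝ) ≤ (r : ℝ) := r.2.1
    have h1 : (0 : ℝ) ≤ 1 - (r : ℝ) := sub_nonneg.2 r.2.2
    simp [← ENNReal.ofReal_add h0 h1]⟩⟩

/-- `D` is a flat derivative of `Φ` on `P(ℝ^d)`:
`Φ(μ) - Φ(ν) = ∫₀¹ ⟨μ - ν, D(ν + r (μ - ν), ·)⟩ dr` for all `μ, ν`. -/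
def IsFlatDeriv {d : ℕ} (Φ : Prob d → ℝ) (D : Prob d → Eucl d → ℝ) : Prop :=
  ∀ μ ν : Prob d, Φ μ - Φ ν =
    ∫ r : unitInterval, ((∫ x, D (mixture r μ ν) x ∂(μ : Measure (Eucl d)))
      - ∫ x, D (mixture r μ ν) x ∂(ν : Measure (Eucl d)))

/-- The time-dependent function `Φ(t, μ)` is of class `S^{1,1}(P(ℝ^d))` in `μ` for `t ∈ I`, with
`D(t, μ, x)` the continuous version of its flat derivative: `D(t, ·, ·)` is a flat derivative of
`Φ(t, ·)`, it is `C²` in `x`, the function and its first two `x`-derivatives are jointly continuous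
and are bounded in `x`, locally uniformly in `(t, μ)`. -/
structure IsS11On {d : ℕ} (I : Set ℝ) (Φ : ℝ → Prob d → ℝ) (D : ℝ → Prob d → Eucl d → ℝ) :
    Prop where
  flat : ∀ t ∈ I, IsFlatDeriv (Φ t) (D t)
  contDiff : ∀ t ∈ I, ∀ μ, ContDiff ℝ 2 (D t μ)
  cont : ContinuousOn (fun q : ℝ × Prob d × Eucl d => D q.1 q.2.1 q.2.2) (I ×ˢ univ)
  cont_fderiv : ContinuousOn
    (fun q : ℝ × Prob d × Eucl d => fderiv ℝ (D q.1 q.2.1) q.2.2) (I ×ˢ univ)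
  cont_fderiv2 : ContinuousOn
    (fun q : ℝ × Prob d × Eucl d => fderiv ℝ (fderiv ℝ (D q.1 q.2.1)) q.2.2) (I ×ˢ univ)
  bdd : ∀ t ∈ I, ∀ μ : Prob d, ∃ C : ℝ, ∀ᶠ q in 𝓝[I ×ˢ (univ : Set (Prob d))] (t, μ), ∀ x,
    |D q.1 q.2 x| ≤ C ∧ ‖fderiv ℝ (D q.1 q.2) x‖ ≤ C ∧ ‖fderiv ℝ (fderiv ℝ (D q.1 q.2)) x‖ ≤ C

/-! ### The data of the control problem -/

/-- Data of the partially observed control problem: `G` is the space of the measurement noises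
`Γ_i`, `Y` the space of the observations. -/
structure ObsControl (d k₁ k₂ n : ℕ) (G Y : Type*) [MeasurableSpace G] [MeasurableSpace Y] where
  /-- the times `t_0 = 0 < t_1 < ⋯ < t_n < t_{n+1} = T` -/
  τ : Fin (n + 2) → ℝ
  /-- control set -/
  U : Set (Eucl k₁ × Eucl k₂)
  /-- drift -/
  b : Eucl k₁ → Eucl d → Eucl d
  /-- diffusion matrix -/
  a : Eucl k₁ → Eucl d → Matrix (Fin d) (Fin d) ℝ
  /-- law of the noise `Γ_i` -/
  γ : Fin n → ProbabilityMeasure G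
  /-- the `i`-th observation as a function of the prior, the control `β` and the noise `Γ_i` -/
  obs : Fin n → Prob d → Eucl k₂ → G → Y
  /-- Bayesian update kernel: `K β μ y x` is the density at `x` of the posterior with respect to the
  prior `μ`, given the observation `y` -/
  K : Eucl k₂ → Prob d → Y → Eucl d → ℝ≥0
  /-- running cost -/
  ℓ : ℝ → Prob d → Eucl k₁ → ℝ
  /-- measurement cost -/
  h : ℝ → Prob d → Eucl k₂ → ℝ
  /-- terminal cost -/
  g : Prob d → ℝ

namespace ObsControl

variable {d k₁ k₂ n : ℕ} {G Y : Type*} [MeasurableSpace G] [MeasurableSpace Y]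

/-- The time horizon `T = t_{n+1}`. -/
def T (P : ObsControl d k₁ k₂ n G Y) : ℝ := P.τ (Fin.last (n + 1))

/-- The observation times `t_1, …, t_n` (indexed from `0`). -/
def obsTime (P : ObsControl d k₁ k₂ n G Y) (j : Fin n) : ℝ := P.τ j.succ.castSucc

/-- The half-open interval `[t_i, t_{i+1})`, `i = 0, …, n`. -/
def slot (P : ObsControl d k₁ k₂ n G Y) (i : Fin (n + 1)) : Set ℝ :=
  Ico (P.τ i.castSucc) (P.τ i.succ)

/-- The controlled generator
`G(α) f(x) = ∑ b_i(α, x) ∂_i f(x) + ½ ∑ a_ij(α, x) ∂²_ij f(x)`. -/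
def gen (P : ObsControl d k₁ k₂ n G Y) (α : Eucl k₁) (f : Eucl d → ℝ) (x : Eucl d) : ℝ :=
  (∑ i, P.b α x i * fderiv ℝ f x (EuclideanSpace.single i 1))
    + (1 / 2) * ∑ i, ∑ j, P.a α x i j *
        fderiv ℝ (fderiv ℝ f) x (EuclideanSpace.single i 1) (EuclideanSpace.single j 1)

/-- The pairing `⟨G(α)^* μ, p⟩ = ⟨μ, G(α) p⟩`, the adjoint acting in the weak sense. -/
def adjPair (P : ObsControl d k₁ k₂ n G Y) (α : Eucl k₁) (μ : Prob d) (p : Eucl d → ℝ) : ℝ :=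
  ∫ x, P.gen α p x ∂(μ : Measure (Eucl d))

/-- `c` is a weak solution of the Fokker-Planck equation `dμ_t = G(α_t)^* μ_t dt` on `[r₁, r₂]`. -/
def IsFPSolution (P : ObsControl d k₁ k₂ n G Y) (α : ℝ → Eucl k₁) (r₁ r₂ : ℝ) (c : ℝ → Prob d) :
    Prop :=
  ContinuousOn c (Icc r₁ r₂) ∧
    ∀ f : Eucl d → ℝ, IsCb2 f → ∀ t ∈ Icc r₁ r₂,
      ∫ x, f x ∂(c t : Measure (Eucl d)) = ∫ x, f x ∂(c r₁ : Measure (Eucl d))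
        + ∫ r in r₁..t, P.adjPair (α r) (c r) f

open Classical in
/-- The posterior `K_β(·; μ, y) μ` (set to `μ` where this is not a probability measure). -/
def post (P : ObsControl d k₁ k₂ n G Y) (β : Eucl k₂) (μ : Prob d) (y : Y) : Prob d :=
  if hK : ∫⁻ x, (P.K β μ y x : ℝ≥0∞) ∂(μ : Measure (Eucl d)) = 1 then
    ⟨(μ : Measure (Eucl d)).withDensity fun x => (P.K β μ y x : ℝ≥0∞), ⟨by simpa using hK⟩⟩
  else μ

/-- Standing assumptions on the data. -/
structure Standing (P : ObsControl d k₁ k₂ n G Y) : Prop where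
  τ_zero : P.τ 0 = 0
  τ_strictMono : StrictMono P.τ
  U_nonempty : P.U.Nonempty
  /- measurability -/
  b_meas : Measurable fun q : Eucl k₁ × Eucl d => P.b q.1 q.2
  a_meas : ∀ i j, Measurable fun q : Eucl k₁ × Eucl d => P.a q.1 q.2 i j
  obs_meas : ∀ j, Measurable fun q : Prob d × Eucl k₂ × G => P.obs j q.1 q.2.1 q.2.2
  K_meas : Measurable fun q : Eucl k₂ × Prob d × Y × Eucl d => P.K q.1 q.2.1 q.2.2.1 q.2.2.2
  ℓ_meas : Measurable fun q : ℝ × Prob d × Eucl k₁ => P.ℓ q.1 q.2.1 q.2.2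
  h_meas : ∀ j, Measurable fun q : Prob d × Eucl k₂ => P.h (P.obsTime j) q.1 q.2
  /- boundedness -/
  b_bdd : ∃ C, ∀ u ∈ P.U, ∀ x, ‖P.b u.1 x‖ ≤ C
  a_bdd : ∃ C, ∀ u ∈ P.U, ∀ x i j, |P.a u.1 x i j| ≤ C
  ℓ_bdd : ∃ C, ∀ u ∈ P.U, ∀ t ∈ Icc 0 P.T, ∀ μ, |P.ℓ t μ u.1| ≤ C
  h_bdd : ∃ C, ∀ u ∈ P.U, ∀ j μ, |P.h (P.obsTime j) μ u.2| ≤ C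
  g_bdd : ∃ C, ∀ μ, |P.g μ| ≤ C
  /- continuity in the state, uniform in the control -/
  b_cont : Equicontinuous fun (u : P.U) (x : Eucl d) => P.b u.1.1 x
  a_cont : ∀ i j, Equicontinuous fun (u : P.U) (x : Eucl d) => P.a u.1.1 x i j
  ℓ_cont : EquicontinuousOn (fun (u : P.U) (q : ℝ × Prob d) => P.ℓ q.1 q.2 u.1.1)
    (Icc 0 P.T ×ˢ univ)
  h_cont : ∀ j, Equicontinuous fun (u : P.U) (μ : Prob d) => P.h (P.obsTime j) μ u.1.2
  g_cont : Continuous P.g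
  /- the diffusion matrix is symmetric and non-negative -/
  a_psd : ∀ u ∈ P.U, ∀ x, (P.a u.1 x).PosSemidef
  /- the update is a conditional density, for almost every value of the noise -/
  K_normalized : ∀ u ∈ P.U, ∀ (j : Fin n) (μ : Prob d), ∀ᵐ w ∂(P.γ j : Measure G),
    ∫⁻ x, (P.K u.2 μ (P.obs j μ u.2 w) x : ℝ≥0∞) ∂(μ : Measure (Eucl d)) = 1
  /- the law of the posterior depends weakly continuously on the prior, uniformly in the control -/
  update_cont : ∀ (j : Fin n) (Ψ : Prob d →ᵇ ℝ), Equicontinuous fun (u : P.U) (μ : Prob d) =>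
    ∫ w, Ψ (P.post u.1.2 μ (P.obs j μ u.1.2 w)) ∂(P.γ j : Measure G)
  /- unique weak solvability of the controlled Fokker-Planck equation -/
  fp_exists : ∀ (r₁ r₂ : ℝ), 0 ≤ r₁ → r₁ < r₂ → r₂ ≤ P.T → ∀ (μ : Prob d) (α : ℝ → Eucl k₁),
    Measurable α → (∀ t ∈ Icc r₁ r₂, α t ∈ Prod.fst '' P.U) →
      ∃ c, P.IsFPSolution α r₁ r₂ c ∧ c r₁ = μ
  fp_unique : ∀ (r₁ r₂ : ℝ), 0 ≤ r₁ → r₁ < r₂ → r₂ ≤ P.T → ∀ (α : ℝ → Eucl k₁),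
    Measurable α → (∀ t ∈ Icc r₁ r₂, α t ∈ Prod.fst '' P.U) →
      ∀ c c', P.IsFPSolution α r₁ r₂ c → P.IsFPSolution α r₁ r₂ c' → c r₁ = c' r₁ →
        EqOn c c' (Icc r₁ r₂)

/-! ### Admissible controls, controlled process, cost and value function -/

/-- Admissible controls on `[s, T]`. Being adapted to the filtration generated by the observations
means being a measurable function of the observations made so far: `α t y` may use only the
observations made in `(s, t]`, and `β j y`, the measurement control used at the observation time
`t_j`, only those made in `(s, t_j)`. -/
structure Control (P : ObsControl d k₁ k₂ n G Y) (s : ℝ) where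
  α : ℝ → (Fin n → Y) → Eucl k₁
  β : Fin n → (Fin n → Y) → Eucl k₂
  α_meas : Measurable fun q : ℝ × (Fin n → Y) => α q.1 q.2
  β_meas : ∀ j, Measurable (β j)
  α_adapted : ∀ t ∈ Icc s P.T, ∀ y y' : Fin n → Y,
    (∀ j, s < P.obsTime j → P.obsTime j ≤ t → y j = y' j) → α t y = α t y'
  β_predictable : ∀ j, s < P.obsTime j → ∀ y y' : Fin n → Y,
    (∀ i, s < P.obsTime i → P.obsTime i < P.obsTime j → y i = y' i) → β j y = β j y'
  α_mem : ∀ t ∈ Icc s P.T, ∀ y, α t y ∈ Prod.fst '' P.U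
  β_mem : ∀ j, s < P.obsTime j → ∀ y, β j y ∈ Prod.snd '' P.U

/-- The controlled measure-valued process started from `μ` at time `s`, on the probability space of
the independent noises `ω = (Γ_j)_j`. `seg i` is the process on `[t_i, t_{i+1})`, extended by its
left limit to `t_{i+1}`; thus `seg j.castSucc (t_j)` is the state just before the observation at the
`j`-th observation time, and `seg j.succ (t_j)` the state just after it. `record ω` is the sequence
of the observations. -/
structure Trajectory (P : ObsControl d k₁ k₂ n G Y) {s : ℝ} (u : P.Control s) (μ : Prob d) where
  record : (Fin n → G) → Fin n → Y
  seg : Fin (n + 1) → ℝ → (Fin n → G) → Prob d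
  record_meas : Measurable record
  seg_meas : ∀ i, Measurable fun q : ℝ × (Fin n → G) => seg i q.1 q.2
  start : ∀ i, s ∈ P.slot i → ∀ ω, seg i s ω = μ
  evolve : ∀ i, s < P.τ i.succ → ∀ ω, P.IsFPSolution (fun t => u.α t (record ω))
    (max s (P.τ i.castSucc)) (P.τ i.succ) fun t => seg i t ω
  observe : ∀ j, s < P.obsTime j → ∀ ω, record ω j =
    P.obs j (seg j.castSucc (P.obsTime j) ω) (u.β j (record ω)) (ω j)
  update : ∀ j, s < P.obsTime j → ∀ ω, seg j.succ (P.obsTime j) ω =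
    P.post (u.β j (record ω)) (seg j.castSucc (P.obsTime j) ω) (record ω j)

/-- The law of the independent noises. -/
def noise (P : ObsControl d k₁ k₂ n G Y) : Measure (Fin n → G) :=
  Measure.pi fun j => (P.γ j : Measure G)

/-- The cost `J(s, μ; u)`:
expectation of `∫_s^T ℓ(t, μ_t, α_t) dt + ∑_{t_j > s} h(t_j, μ_{t_j^-}, β_j) + g(μ_T)`. -/
def Trajectory.cost {P : ObsControl d k₁ k₂ n G Y} {s : ℝ} {u : P.Control s} {μ : Prob d}
    (X : P.Trajectory u μ) : ℝ :=
  ∫ ω, ((∑ i : Fin (n + 1), ∫ t in (max s (P.τ i.castSucc))..(max s (P.τ i.succ)),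
          P.ℓ t (X.seg i t ω) (u.α t (X.record ω)))
      + (∑ j : Fin n, if s < P.obsTime j then
          P.h (P.obsTime j) (X.seg j.castSucc (P.obsTime j) ω) (u.β j (X.record ω)) else 0)
      + P.g (X.seg (Fin.last n) P.T ω)) ∂P.noise

/-- The value function: `V(T, μ) = g(μ)` and `V(s, μ) = inf_u J(s, μ; u)` for `s < T`. -/
def value (P : ObsControl d k₁ k₂ n G Y) (s : ℝ) (μ : Prob d) : ℝ :=
  if s < P.T then sInf {J | ∃ (u : P.Control s) (X : P.Trajectory u μ), J = X.cost} else P.g μ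

/-- The control behind the trajectory `X` is optimal for the start `(s, μ)`. -/
def Trajectory.IsOptimal {P : ObsControl d k₁ k₂ n G Y} {s : ℝ} {u : P.Control s} {μ : Prob d}
    (X : P.Trajectory u μ) : Prop :=
  ∀ (u' : P.Control s) (X' : P.Trajectory u' μ), X.cost ≤ X'.cost

/-! ### Hamiltonian, impulse operator, feedback maps -/

/-- The expression minimized in the Hamiltonian. -/
def hamArg (P : ObsControl d k₁ k₂ n G Y) (t : ℝ) (μ : Prob d) (p : Eucl d → ℝ)
    (u : Eucl k₁ × Eucl k₂) : ℝ :=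
  P.adjPair u.1 μ p + P.ℓ t μ u.1

/-- The Hamiltonian `H(t, μ, p) = inf_{(α, β) ∈ U} {⟨G(α)^* μ, p⟩ + ℓ(t, μ, α)}`. -/
def hamiltonian (P : ObsControl d k₁ k₂ n G Y) (t : ℝ) (μ : Prob d) (p : Eucl d → ℝ) : ℝ :=
  ⨅ u : P.U, P.hamArg t μ p u

/-- The expression `h(t_j, μ, β) + E[V(t_j, K_β(·; μ, Y_j) μ)]` minimized at an observation. -/
def impulseArg (P : ObsControl d k₁ k₂ n G Y) (j : Fin n) (μ : Prob d)
    (u : Eucl k₁ × Eucl k₂) : ℝ :=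
  P.h (P.obsTime j) μ u.2
    + ∫ w, P.value (P.obsTime j) (P.post u.2 μ (P.obs j μ u.2 w)) ∂(P.γ j : Measure G)

/-- `inf_{(α, β) ∈ U} {h(t_j, μ, β) + E[V(t_j, K_β(·; μ, Y_j) μ)]}`. -/
def impulse (P : ObsControl d k₁ k₂ n G Y) (j : Fin n) (μ : Prob d) : ℝ :=
  ⨅ u : P.U, P.impulseArg j μ u

/-- `F : [0, T) × P(ℝ^d) → U` selects minimizers: of the Hamiltonian expression with
`p = D(t, μ, ·)` at the times `t` that are no observation times, and of the impulse expression at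
the observation times. -/
structure IsArgminMap (P : ObsControl d k₁ k₂ n G Y) (D : ℝ → Prob d → Eucl d → ℝ)
    (F : ℝ → Prob d → Eucl k₁ × Eucl k₂) : Prop where
  mem : ∀ t ∈ Ico 0 P.T, ∀ μ, F t μ ∈ P.U
  ham : ∀ t ∈ Ico 0 P.T, (∀ j, t ≠ P.obsTime j) → ∀ μ, IsMinOn (P.hamArg t μ (D t μ)) P.U (F t μ)
  imp : ∀ j μ, IsMinOn (P.impulseArg j μ) P.U (F (P.obsTime j) μ)

/-- The control `u` is obtained from the map `F` along its own path `X`: `α_t = F_α(t, μ_t)` at the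
times that are no observation times, and `β_j = F_β(t_j, μ_{t_j^-})`. -/
structure Trajectory.IsFeedback {P : ObsControl d k₁ k₂ n G Y} {s : ℝ} {u : P.Control s}
    {μ : Prob d} (X : P.Trajectory u μ) (F : ℝ → Prob d → Eucl k₁ × Eucl k₂) : Prop where
  α_eq : ∀ i, ∀ t ∈ P.slot i, s ≤ t → (∀ j, t ≠ P.obsTime j) → ∀ ω,
    u.α t (X.record ω) = (F t (X.seg i t ω)).1
  β_eq : ∀ j, s < P.obsTime j → ∀ ω,
    u.β j (X.record ω) = (F (P.obsTime j) (X.seg j.castSucc (P.obsTime j) ω)).2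

end ObsControl

end

/-!
The proof is dynamic programming, followed by a first order expansion of the value function on short
time intervals.

*Dynamic programming.* Between two observations the controls are deterministic, because no new
information arrives: a control up to the next observation is an open loop control together with the
measurement control used there (`OpenLoop`), and the path is the flow of the Fokker–Planck equation
(`flow`). Conditioned on the noise at the next observation, an admissible control continues as an
admissible control started from the posterior (`Trajectory.after`, `Trajectory.cost_eq_after`);
hence its cost is at least the cost of its first leg followed by the value function, `legCost`
(`Trajectory.exists_legCost_le`). Conversely a leg can be continued by nearly optimal controls, if
these depend measurably on the posterior. Such a `Family` is built backwards in time
(`exists_family_le_legCost`): the cost of a leg is continuous in the initial state, so that each leg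
which is nearly optimal at a state is nearly optimal on an open set of states, and countably many of
these sets cover the space of states since it is second countable
(`exists_nearly_optimal_family`). Therefore the value function is the infimum of `legCost`
(`value_le_legCost`, `exists_legCost_le_value_add`).

*Analysis on `P(ℝ^d)`.* Three facts are needed. The weak topology is second countable and its Borel
`σ`-algebra is the Giry `σ`-algebra (`secondCountableTopology_prob`, `borelSpace_prob`), by Lévy's
theorem and metrizability. The flow depends continuously on the initial state (`fp_tendsto`):
testing the equation with plane waves gives a Lipschitz bound in time for characteristic functions,
uniform in the control, hence tightness and convergent subsequences, whose limits are identified by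
uniqueness. Finally, pairings with the derivatives of a function of class `S^{1,1}` are continuous
uniformly in the control (`tendsto_integral_sub_of_locally_close`); this gives the chain rule
`Standing.eventually_increment`, which expands `V(s, μ_s) + ∫ ℓ` along an arbitrary controlled path,
with an error `o(s - t)` that does not depend on the control.

*Conclusion.* Inserting the chain rule into the dynamic programming principle, with constant
controls for one inequality and nearly optimal ones for the other, gives the equation
(`Standing.hjb`). Close to the end of a slot neither the state nor the running cost has time to
change, so that the value function tends to the minimal exit cost (`Standing.tendsto_value`). Along
the path of a feedback control given by minimizers the chain rule shows that `V` plus the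
accumulated cost has right derivative `0`, hence is constant in each slot; joining the slots by
backward induction, the cost of such a control is `V` (`Trajectory.IsFeedback.cost_eq`).
-/

noncomputable section

/-! ### The space of probability measures: separability and Borel structure -/

/-- The characteristic function of a probability measure as a continuous map. -/
def charMap {d : ℕ} (μ : Prob d) : C(Eucl d, ℂ) :=
  ⟨charFun (μ : Measure (Eucl d)), by fun_prop⟩

/-- By Lévy's theorem a measure depends continuously on its characteristic function, and the set of
characteristic functions is a separable subspace of `C(ℝ^d, ℂ)`. -/
instance separableSpace_prob (d : ℕ) : TopologicalSpace.SeparableSpace (Prob d) := by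
  have hcont : Continuous (fun φ : range (charMap (d := d)) => φ.2.choose) := by
    rw [continuous_iff_seqContinuous]
    intro x p hx
    refine ProbabilityMeasure.tendsto_of_tendsto_charFun fun ξ => ?_
    have h1 : Tendsto (fun k => (x k : C(Eucl d, ℂ)) ξ) atTop (𝓝 ((p : C(Eucl d, ℂ)) ξ)) :=
      ((ContinuousEvalConst.continuous_eval_const (F := C(Eucl d, ℂ)) ξ).tendsto
        (p : C(Eucl d, ℂ))).comp ((continuous_subtype_val.tendsto p).comp hx)
    have h2 : ∀ q : range (charMap (d := d)),
        charFun (q.2.choose : Measure (Eucl d)) ξ = (q : C(Eucl d, ℂ)) ξ := fun q =>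
      congrArg (fun f : C(Eucl d, ℂ) => f ξ) q.2.choose_spec
    simpa only [Function.comp_def, h2] using h1
  have hinj : ∀ ν μ : Prob d, charMap ν = charMap μ → ν = μ := fun ν μ h =>
    ProbabilityMeasure.toMeasure_injective (Measure.ext_of_charFun
      (congrArg (fun f : C(Eucl d, ℂ) => (f : Eucl d → ℂ)) h))
  refine Function.Surjective.denseRange (fun μ => ?_) |>.separableSpace hcont
  exact ⟨⟨charMap μ, mem_range_self μ⟩, hinj _ _ (mem_range_self μ).choose_spec⟩

instance secondCountableTopology_prob (d : ℕ) : SecondCountableTopology (Prob d) := by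
  let _ := TopologicalSpace.pseudoMetrizableSpacePseudoMetric (Prob d)
  exact UniformSpace.secondCountable_of_separable _

/-- The topology of `P(ℝ^d)` is generated by the preimages of open sets under `μ ↦ ∫ f dμ`. -/
theorem prob_topology_eq_generateFrom (d : ℕ) :
    (inferInstance : TopologicalSpace (Prob d)) = TopologicalSpace.generateFrom
      {s | ∃ (f : Eucl d →ᵇ ℝ) (O : Set ℝ), IsOpen O ∧
        (fun μ : Prob d => ∫ x, f x ∂(μ : Measure (Eucl d))) ⁻¹' O = s} := by
  refine le_antisymm (le_generateFrom ?_) ?_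
  · rintro s ⟨f, O, hO, rfl⟩
    exact hO.preimage (ProbabilityMeasure.continuous_integral_boundedContinuousFunction f)
  · have h : ∀ (X : Type) [TopologicalSpace X] (φ : X → Prob d),
        (∀ f : Eucl d →ᵇ ℝ, Continuous fun x => ∫ y, f y ∂(φ x : Measure (Eucl d))) →
          Continuous φ := fun X _ φ hφ =>
      ProbabilityMeasure.continuous_iff_forall_continuous_integral.2 hφ
    rw [← continuous_id_iff_le]
    refine @h (Prob d) (TopologicalSpace.generateFrom _) id fun f => ?_
    rw [continuous_def]
    intro O hO
    exact TopologicalSpace.isOpen_generateFrom_of_mem ⟨f, O, hO, rfl⟩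

/-- The Giry `σ`-algebra of `P(ℝ^d)` is the Borel `σ`-algebra of the weak topology. -/
instance borelSpace_prob (d : ℕ) : BorelSpace (Prob d) := by
  refine ⟨le_antisymm ?_ ?_⟩
  · have h : @Measurable (Prob d) (Measure (Eucl d)) (borel _) _ (fun μ => (μ : Measure _)) := by
      let _ : MeasurableSpace (Prob d) := borel _
      have _ : BorelSpace (Prob d) := ⟨rfl⟩
      refine Measurable.measure_of_isPiSystem_of_isProbabilityMeasure
        (S := {s | IsClosed s}) ?_ isPiSystem_isClosed ?_
      · rw [← borel_eq_generateFrom_isClosed]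
        exact BorelSpace.measurable_eq
      · intro F hF
        have hF' : IsClosed F := hF
        refine UpperSemicontinuous.measurable ?_
        intro μ y hy
        exact eventually_lt_of_limsup_lt (lt_of_le_of_lt
          (ProbabilityMeasure.limsup_measure_closed_le_of_tendsto tendsto_id hF') hy)
    intro s hs
    obtain ⟨t, ht, rfl⟩ := hs
    exact h ht
  · rw [borel_eq_generateFrom_of_subbasis (prob_topology_eq_generateFrom d)]
    refine MeasurableSpace.generateFrom_le ?_
    rintro s ⟨f, O, hO, rfl⟩
    refine hO.measurableSet.preimage ?_
    let κ : ProbabilityTheory.Kernel (Prob d) (Eucl d) :=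
      ⟨fun μ => (μ : Measure (Eucl d)), measurable_subtype_coe⟩
    have : ProbabilityTheory.IsMarkovKernel κ := ⟨fun μ => μ.2⟩
    exact (StronglyMeasurable.integral_kernel (κ := κ)
      (f := f) f.continuous.stronglyMeasurable).measurable

/-- Integrals of a jointly measurable function against a measurable family of measures. -/
theorem measurable_integral_prob {d : ℕ} {X : Type*} [MeasurableSpace X] {κ : X → Prob d}
    (hκ : Measurable κ) {f : X → Eucl d → ℝ} (hf : Measurable (Function.uncurry f)) :
    Measurable fun x => ∫ y, f x y ∂(κ x : Measure (Eucl d)) := by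
  let k : ProbabilityTheory.Kernel X (Eucl d) := ⟨fun x => (κ x : Measure (Eucl d)),
    measurable_subtype_coe.comp hκ⟩
  have : ProbabilityTheory.IsMarkovKernel k := ⟨fun x => (κ x).2⟩
  exact (StronglyMeasurable.integral_kernel_prod_right' (κ := k)
    hf.stronglyMeasurable).measurable

/-- Lower integrals of a jointly measurable function against a measurable family of measures. -/
theorem measurable_lintegral_prob {d : ℕ} {X : Type*} [MeasurableSpace X] {κ : X → Prob d}
    (hκ : Measurable κ) {f : X → Eucl d → ℝ≥0∞} (hf : Measurable (Function.uncurry f)) :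
    Measurable fun x => ∫⁻ y, f x y ∂(κ x : Measure (Eucl d)) := by
  let k : ProbabilityTheory.Kernel X (Eucl d) := ⟨fun x => (κ x : Measure (Eucl d)),
    measurable_subtype_coe.comp hκ⟩
  have : ProbabilityTheory.IsMarkovKernel k := ⟨fun x => (κ x).2⟩
  exact hf.lintegral_kernel_prod_right' (κ := k)

/-! ### Weak convergence: characteristic functions, tightness, varying integrands -/

/-- Neighbourhoods in `P(ℝ^d)` are detected by characteristic functions, uniformly in the
measure that is compared with a measure close to `μ`. -/
theorem exists_charFun_nhds {d : ℕ} (μ : Prob d) {N : Set (Prob d)} (hN : N ∈ 𝓝 μ)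
    (κ : Eucl d → ℝ) : ∃ δ > 0, ∀ᶠ m : Prob d in 𝓝 μ, ∀ m' : Prob d,
      (∀ ξ, ‖charFun (m' : Measure (Eucl d)) ξ - charFun (m : Measure (Eucl d)) ξ‖ ≤ δ * κ ξ) →
        m' ∈ N := by
  by_contra! hcon
  -- there are `m k → μ` and `m' k ∉ N` whose characteristic functions have the same limit, so that
  -- `m' k → μ` by Lévy's theorem
  obtain ⟨B, hB⟩ := (𝓝 μ).exists_antitone_basis
  have hex : ∀ k : ℕ, ∃ m ∈ B k, ∃ m' : Prob d,
      (∀ ξ, ‖charFun (m' : Measure (Eucl d)) ξ - charFun (m : Measure (Eucl d)) ξ‖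
        ≤ (1 / ((k : ℝ) + 1)) * κ ξ) ∧ m' ∉ N := by
    intro k
    have h1 := hcon (1 / ((k : ℝ) + 1)) (by positivity)
    obtain ⟨m, ⟨m', h3, h4⟩, hm⟩ :=
      (h1.and_eventually (hB.1.mem_of_mem (i := k) trivial)).exists
    exact ⟨m, hm, m', h3, h4⟩
  choose m hm m' hm' hN' using hex
  have hmlim : Tendsto m atTop (𝓝 μ) := hB.tendsto hm
  have hm'lim : Tendsto m' atTop (𝓝 μ) := by
    refine ProbabilityMeasure.tendsto_of_tendsto_charFun fun ξ => ?_
    have h1 := ProbabilityMeasure.tendsto_iff_tendsto_charFun.1 hmlim ξ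
    have h2 : Tendsto (fun k => charFun (m' k : Measure (Eucl d)) ξ
        - charFun (m k : Measure (Eucl d)) ξ) atTop (𝓝 0) := by
      refine squeeze_zero_norm (fun k => hm' k ξ) ?_
      simpa using tendsto_one_div_add_atTop_nhds_zero_nat.mul_const (κ ξ)
    simpa using h2.add h1
  obtain ⟨k, hk⟩ := (hm'lim.eventually hN).exists
  exact hN' k hk

/-- An integral is approximated by finitely many values of the integrand, weighted by a partition of
unity subordinate to sets of small oscillation; the remainder is the mass that the partition, which
only sums to `1` on `K`, misses. -/
theorem abs_integral_sub_sum_partition_le {d : ℕ} {K : Set (Eucl d)} {ι : Type*} [Fintype ι]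
    {W : ι → Set (Eucl d)} (p : PartitionOfUnity ι (Eucl d) K) (hp : p.IsSubordinate W)
    {F : Eucl d → ℝ} (hF : Measurable F) {C ε : ℝ} (hε : 0 ≤ ε) (hC : ∀ x, |F x| ≤ C) (v : ι → ℝ)
    (hv : ∀ i, ∀ y ∈ W i, |F y - v i| ≤ ε) (m : Prob d) :
    |∫ y, F y ∂(m : Measure (Eucl d)) - ∑ i, v i * ∫ y, p i y ∂(m : Measure (Eucl d))|
      ≤ ε + C * ∫ y, (1 - ∑ i, p i y) ∂(m : Measure (Eucl d)) := by
  have hint : ∀ i, Integrable (fun y => p i y) (m : Measure (Eucl d)) := fun i =>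
    Integrable.of_bound (p i).continuous.aestronglyMeasurable 1
      (Eventually.of_forall fun y => by
        rw [Real.norm_eq_abs, abs_of_nonneg (p.nonneg i y)]
        exact p.le_one i y)
  have hsum : Integrable (fun y => ∑ i, p i y) (m : Measure (Eucl d)) :=
    integrable_finsetSum _ fun i _ => hint i
  have hFi : Integrable F (m : Measure (Eucl d)) :=
    Integrable.of_bound hF.aestronglyMeasurable C (Eventually.of_forall hC)
  have hvs : Integrable (fun y => ∑ i, v i * p i y) (m : Measure (Eucl d)) :=
    integrable_finsetSum _ fun i _ => (hint i).const_mul _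
  have hq : ∀ y, 0 ≤ 1 - ∑ i, p i y := fun y => by
    have := p.sum_le_one y
    rw [finsum_eq_sum_of_fintype] at this
    linarith
  have hrem : Integrable (fun y => ε + C * (1 - ∑ i, p i y)) (m : Measure (Eucl d)) :=
    (integrable_const ε).add (((integrable_const 1).sub hsum).const_mul C)
  have e1 : ∫ y, F y ∂(m : Measure (Eucl d)) - ∑ i, v i * ∫ y, p i y ∂(m : Measure (Eucl d))
      = ∫ y, (F y - ∑ i, v i * p i y) ∂(m : Measure (Eucl d)) := by
    rw [integral_sub hFi hvs, integral_finsetSum _ fun i _ => (hint i).const_mul _]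
    simp_rw [integral_const_mul]
  have e2 : ε + C * ∫ y, (1 - ∑ i, p i y) ∂(m : Measure (Eucl d))
      = ∫ y, (ε + C * (1 - ∑ i, p i y)) ∂(m : Measure (Eucl d)) := by
    have h1 : Integrable (fun y => C * (1 - ∑ i, p i y)) (m : Measure (Eucl d)) :=
      ((integrable_const 1).sub hsum).const_mul C
    rw [integral_add (integrable_const ε) h1, integral_const_mul]
    simp
  rw [e1, e2, ← Real.norm_eq_abs]
  refine norm_integral_le_of_norm_le hrem (Eventually.of_forall fun y => ?_)
  have e3 : F y - ∑ i, v i * p i y = ∑ i, p i y * (F y - v i) + (1 - ∑ i, p i y) * F y := by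
    simp_rw [mul_sub, Finset.sum_sub_distrib, ← Finset.sum_mul, mul_comm (p _ y)]
    ring
  rw [e3, Real.norm_eq_abs]
  refine (abs_add_le _ _).trans (add_le_add ?_ ?_)
  · refine (Finset.abs_sum_le_sum_abs _ _).trans ?_
    calc ∑ i, |p i y * (F y - v i)| ≤ ∑ i, p i y * ε := by
          refine Finset.sum_le_sum fun i _ => ?_
          rw [abs_mul, abs_of_nonneg (p.nonneg i y)]
          by_cases h0 : p i y = 0
          · simp [h0]
          · exact mul_le_mul_of_nonneg_left
              (hv i y (hp i (subset_tsupport _ (Function.mem_support.2 h0)))) (p.nonneg i y)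
      _ ≤ ε := by
          rw [← Finset.sum_mul]
          have := hq y
          nlinarith
  · rw [abs_mul, abs_of_nonneg (hq y), mul_comm]
    exact mul_le_mul_of_nonneg_right (hC y) (hq y)

/-- Weak convergence with varying integrands: if `c_i → μ` weakly, `f_i` and `g_i` are uniformly
bounded, and near each point `f_i` and `g_i` are uniformly close to the value of `g_i` at the point,
then `∫ f_i dc_i - ∫ g_i dμ → 0`. The index filter may carry controls without restriction, which
gives uniformity in the control. -/
theorem tendsto_integral_sub_of_locally_close {d : ℕ} {ι : Type*} {L : Filter ι} {c : ι → Prob d}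
    {μ : Prob d} (hc : Tendsto c L (𝓝 μ)) {f g : ι → Eucl d → ℝ} {C : ℝ}
    (hfm : ∀ᶠ i in L, Measurable (f i)) (hgm : ∀ᶠ i in L, Measurable (g i))
    (hfC : ∀ᶠ i in L, ∀ x, |f i x| ≤ C) (hgC : ∀ᶠ i in L, ∀ x, |g i x| ≤ C)
    (hf : ∀ x, Tendsto (fun q : ι × Eucl d => f q.1 q.2 - g q.1 x) (L ×ˢ 𝓝 x) (𝓝 0))
    (hg : ∀ x, Tendsto (fun q : ι × Eucl d => g q.1 q.2 - g q.1 x) (L ×ˢ 𝓝 x) (𝓝 0)) :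
    Tendsto (fun i => ∫ x, f i x ∂(c i : Measure (Eucl d)) - ∫ x, g i x ∂(μ : Measure (Eucl d)))
      L (𝓝 0) := by
  rcases L.eq_or_neBot with rfl | hL
  · simp
  have hC0 : 0 ≤ C := by
    obtain ⟨i, hi⟩ := hfC.exists
    exact (abs_nonneg _).trans (hi 0)
  rw [Metric.tendsto_nhds]
  intro ε hε
  -- the errors made below add up to at most `(2 + 4 * C) * η`, which is less than `ε`
  set η : ℝ := ε / (3 + 4 * C) with hη
  have hη0 : 0 < η := by positivity
  obtain ⟨K, -, hK, hKμ⟩ := MeasurableSet.univ.exists_isCompact_lt_add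
    (measure_ne_top (μ : Measure (Eucl d)) univ)
    (ε := ENNReal.ofReal η) (by simpa using hη0)
  have hKc : (μ : Measure (Eucl d)).real Kᶜ ≤ η := by
    have h1 : (μ : Measure (Eucl d)) Kᶜ ≤ ENNReal.ofReal η := by
      rw [measure_compl hK.measurableSet (measure_ne_top _ _)]
      exact tsub_le_iff_left.2 hKμ.le
    exact ENNReal.toReal_le_of_le_ofReal hη0.le h1
  -- sets on which the integrands oscillate little; finitely many of them cover `K`
  have hW : ∀ x : Eucl d, ∃ W : Set (Eucl d), IsOpen W ∧ x ∈ W ∧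
      ∀ᶠ i in L, ∀ y ∈ W, |f i y - g i x| ≤ η ∧ |g i y - g i x| ≤ η := by
    intro x
    have h1 := (hf x).eventually (Metric.closedBall_mem_nhds (0 : ℝ) hη0)
    have h2 := (hg x).eventually (Metric.closedBall_mem_nhds (0 : ℝ) hη0)
    obtain ⟨A, hA, B, hB, hAB⟩ := eventually_prod_iff.1 (h1.and h2)
    obtain ⟨W, hWB, hWo, hxW⟩ := mem_nhds_iff.1 hB
    refine ⟨W, hWo, hxW, hA.mono fun i hi y hy => ?_⟩
    have := hAB hi (hWB hy)
    simpa [Metric.mem_closedBall, Real.dist_eq] using this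
  choose W hWo hxW hWL using hW
  obtain ⟨t, -, ht⟩ := hK.elim_nhds_subcover W fun x _ => (hWo x).mem_nhds (hxW x)
  obtain ⟨p, hp⟩ := PartitionOfUnity.exists_isSubordinate hK.isClosed
    (fun x : t => W x) (fun x => hWo x) (by simpa [iUnion_subtype] using ht)
  have hpc : ∀ x, Tendsto (fun i => ∫ y, p x y ∂(c i : Measure (Eucl d))) L
      (𝓝 (∫ y, p x y ∂(μ : Measure (Eucl d)))) := fun x => by
    have hb : ∀ y, ‖p x y‖ ≤ 1 := fun y => by
      rw [Real.norm_eq_abs, abs_of_nonneg (p.nonneg x y)]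
      exact p.le_one x y
    exact (ProbabilityMeasure.tendsto_iff_forall_integral_tendsto.1 hc)
      (BoundedContinuousFunction.ofNormedAddCommGroup (p x) (p x).continuous 1 hb)
  have hpi : ∀ x (m : Prob d), Integrable (fun y => p x y) (m : Measure (Eucl d)) := fun i m =>
    Integrable.of_bound (p i).continuous.aestronglyMeasurable 1
      (Eventually.of_forall fun y => by
        rw [Real.norm_eq_abs, abs_of_nonneg (p.nonneg i y)]
        exact p.le_one i y)
  have hrem : ∀ m : Prob d, ∫ y, (1 - ∑ x, p x y) ∂(m : Measure (Eucl d))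
      = 1 - ∑ x, ∫ y, p x y ∂(m : Measure (Eucl d)) := fun m => by
    rw [integral_sub (integrable_const 1) (integrable_finsetSum _ fun i _ => hpi i m),
      integral_finsetSum _ fun i _ => hpi i m]
    simp
  -- the partition of unity misses little mass of `μ`, hence, by weak convergence, of `c i`
  have hqμ : ∫ y, (1 - ∑ x, p x y) ∂(μ : Measure (Eucl d)) ≤ η := by
    calc ∫ y, (1 - ∑ x, p x y) ∂(μ : Measure (Eucl d))
        ≤ ∫ y, Kᶜ.indicator (fun _ => (1 : ℝ)) y ∂(μ : Measure (Eucl d)) := by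
          refine integral_mono
            ((integrable_const 1).sub (integrable_finsetSum _ fun i _ => hpi i μ))
            ((integrable_const 1).indicator hK.measurableSet.compl) fun y => ?_
          have h0 : 0 ≤ ∑ x, p x y := Finset.sum_nonneg fun x _ => p.nonneg x y
          by_cases hy : y ∈ K
          · have := p.sum_eq_one hy
            rw [finsum_eq_sum_of_fintype] at this
            rw [indicator_of_notMem (by simpa using hy), this, sub_self]
          · rw [indicator_of_mem hy]
            linarith
      _ ≤ η := by
          rw [integral_indicator_const _ hK.measurableSet.compl]
          simpa using hKc
  have hqc : ∀ᶠ i in L, ∫ y, (1 - ∑ x, p x y) ∂(c i : Measure (Eucl d)) < 2 * η := by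
    have h1 : Tendsto (fun i => ∫ y, (1 - ∑ x, p x y) ∂(c i : Measure (Eucl d))) L
        (𝓝 (∫ y, (1 - ∑ x, p x y) ∂(μ : Measure (Eucl d)))) := by
      simp_rw [hrem]
      exact tendsto_const_nhds.sub (tendsto_finsetSum _ fun x _ => hpc x)
    exact h1.eventually_lt_const (by linarith)
  have hdiff : ∀ᶠ i in L, ∑ x, |∫ y, p x y ∂(c i : Measure (Eucl d))
      - ∫ y, p x y ∂(μ : Measure (Eucl d))| < η := by
    have h1 : Tendsto (fun i => ∑ x, |∫ y, p x y ∂(c i : Measure (Eucl d))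
      - ∫ y, p x y ∂(μ : Measure (Eucl d))|) L (𝓝 (∑ x : t, |(0 : ℝ)|)) :=
      tendsto_finsetSum _ fun x _ => by
        simpa using ((hpc x).sub_const (∫ y, p x y ∂(μ : Measure (Eucl d)))).abs
    simp only [abs_zero, Finset.sum_const_zero] at h1
    exact h1.eventually_lt_const hη0
  have hall : ∀ᶠ i in L, ∀ x : t, ∀ y ∈ W x, |f i y - g i x| ≤ η ∧ |g i y - g i x| ≤ η :=
    eventually_all.2 fun x => hWL x
  filter_upwards [hfm, hgm, hfC, hgC, hqc, hdiff, hall] with i h1 h2 h3 h4 h5 h6 h7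
  have k1 := abs_integral_sub_sum_partition_le p hp h1 hη0.le h3 (fun x => g i x)
    (fun x y hy => (h7 x y hy).1) (c i)
  have k2 := abs_integral_sub_sum_partition_le p hp h2 hη0.le h4 (fun x => g i x)
    (fun x y hy => (h7 x y hy).2) μ
  have k3 : |∑ x : t, g i x * ∫ y, p x y ∂(c i : Measure (Eucl d))
      - ∑ x : t, g i x * ∫ y, p x y ∂(μ : Measure (Eucl d))| ≤ C * η := by
    rw [← Finset.sum_sub_distrib]
    refine (Finset.abs_sum_le_sum_abs _ _).trans ?_
    refine le_trans ?_ (mul_le_mul_of_nonneg_left h6.le hC0)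
    rw [Finset.mul_sum]
    refine Finset.sum_le_sum fun x _ => ?_
    rw [← mul_sub, abs_mul]
    exact mul_le_mul_of_nonneg_right (h4 _) (abs_nonneg _)
  have k4 : η * (3 + 4 * C) = ε := by
    rw [hη]
    field_simp
  rw [Real.dist_eq, sub_zero]
  have k5 := mul_le_mul_of_nonneg_left h5.le hC0
  have k6 := mul_le_mul_of_nonneg_left hqμ hC0
  rw [abs_le] at k1 k2 k3
  rw [abs_lt]
  constructor <;> nlinarith [k1.1, k1.2, k2.1, k2.2, k3.1, k3.2]

/-- A set of probability measures whose characteristic functions are equicontinuous at `0` is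
tight. -/
theorem isTightMeasureSet_of_charFun {d : ℕ} {S : Set (Prob d)}
    (h : ∀ ε > 0, ∃ δ > 0, ∀ ξ : Eucl d, ‖ξ‖ < δ → ∀ μ ∈ S,
      ‖1 - charFun (μ : Measure (Eucl d)) ξ‖ ≤ ε) :
    IsTightMeasureSet {((μ : Prob d) : Measure (Eucl d)) | μ ∈ S} := by
  refine isTightMeasureSet_of_inner_tendsto ℝ fun z => ?_
  rw [ENNReal.tendsto_nhds_zero]
  intro ε hε
  obtain ⟨η, hη0, hη⟩ : ∃ η : ℝ, 0 < η ∧ ENNReal.ofReal (2 * η) ≤ ε := by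
    rcases eq_or_ne ε ∞ with rfl | hε'
    · exact ⟨1, one_pos, le_top⟩
    · refine ⟨ε.toReal / 2, half_pos (ENNReal.toReal_pos hε.ne' hε'), ?_⟩
      rw [mul_div_cancel₀ _ two_ne_zero, ENNReal.ofReal_toReal hε']
  obtain ⟨δ, hδ, hS⟩ := h η hη0
  have hlim : Tendsto (fun r : ℝ => 2 * r⁻¹ * ‖z‖) atTop (𝓝 0) := by
    simpa using (tendsto_inv_atTop_zero.const_mul 2).mul_const ‖z‖
  filter_upwards [hlim.eventually_lt_const hδ, eventually_gt_atTop 0] with r hr hr0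
  refine iSup₂_le ?_
  rintro _ ⟨μ, hμ, rfl⟩
  have h1 := measureReal_abs_inner_gt_le_integral_charFun (μ := (μ : Measure (Eucl d)))
    (a := z) hr0
  have h2 : ‖∫ t in -2 * r⁻¹..2 * r⁻¹, 1 - charFun (μ : Measure (Eucl d)) (t • z)‖
      ≤ η * |2 * r⁻¹ - -2 * r⁻¹| := by
    refine intervalIntegral.norm_integral_le_of_norm_le_const fun t ht => hS _ ?_ μ hμ
    refine lt_of_le_of_lt ?_ hr
    rw [norm_smul]
    refine mul_le_mul_of_nonneg_right ?_ (norm_nonneg z)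
    have hr1 : 0 < r⁻¹ := inv_pos.2 hr0
    rw [uIoc_of_le (by linarith)] at ht
    rw [Real.norm_eq_abs, abs_le]
    constructor <;> linarith [ht.1, ht.2]
  have h3 : (μ : Measure (Eucl d)).real {x | r < |inner ℝ z x|} ≤ 2 * η := by
    refine h1.trans ?_
    have hr1 : 0 < r⁻¹ := inv_pos.2 hr0
    rw [show 2 * r⁻¹ - -2 * r⁻¹ = 4 * r⁻¹ by ring, abs_of_pos (by positivity)] at h2
    calc 2⁻¹ * r * ‖∫ t in -2 * r⁻¹..2 * r⁻¹, 1 - charFun (μ : Measure (Eucl d)) (t • z)‖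
        ≤ 2⁻¹ * r * (η * (4 * r⁻¹)) := mul_le_mul_of_nonneg_left h2 (by positivity)
      _ = 2 * η := by
        field_simp
        ring
  refine le_trans ?_ hη
  exact (ENNReal.le_ofReal_iff_toReal_le (measure_ne_top _ _) (by positivity)).2
    (by simpa [Measure.real, Real.norm_eq_abs] using h3)

/-- The characteristic functions of a tight set of probability measures are equicontinuous at
`0`. -/
theorem charFun_equicontinuous_of_isTight {d : ℕ} {S : Set (Prob d)}
    (hS : IsTightMeasureSet {((μ : Prob d) : Measure (Eucl d)) | μ ∈ S}) :
    ∀ ε > 0, ∃ δ > 0, ∀ ξ : Eucl d, ‖ξ‖ < δ → ∀ μ ∈ S,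
      ‖1 - charFun (μ : Measure (Eucl d)) ξ‖ ≤ ε := by
  intro ε hε
  obtain ⟨K, hK, hKS⟩ := isTightMeasureSet_iff_exists_isCompact_measure_compl_le.1 hS
    (ENNReal.ofReal (ε / 4)) (by simpa using hε)
  obtain ⟨R, hR0, hR⟩ := hK.isBounded.exists_pos_norm_le
  refine ⟨ε / (2 * R), by positivity, fun ξ hξ μ hμ => ?_⟩
  have hKμ : (μ : Measure (Eucl d)).real Kᶜ ≤ ε / 4 :=
    ENNReal.toReal_le_of_le_ofReal (by positivity) (hKS _ ⟨μ, hμ, rfl⟩)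
  have hmeas : MeasurableSet Kᶜ := hK.measurableSet.compl
  have hexp : Integrable (fun x : Eucl d => Complex.exp (inner ℝ x ξ * Complex.I))
      (μ : Measure (Eucl d)) :=
    Integrable.of_bound (by fun_prop) 1 (Eventually.of_forall fun x => by
      rw [Complex.norm_exp_ofReal_mul_I])
  have e1 : 1 - charFun (μ : Measure (Eucl d)) ξ
      = ∫ x, (1 - Complex.exp (inner ℝ x ξ * Complex.I)) ∂(μ : Measure (Eucl d)) := by
    rw [integral_sub (integrable_const 1) hexp, charFun_apply]
    simp
  rw [e1]
  have hi : Integrable (fun x => ε / 2 + Kᶜ.indicator (fun _ => (2 : ℝ)) x)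
      (μ : Measure (Eucl d)) :=
    (integrable_const _).add ((integrable_const 2).indicator hmeas)
  refine (norm_integral_le_of_norm_le hi (Eventually.of_forall fun x => ?_)).trans ?_
  -- `|1 - exp (i⟨x, ξ⟩)|` is at most `|⟨x, ξ⟩|`, which is small on `K`, and at most `2` elsewhere
  · by_cases hx : x ∈ K
    · have h1 : ‖Complex.exp (inner ℝ x ξ * Complex.I) - 1‖ ≤ ‖inner ℝ x ξ‖ := by
        rw [mul_comm]
        exact Real.norm_exp_I_mul_ofReal_sub_one_le
      rw [norm_sub_rev]
      refine h1.trans ((norm_inner_le_norm x ξ).trans ?_)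
      have h2 := mul_le_mul (hR x hx) hξ.le (norm_nonneg _) hR0.le
      rw [show R * (ε / (2 * R)) = ε / 2 by field_simp] at h2
      simpa [hx] using h2
    · have h1 : ‖1 - Complex.exp (inner ℝ x ξ * Complex.I)‖ ≤ 2 := by
        refine (norm_sub_le _ _).trans ?_
        rw [Complex.norm_exp_ofReal_mul_I]
        norm_num
      simp only [mem_compl_iff, hx, not_false_eq_true, indicator_of_mem]
      linarith
  · rw [integral_add (integrable_const _) ((integrable_const 2).indicator hmeas),
      integral_indicator_const _ hmeas]
    simp only [integral_const, probReal_univ, smul_eq_mul, one_mul]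
    linarith

/-! ### Convex combinations -/

theorem integral_mixture {d : ℕ} (r : unitInterval) (μ ν : Prob d) {f : Eucl d → ℝ}
    (hμ : Integrable f (μ : Measure (Eucl d))) (hν : Integrable f (ν : Measure (Eucl d))) :
    ∫ x, f x ∂(mixture r μ ν : Measure (Eucl d))
      = r * ∫ x, f x ∂(μ : Measure (Eucl d)) + (1 - r) * ∫ x, f x ∂(ν : Measure (Eucl d)) := by
  change ∫ x, f x ∂(ENNReal.ofReal (r : ℝ) • (μ : Measure (Eucl d))
      + ENNReal.ofReal (1 - (r : ℝ)) • (ν : Measure (Eucl d))) = _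
  rw [integral_add_measure (hμ.smul_measure ENNReal.ofReal_ne_top)
    (hν.smul_measure ENNReal.ofReal_ne_top), integral_smul_measure, integral_smul_measure,
    ENNReal.toReal_ofReal r.2.1, ENNReal.toReal_ofReal (sub_nonneg.2 r.2.2)]
  rfl

/-- `mixture r m μ → μ` as `m → μ`, whatever the weights `r`. -/
theorem tendsto_mixture {d : ℕ} {μ : Prob d} {ι : Type*} {L : Filter ι} {m : ι → Prob d}
    (hm : Tendsto m L (𝓝 μ)) (r : ι → unitInterval) :
    Tendsto (fun i => mixture (r i) (m i) μ) L (𝓝 μ) := by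
  rw [ProbabilityMeasure.tendsto_iff_forall_integral_tendsto]
  intro f
  have h1 := ProbabilityMeasure.tendsto_iff_forall_integral_tendsto.1 hm f
  rw [← tendsto_sub_nhds_zero_iff] at h1 ⊢
  refine squeeze_zero_norm (fun i => ?_) (tendsto_zero_iff_norm_tendsto_zero.1 h1)
  rw [integral_mixture (r i) (m i) μ (f.integrable _) (f.integrable _)]
  rw [show ∀ (r a b : ℝ), r * a + (1 - r) * b - b = r * (a - b) by intros; ring, norm_mul]
  refine mul_le_of_le_one_left (norm_nonneg _) ?_
  rw [Real.norm_eq_abs, abs_of_nonneg (r i).2.1]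
  exact (r i).2.2

theorem continuous_mixture {d : ℕ} (μ ν : Prob d) : Continuous fun r => mixture r μ ν := by
  rw [ProbabilityMeasure.continuous_iff_forall_continuous_integral]
  intro f
  simp_rw [integral_mixture _ μ ν (f.integrable _) (f.integrable _)]
  fun_prop

/-! ### The controlled generator -/

theorem continuous_fderiv_of_contDiff_two {d : ℕ} {f : Eucl d → ℝ} (hf : ContDiff ℝ 2 f) :
    Continuous (fderiv ℝ f) := hf.continuous_fderiv (by norm_num)

theorem continuous_fderiv_fderiv_of_contDiff_two {d : ℕ} {f : Eucl d → ℝ} (hf : ContDiff ℝ 2 f) :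
    Continuous (fderiv ℝ (fderiv ℝ f)) :=
  (hf.fderiv_right (m := 1) (by norm_num)).continuous_fderiv (by norm_num)

namespace ObsControl

variable {d k₁ k₂ n : ℕ} {G Y : Type*} [MeasurableSpace G] [MeasurableSpace Y]
  {P : ObsControl d k₁ k₂ n G Y}

/-- `B` bounds the generator: `|G(α) f| ≤ B (‖Df‖ + ‖D²f‖)` for all admissible `α`. -/
def IsGenBound (P : ObsControl d k₁ k₂ n G Y) (B : ℝ) : Prop :=
  0 ≤ B ∧ ∀ α ∈ Prod.fst '' P.U, ∀ (f : Eucl d → ℝ) (x : Eucl d),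
    |P.gen α f x| ≤ B * (‖fderiv ℝ f x‖ + ‖fderiv ℝ (fderiv ℝ f) x‖)

theorem Standing.exists_genBound (hP : P.Standing) : ∃ B, P.IsGenBound B := by
  obtain ⟨Cb, hCb⟩ := hP.b_bdd
  obtain ⟨Ca, hCa⟩ := hP.a_bdd
  refine ⟨d * |Cb| + d * d * |Ca|, by positivity, ?_⟩
  rintro _ ⟨u, hu, rfl⟩ f x
  set p := fderiv ℝ f x
  set q := fderiv ℝ (fderiv ℝ f) x
  have hs : ∀ i : Fin d, ‖EuclideanSpace.single i (1 : ℝ)‖ = 1 := fun i => by simp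
  have h1 : |∑ i, P.b u.1 x i * p (EuclideanSpace.single i 1)| ≤ d * |Cb| * ‖p‖ := by
    refine (Finset.abs_sum_le_sum_abs _ _).trans ?_
    calc ∑ i, |P.b u.1 x i * p (EuclideanSpace.single i 1)| ≤ ∑ _i : Fin d, |Cb| * ‖p‖ := by
          refine Finset.sum_le_sum fun i _ => ?_
          rw [abs_mul]
          refine mul_le_mul ?_ ?_ (abs_nonneg _) (abs_nonneg _)
          · exact (PiLp.norm_apply_le (P.b u.1 x) i).trans ((hCb u hu x).trans (le_abs_self _))
          · simpa [hs i] using p.le_opNorm (EuclideanSpace.single i 1)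
      _ = d * |Cb| * ‖p‖ := by simp [mul_assoc]
  have h2 : |∑ i, ∑ j, P.a u.1 x i j * q (EuclideanSpace.single i 1) (EuclideanSpace.single j 1)|
      ≤ d * d * |Ca| * ‖q‖ := by
    refine (Finset.abs_sum_le_sum_abs _ _).trans ?_
    calc ∑ i, |∑ j, P.a u.1 x i j * q (EuclideanSpace.single i 1) (EuclideanSpace.single j 1)|
        ≤ ∑ _i : Fin d, ∑ _j : Fin d, |Ca| * ‖q‖ := by
          refine Finset.sum_le_sum fun i _ => (Finset.abs_sum_le_sum_abs _ _).trans
            (Finset.sum_le_sum fun j _ => ?_)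
          rw [abs_mul]
          refine mul_le_mul ((hCa u hu x i j).trans (le_abs_self _)) ?_ (abs_nonneg _)
            (abs_nonneg _)
          simpa [hs] using q.le_opNorm₂ (EuclideanSpace.single i 1) (EuclideanSpace.single j 1)
      _ = d * d * |Ca| * ‖q‖ := by simp [mul_assoc]
  have h3 : |P.gen u.1 f x| ≤ d * |Cb| * ‖p‖ + 1 / 2 * (d * d * |Ca| * ‖q‖) := by
    unfold gen
    refine (abs_add_le _ _).trans (add_le_add h1 ?_)
    rw [abs_mul, abs_of_pos (by norm_num : (0 : ℝ) < 1 / 2)]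
    exact mul_le_mul_of_nonneg_left h2 (by norm_num)
  have hp := norm_nonneg p
  have hq := norm_nonneg q
  have k1 : 0 ≤ (d : ℝ) * |Cb| * ‖q‖ := by positivity
  have k2 : 0 ≤ (d : ℝ) * d * |Ca| * ‖p‖ := by positivity
  have k3 : 0 ≤ (d : ℝ) * d * |Ca| * ‖q‖ := by positivity
  nlinarith

theorem Standing.measurable_gen (hP : P.Standing) {f : Eucl d → ℝ} (hf : ContDiff ℝ 2 f) :
    Measurable fun q : Eucl k₁ × Eucl d => P.gen q.1 f q.2 := by
  unfold gen
  have hb : ∀ i, Measurable fun q : Eucl k₁ × Eucl d => P.b q.1 q.2 i := fun i =>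
    (by fun_prop : Measurable fun x : Eucl d => x i).comp hP.b_meas
  have h1 := continuous_fderiv_of_contDiff_two hf
  have h2 := continuous_fderiv_fderiv_of_contDiff_two hf
  have hp : ∀ v, Measurable fun q : Eucl k₁ × Eucl d => fderiv ℝ f q.2 v := fun v =>
    (by fun_prop : Continuous fun q : Eucl k₁ × Eucl d => fderiv ℝ f q.2 v).measurable
  have hq : ∀ v w, Measurable fun q : Eucl k₁ × Eucl d => fderiv ℝ (fderiv ℝ f) q.2 v w :=
    fun v w => (by fun_prop : Continuous
      fun q : Eucl k₁ × Eucl d => fderiv ℝ (fderiv ℝ f) q.2 v w).measurable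
  refine Measurable.add (Finset.measurable_sum _ fun i _ => (hb i).mul (hp _))
    (Measurable.const_mul (Finset.measurable_sum _ fun i _ => Finset.measurable_sum _ fun j _ =>
      (hP.a_meas i j).mul (hq _ _)) _)

/-- Uniform continuity in the control: a bounded coefficient that is equicontinuous in `x`, times a
convergent factor. -/
theorem tendsto_mul_sub_mul {ι : Type*} {l : Filter ι} {A A₀ p : ι → ℝ} {p₀ C : ℝ}
    (hA : Tendsto (fun i => A i - A₀ i) l (𝓝 0)) (hA₀ : ∀ i, |A₀ i| ≤ C)
    (hp : Tendsto p l (𝓝 p₀)) : Tendsto (fun i => A i * p i - A₀ i * p₀) l (𝓝 0) := by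
  have h1 : Tendsto (fun i => (A i - A₀ i) * p i) l (𝓝 0) := by
    simpa using hA.mul hp
  have h2 : Tendsto (fun i => A₀ i * (p i - p₀)) l (𝓝 0) := by
    have h3 : Tendsto (fun i => C * |p i - p₀|) l (𝓝 0) := by
      simpa using ((hp.sub_const p₀).abs).const_mul C
    refine squeeze_zero_norm (fun i => ?_) h3
    rw [norm_mul]
    exact mul_le_mul_of_nonneg_right (hA₀ i) (norm_nonneg _)
  have h4 := h1.add h2
  rw [add_zero] at h4
  exact h4.congr fun i => by ring

/-- An equicontinuous family, read as convergence along a filter that leaves the parameter free. -/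
theorem tendsto_dist_of_equicontinuousAt {ι κ X M : Type*} [TopologicalSpace X]
    [PseudoMetricSpace M] {F : κ → X → M} {x : X} (hF : EquicontinuousAt F x) {L : Filter ι}
    {y : ι → X} (hy : Tendsto y L (𝓝 x)) (u : ι → κ) :
    Tendsto (fun i => dist (F (u i) (y i)) (F (u i) x)) L (𝓝 0) := by
  rw [Metric.tendsto_nhds]
  intro ε hε
  have h1 := Metric.equicontinuousAt_iff_right.1 hF ε hε
  filter_upwards [hy.eventually h1] with i hi
  have := hi (u i)
  rw [Real.dist_eq, sub_zero, abs_of_nonneg dist_nonneg, dist_comm]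
  exact this

theorem Standing.tendsto_gen_sub (hP : P.Standing) {ι : Type*} {L : Filter ι} (u : ι → P.U)
    {y : ι → Eucl d} {x : Eucl d} (hy : Tendsto y L (𝓝 x)) {p : ι → Eucl d → ℝ}
    {p₀ : Eucl d → ℝ}
    (h1 : Tendsto (fun i => fderiv ℝ (p i) (y i)) L (𝓝 (fderiv ℝ p₀ x)))
    (h2 : Tendsto (fun i => fderiv ℝ (fderiv ℝ (p i)) (y i)) L
      (𝓝 (fderiv ℝ (fderiv ℝ p₀) x))) :
    Tendsto (fun i => P.gen (u i).1.1 (p i) (y i) - P.gen (u i).1.1 p₀ x) L (𝓝 0) := by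
  obtain ⟨Cb, hCb⟩ := hP.b_bdd
  obtain ⟨Ca, hCa⟩ := hP.a_bdd
  have hb : ∀ k, Tendsto (fun i => P.b (u i).1.1 (y i) k * fderiv ℝ (p i) (y i)
      (EuclideanSpace.single k 1) - P.b (u i).1.1 x k * fderiv ℝ p₀ x
      (EuclideanSpace.single k 1)) L (𝓝 0) := fun k => by
    refine tendsto_mul_sub_mul (C := Cb) ?_ (fun i => ?_) ?_
    · refine squeeze_zero_norm (fun i => ?_)
        (tendsto_dist_of_equicontinuousAt (hP.b_cont x) hy u)
      rw [dist_eq_norm]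
      exact PiLp.norm_apply_le (P.b (u i).1.1 (y i) - P.b (u i).1.1 x) k
    · exact (PiLp.norm_apply_le (P.b (u i).1.1 x) k).trans (hCb _ (u i).2 x)
    · exact ((ContinuousLinearMap.apply ℝ ℝ (EuclideanSpace.single k (1 : ℝ))).continuous.tendsto
        (fderiv ℝ p₀ x)).comp h1
  have ha : ∀ k l, Tendsto (fun i => P.a (u i).1.1 (y i) k l * fderiv ℝ (fderiv ℝ (p i)) (y i)
      (EuclideanSpace.single k 1) (EuclideanSpace.single l 1) - P.a (u i).1.1 x k l *
      fderiv ℝ (fderiv ℝ p₀) x (EuclideanSpace.single k 1) (EuclideanSpace.single l 1))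
      L (𝓝 0) := fun k l => by
    refine tendsto_mul_sub_mul (C := Ca) ?_ (fun i => hCa _ (u i).2 x k l) ?_
    · exact squeeze_zero_norm (fun i => (Real.dist_eq _ _).ge)
        (tendsto_dist_of_equicontinuousAt (hP.a_cont k l x) hy u)
    · have hc : Continuous fun q : Eucl d →L[ℝ] Eucl d →L[ℝ] ℝ =>
          q (EuclideanSpace.single k (1 : ℝ)) (EuclideanSpace.single l (1 : ℝ)) := by fun_prop
      exact (hc.tendsto (fderiv ℝ (fderiv ℝ p₀) x)).comp h2
  have h3 := (tendsto_finsetSum Finset.univ fun k _ => hb k).add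
    ((tendsto_finsetSum Finset.univ fun k _ => tendsto_finsetSum Finset.univ
      fun l _ => ha k l).const_mul (1 / 2))
  simp only [Finset.sum_const_zero, mul_zero, add_zero] at h3
  refine h3.congr fun i => ?_
  simp only [gen, Finset.sum_sub_distrib]
  ring

/-- Joint continuity of `(m, p) ↦ ⟨G(α)^* m, p⟩`, uniform in the control. -/
theorem Standing.tendsto_adjPair_sub (hP : P.Standing) {ι : Type*} {L : Filter ι} (u : ι → P.U)
    {c : ι → Prob d} {c₀ : Prob d} (hc : Tendsto c L (𝓝 c₀)) {p : ι → Eucl d → ℝ}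
    {p₀ : Eucl d → ℝ} (hp₀ : ContDiff ℝ 2 p₀) {C : ℝ}
    (hC₀ : ∀ x, ‖fderiv ℝ p₀ x‖ ≤ C ∧ ‖fderiv ℝ (fderiv ℝ p₀) x‖ ≤ C)
    (hp : ∀ᶠ i in L, ContDiff ℝ 2 (p i))
    (hC : ∀ᶠ i in L, ∀ x, ‖fderiv ℝ (p i) x‖ ≤ C ∧ ‖fderiv ℝ (fderiv ℝ (p i)) x‖ ≤ C)
    (h1 : ∀ x, Tendsto (fun q : ι × Eucl d => fderiv ℝ (p q.1) q.2) (L ×ˢ 𝓝 x)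
      (𝓝 (fderiv ℝ p₀ x)))
    (h2 : ∀ x, Tendsto (fun q : ι × Eucl d => fderiv ℝ (fderiv ℝ (p q.1)) q.2) (L ×ˢ 𝓝 x)
      (𝓝 (fderiv ℝ (fderiv ℝ p₀) x))) :
    Tendsto (fun i => P.adjPair (u i).1.1 (c i) (p i) - P.adjPair (u i).1.1 c₀ p₀) L (𝓝 0) := by
  obtain ⟨B, hB0, hB⟩ := hP.exists_genBound
  have hbd : ∀ (v : P.U) (q : Eucl d → ℝ),
      (∀ x, ‖fderiv ℝ q x‖ ≤ C ∧ ‖fderiv ℝ (fderiv ℝ q) x‖ ≤ C) →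
        ∀ x, |P.gen v.1.1 q x| ≤ B * (C + C) := fun v q hq x =>
    (hB _ ⟨v.1, v.2, rfl⟩ q x).trans
      (mul_le_mul_of_nonneg_left (add_le_add (hq x).1 (hq x).2) hB0)
  have hms : ∀ (v : P.U) {q : Eucl d → ℝ}, ContDiff ℝ 2 q → Measurable (P.gen v.1.1 q) :=
    fun v q hq => (hP.measurable_gen hq).comp measurable_prodMk_left
  refine tendsto_integral_sub_of_locally_close (C := B * (C + C)) hc
    (f := fun i => P.gen (u i).1.1 (p i)) (g := fun i => P.gen (u i).1.1 p₀)
    (hp.mono fun i hi => hms (u i) hi) (Eventually.of_forall fun i => hms (u i) hp₀)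
    (hC.mono fun i hi => hbd (u i) _ hi) (Eventually.of_forall fun i => hbd (u i) _ hC₀)
    (fun x => ?_) (fun x => ?_)
  · exact hP.tendsto_gen_sub (fun q : ι × Eucl d => u q.1) tendsto_snd (h1 x) (h2 x)
  · exact hP.tendsto_gen_sub (fun q : ι × Eucl d => u q.1) (p := fun _ => p₀) tendsto_snd
      (((continuous_fderiv_of_contDiff_two hp₀).tendsto x).comp tendsto_snd)
      (((continuous_fderiv_fderiv_of_contDiff_two hp₀).tendsto x).comp tendsto_snd)

theorem IsGenBound.abs_adjPair_le {B : ℝ} (hB : P.IsGenBound B) {α : Eucl k₁}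
    (hα : α ∈ Prod.fst '' P.U) (μ : Prob d) {f : Eucl d → ℝ} {C₁ C₂ : ℝ}
    (hC : ∀ x, ‖fderiv ℝ f x‖ ≤ C₁ ∧ ‖fderiv ℝ (fderiv ℝ f) x‖ ≤ C₂) :
    |P.adjPair α μ f| ≤ B * (C₁ + C₂) := by
  have := norm_integral_le_of_norm_le_const (μ := (μ : Measure (Eucl d))) (f := P.gen α f)
    (C := B * (C₁ + C₂)) (Eventually.of_forall fun x => (hB.2 α hα f x).trans
      (mul_le_mul_of_nonneg_left (add_le_add (hC x).1 (hC x).2) hB.1))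
  simpa [adjPair] using this

/-- The integrand of the weak Fokker–Planck equation is integrable along continuous curves. -/
theorem Standing.intervalIntegrable_adjPair (hP : P.Standing) {α : ℝ → Eucl k₁}
    (hα : Measurable α) {r₁ r₂ : ℝ} (hαU : ∀ t ∈ Icc r₁ r₂, α t ∈ Prod.fst '' P.U)
    {c : ℝ → Prob d} (hc : ContinuousOn c (Icc r₁ r₂)) {f : Eucl d → ℝ} (hf : IsCb2 f) {s t : ℝ}
    (hs : s ∈ Icc r₁ r₂) (ht : t ∈ Icc r₁ r₂) :
    IntervalIntegrable (fun r => P.adjPair (α r) (c r) f) volume s t := by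
  obtain ⟨B, hB⟩ := hP.exists_genBound
  obtain ⟨hf2, C, hC⟩ := hf
  have hr : r₁ ≤ r₂ := hs.1.trans hs.2
  have hc' : Continuous fun r => c (projIcc r₁ r₂ hr r) :=
    hc.comp_continuous (continuous_subtype_val.comp continuous_projIcc) fun r => Subtype.prop _
  have hmeas : Measurable fun r => P.adjPair (α r) (c (projIcc r₁ r₂ hr r)) f :=
    measurable_integral_prob (f := fun r x => P.gen (α r) f x) hc'.measurable
      ((hP.measurable_gen hf2).comp ((hα.comp measurable_fst).prodMk measurable_snd))
  have hon : IntegrableOn (fun r => P.adjPair (α r) (c r) f) (Icc r₁ r₂) := by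
    have h1 : IntegrableOn (fun r => P.adjPair (α r) (c (projIcc r₁ r₂ hr r)) f)
        (Icc r₁ r₂) := by
      refine Measure.integrableOn_of_bounded (M := B * (C + C)) (by simp)
        hmeas.aestronglyMeasurable ?_
      refine (ae_restrict_iff' measurableSet_Icc).2 (Eventually.of_forall fun r hr' => ?_)
      exact hB.abs_adjPair_le (hαU r hr') _ fun x => ⟨(hC x).2.1, (hC x).2.2⟩
    refine h1.congr_fun (fun r hr' => ?_) measurableSet_Icc
    simp only [projIcc_of_mem hr hr']
  refine (hon.mono_set ?_).intervalIntegrable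
  exact ordConnected_Icc.uIcc_subset hs ht

/-! ### Weak solutions of the Fokker–Planck equation -/

theorem IsFPSolution.integral_eq (hP : P.Standing) {α : ℝ → Eucl k₁} (hα : Measurable α)
    {r₁ r₂ : ℝ} (hαU : ∀ t ∈ Icc r₁ r₂, α t ∈ Prod.fst '' P.U) {c : ℝ → Prob d}
    (hc : P.IsFPSolution α r₁ r₂ c) {f : Eucl d → ℝ} (hf : IsCb2 f) {s t : ℝ}
    (hs : s ∈ Icc r₁ r₂) (ht : t ∈ Icc r₁ r₂) :
    ∫ x, f x ∂(c t : Measure (Eucl d)) = ∫ x, f x ∂(c s : Measure (Eucl d))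
      + ∫ r in s..t, P.adjPair (α r) (c r) f := by
  have hr : r₁ ∈ Icc r₁ r₂ := ⟨le_rfl, hs.1.trans hs.2⟩
  have h1 := hc.2 f hf t ht
  have h2 := hc.2 f hf s hs
  have h3 := intervalIntegral.integral_add_adjacent_intervals
    (hP.intervalIntegrable_adjPair hα hαU hc.1 hf hr hs)
    (hP.intervalIntegrable_adjPair hα hαU hc.1 hf hs ht)
  linarith

theorem IsFPSolution.restrict (hP : P.Standing) {α : ℝ → Eucl k₁} (hα : Measurable α)
    {r₁ r₂ : ℝ} (hαU : ∀ t ∈ Icc r₁ r₂, α t ∈ Prod.fst '' P.U) {c : ℝ → Prob d}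
    (hc : P.IsFPSolution α r₁ r₂ c) {s t : ℝ} (hs : r₁ ≤ s) (ht : t ≤ r₂) :
    P.IsFPSolution α s t c := by
  have hsub : Icc s t ⊆ Icc r₁ r₂ := Icc_subset_Icc hs ht
  refine ⟨hc.1.mono hsub, fun f hf r hr => ?_⟩
  exact hc.integral_eq hP hα hαU hf (hsub ⟨le_rfl, hr.1.trans hr.2⟩) (hsub hr)

theorem IsFPSolution.congr {α α' : ℝ → Eucl k₁} {r₁ r₂ : ℝ} {c c' : ℝ → Prob d}
    (hc : P.IsFPSolution α r₁ r₂ c) (hαα' : EqOn α α' (Ico r₁ r₂)) (hcc' : EqOn c c' (Icc r₁ r₂)) :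
    P.IsFPSolution α' r₁ r₂ c' := by
  refine ⟨hc.1.congr fun t ht => (hcc' ht).symm, fun f hf t ht => ?_⟩
  rw [← hcc' ht, ← hcc' ⟨le_rfl, ht.1.trans ht.2⟩, hc.2 f hf t ht]
  congr 1
  refine intervalIntegral.integral_congr_Ioo_of_le ht.1 fun r hr => ?_
  rw [hαα' ⟨hr.1.le, hr.2.trans_le ht.2⟩, hcc' ⟨hr.1.le, hr.2.le.trans ht.2⟩]

/-- Concatenation of two solutions. -/
theorem IsFPSolution.glue (hP : P.Standing) {α : ℝ → Eucl k₁} (hα : Measurable α)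
    {r₁ s r₂ : ℝ} (h₁ : r₁ ≤ s) (h₂ : s ≤ r₂) (hαU : ∀ t ∈ Icc r₁ r₂, α t ∈ Prod.fst '' P.U)
    {c c' : ℝ → Prob d} (hc : P.IsFPSolution α r₁ s c) (hc' : P.IsFPSolution α s r₂ c')
    (hs : c s = c' s) : P.IsFPSolution α r₁ r₂ fun t => if t ≤ s then c t else c' t := by
  have e1 : EqOn c (fun t => if t ≤ s then c t else c' t) (Icc r₁ s) := fun t ht => by
    simp [ht.2]
  have e2 : EqOn c' (fun t => if t ≤ s then c t else c' t) (Icc s r₂) := fun t ht => by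
    rcases eq_or_lt_of_le ht.1 with rfl | h
    · simp [hs]
    · simp [not_le.2 h]
  have hl := hc.congr (fun _ _ => rfl) e1
  have hr := hc'.congr (fun _ _ => rfl) e2
  set k : ℝ → Prob d := fun t => if t ≤ s then c t else c' t
  have hk : ContinuousOn k (Icc r₁ r₂) := by
    rw [← Icc_union_Icc_eq_Icc h₁ h₂]
    exact hl.1.union_of_isClosed hr.1 isClosed_Icc isClosed_Icc
  refine ⟨hk, fun f hf t ht => ?_⟩
  rcases le_total t s with hts | hst
  · exact hl.2 f hf t ⟨ht.1, hts⟩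
  · have i1 := hr.2 f hf t ⟨hst, ht.2⟩
    have i2 := hl.2 f hf s ⟨h₁, le_rfl⟩
    have i3 := intervalIntegral.integral_add_adjacent_intervals
      (hP.intervalIntegrable_adjPair hα hαU hk hf ⟨le_rfl, h₁.trans h₂⟩ ⟨h₁, h₂⟩)
      (hP.intervalIntegrable_adjPair hα hαU hk hf ⟨h₁, h₂⟩ ht)
    linarith

end ObsControl

/-! ### Plane waves as test functions -/

/-- A bounded smooth function of `⟨ξ, x⟩` is a test function, with derivative bounds that tend to
`0` as `ξ → 0`. -/
theorem isCb2_comp_inner {d : ℕ} {φ : ℝ → ℝ} (hφ : ContDiff ℝ 2 φ) (h0 : ∀ t, |φ t| ≤ 1)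
    (h1 : ∀ t, |deriv φ t| ≤ 1) (h2 : ∀ t, |deriv (deriv φ) t| ≤ 1) (ξ : Eucl d) :
    IsCb2 (fun x : Eucl d => φ (inner ℝ ξ x)) ∧
      ∀ x, ‖fderiv ℝ (fun x : Eucl d => φ (inner ℝ ξ x)) x‖ ≤ ‖ξ‖ ∧
        ‖fderiv ℝ (fderiv ℝ (fun x : Eucl d => φ (inner ℝ ξ x))) x‖ ≤ ‖ξ‖ ^ 2 := by
  set L : Eucl d →L[ℝ] ℝ := innerSL ℝ ξ with hL
  have hLn : ‖L‖ = ‖ξ‖ := innerSL_apply_norm ℝ ξ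
  have hf : (fun x : Eucl d => φ (inner ℝ ξ x)) = fun x => φ (L x) := rfl
  have hd1 : ContDiff ℝ 1 (deriv φ) := by
    have h : ContDiff ℝ (1 + 1) φ := by simpa [one_add_one_eq_two] using hφ
    exact (contDiff_succ_iff_deriv.1 h).2.2
  have e1 : fderiv ℝ (fun x => φ (L x)) = fun x => deriv φ (L x) • L := by
    funext x
    have : HasDerivAt φ (deriv φ (L x)) (L x) :=
      (hφ.differentiable (by norm_num) (L x)).hasDerivAt
    exact (this.comp_hasFDerivAt x L.hasFDerivAt).fderiv
  have e2 : ∀ x, fderiv ℝ (fun x => deriv φ (L x) • L) x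
      = (deriv (deriv φ) (L x) • L).smulRight L := by
    intro x
    have : HasDerivAt (deriv φ) (deriv (deriv φ) (L x)) (L x) :=
      (hd1.differentiable (by norm_num) (L x)).hasDerivAt
    exact ((this.comp_hasFDerivAt x L.hasFDerivAt).smul_const L).fderiv
  have b1 : ∀ x, ‖fderiv ℝ (fun x => φ (L x)) x‖ ≤ ‖ξ‖ := fun x => by
    rw [e1, norm_smul, hLn]
    exact mul_le_of_le_one_left (norm_nonneg _) (h1 _)
  have b2 : ∀ x, ‖fderiv ℝ (fderiv ℝ (fun x => φ (L x))) x‖ ≤ ‖ξ‖ ^ 2 := fun x => by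
    rw [e1, e2, ContinuousLinearMap.norm_smulRight_apply, norm_smul, hLn, pow_two]
    exact mul_le_mul_of_nonneg_right (mul_le_of_le_one_left (norm_nonneg _) (h2 _))
      (norm_nonneg _)
  rw [hf]
  refine ⟨⟨hφ.comp L.contDiff, 1 + ‖ξ‖ + ‖ξ‖ ^ 2, fun x => ⟨?_, ?_, ?_⟩⟩,
    fun x => ⟨b1 x, b2 x⟩⟩
  · have := h0 (L x)
    nlinarith [norm_nonneg ξ, sq_nonneg ‖ξ‖]
  · have := b1 x
    nlinarith [norm_nonneg ξ, sq_nonneg ‖ξ‖]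
  · have := b2 x
    nlinarith [norm_nonneg ξ, sq_nonneg ‖ξ‖]

theorem charFun_eq_cos_add_sin {d : ℕ} (μ : Prob d) (ξ : Eucl d) :
    charFun (μ : Measure (Eucl d)) ξ
      = (∫ x, Real.cos (inner ℝ ξ x) ∂(μ : Measure (Eucl d)) : ℝ)
        + (∫ x, Real.sin (inner ℝ ξ x) ∂(μ : Measure (Eucl d)) : ℝ) * Complex.I := by
  have i1 : Integrable (fun x => Real.cos (inner ℝ ξ x)) (μ : Measure (Eucl d)) :=
    Integrable.of_bound (by fun_prop) 1 (Eventually.of_forall fun x => Real.abs_cos_le_one _)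
  have i2 : Integrable (fun x => Real.sin (inner ℝ ξ x)) (μ : Measure (Eucl d)) :=
    Integrable.of_bound (by fun_prop) 1 (Eventually.of_forall fun x => Real.abs_sin_le_one _)
  have j1 : Integrable (fun x => (Real.cos (inner ℝ ξ x) : ℂ)) (μ : Measure (Eucl d)) :=
    i1.ofReal
  have j2 : Integrable (fun x => (Real.sin (inner ℝ ξ x) : ℂ)) (μ : Measure (Eucl d)) :=
    i2.ofReal
  rw [charFun_apply, ← integral_complex_ofReal, ← integral_complex_ofReal, ← integral_mul_const,
    ← integral_add j1 (j2.mul_const _)]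
  refine integral_congr_ae (Eventually.of_forall fun x => ?_)
  beta_reduce
  rw [Complex.exp_mul_I, real_inner_comm]
  simp

namespace ObsControl

variable {d k₁ k₂ n : ℕ} {G Y : Type*} [MeasurableSpace G] [MeasurableSpace Y]
  {P : ObsControl d k₁ k₂ n G Y}

theorem IsGenBound.abs_integral_sub_le (hP : P.Standing) {B : ℝ} (hB : P.IsGenBound B)
    {α : ℝ → Eucl k₁} (hα : Measurable α) {r₁ r₂ : ℝ}
    (hαU : ∀ t ∈ Icc r₁ r₂, α t ∈ Prod.fst '' P.U) {c : ℝ → Prob d}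
    (hc : P.IsFPSolution α r₁ r₂ c) {f : Eucl d → ℝ} (hf : IsCb2 f) {C₁ C₂ : ℝ}
    (hC : ∀ x, ‖fderiv ℝ f x‖ ≤ C₁ ∧ ‖fderiv ℝ (fderiv ℝ f) x‖ ≤ C₂) {s t : ℝ}
    (hs : s ∈ Icc r₁ r₂) (ht : t ∈ Icc r₁ r₂) :
    |∫ x, f x ∂(c t : Measure (Eucl d)) - ∫ x, f x ∂(c s : Measure (Eucl d))|
      ≤ B * (C₁ + C₂) * |t - s| := by
  rw [hc.integral_eq hP hα hαU hf hs ht, add_sub_cancel_left, ← Real.norm_eq_abs]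
  refine intervalIntegral.norm_integral_le_of_norm_le_const fun r hr => ?_
  exact hB.abs_adjPair_le (hαU r (ordConnected_Icc.uIcc_subset hs ht (uIoc_subset_uIcc hr))) _ hC

/-- The modulus of the characteristic functions along solutions of the Fokker–Planck equation. -/
def waveModulus {d : ℕ} (B : ℝ) (ξ : Eucl d) : ℝ := 2 * (B * (‖ξ‖ + ‖ξ‖ ^ 2))

/-- Along solutions of the Fokker–Planck equation characteristic functions are Lipschitz in time,
with a constant that does not depend on the control. -/
theorem IsGenBound.norm_charFun_sub_le (hP : P.Standing) {B : ℝ} (hB : P.IsGenBound B)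
    {α : ℝ → Eucl k₁} (hα : Measurable α) {r₁ r₂ : ℝ}
    (hαU : ∀ t ∈ Icc r₁ r₂, α t ∈ Prod.fst '' P.U) {c : ℝ → Prob d}
    (hc : P.IsFPSolution α r₁ r₂ c) {s t : ℝ} (hs : s ∈ Icc r₁ r₂) (ht : t ∈ Icc r₁ r₂)
    (ξ : Eucl d) :
    ‖charFun (c t : Measure (Eucl d)) ξ - charFun (c s : Measure (Eucl d)) ξ‖
      ≤ |t - s| * waveModulus B ξ := by
  have hcos := isCb2_comp_inner (φ := Real.cos) Real.contDiff_cos Real.abs_cos_le_one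
    (fun t => by simpa using Real.abs_sin_le_one t)
    (fun t => by simpa [Real.deriv_cos'] using Real.abs_cos_le_one t) ξ
  have hsin := isCb2_comp_inner (φ := Real.sin) Real.contDiff_sin Real.abs_sin_le_one
    (fun t => by simpa using Real.abs_cos_le_one t)
    (fun t => by simpa [Real.deriv_cos'] using Real.abs_sin_le_one t) ξ
  have h1 := hB.abs_integral_sub_le hP hα hαU hc hcos.1 hcos.2 hs ht
  have h2 := hB.abs_integral_sub_le hP hα hαU hc hsin.1 hsin.2 hs ht
  rw [charFun_eq_cos_add_sin, charFun_eq_cos_add_sin]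
  rw [show ∀ a b a' b' : ℝ, ((a : ℂ) + b * Complex.I) - (a' + b' * Complex.I)
    = ((a - a' : ℝ) : ℂ) + ((b - b' : ℝ) : ℂ) * Complex.I by intros; push_cast; ring]
  refine (norm_add_le _ _).trans ?_
  rw [norm_mul, Complex.norm_I, mul_one, Complex.norm_real, Complex.norm_real, waveModulus,
    Real.norm_eq_abs, Real.norm_eq_abs]
  nlinarith

end ObsControl

/-! ### Stability of the Fokker–Planck flow -/

namespace ObsControl

variable {d k₁ k₂ n : ℕ} {G Y : Type*} [MeasurableSpace G] [MeasurableSpace Y]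
  {P : ObsControl d k₁ k₂ n G Y}

theorem waveModulus_nonneg {d : ℕ} {B : ℝ} (hB : 0 ≤ B) (ξ : Eucl d) : 0 ≤ waveModulus B ξ := by
  unfold waveModulus
  positivity

theorem tendsto_charFun_eval {d : ℕ} {c : ℕ → Prob d} {m : Prob d} (h : Tendsto c atTop (𝓝 m))
    (ξ : Eucl d) : Tendsto (fun k => charFun (c k : Measure (Eucl d)) ξ) atTop
      (𝓝 (charFun (m : Measure (Eucl d)) ξ)) :=
  ProbabilityMeasure.tendsto_iff_tendsto_charFun.1 h ξ

/-- Solutions whose initial data converge stay in a compact set of measures. -/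
theorem Standing.isCompact_closure_fp (hP : P.Standing) {α : ℝ → Eucl k₁} (hα : Measurable α)
    {r₁ r₂ : ℝ} (h12 : r₁ ≤ r₂) (hαU : ∀ t ∈ Icc r₁ r₂, α t ∈ Prod.fst '' P.U)
    {c : ℕ → ℝ → Prob d} (hc : ∀ k, P.IsFPSolution α r₁ r₂ (c k)) {ν : Prob d}
    (hν : Tendsto (fun k => c k r₁) atTop (𝓝 ν)) :
    IsCompact (closure {m | ∃ k, ∃ t ∈ Icc r₁ r₂, m = c k t}) := by
  obtain ⟨B, hB⟩ := hP.exists_genBound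
  have hr₁ : r₁ ∈ Icc r₁ r₂ := ⟨le_rfl, h12⟩
  -- tightness of the initial data makes their characteristic functions equicontinuous at `0`, and
  -- this property is propagated in time by the Lipschitz bound
  have hstart : IsTightMeasureSet
      {((μ : Prob d) : Measure (Eucl d)) | μ ∈ range fun k => c k r₁} :=
    isTightMeasureSet_of_isCompact_closure
      (hν.isCompact_insert_range.closure_of_subset (subset_insert _ _))
  refine isCompact_closure_of_isTightMeasureSet (isTightMeasureSet_of_charFun fun ε hε => ?_)
  obtain ⟨δ₁, hδ₁, h1⟩ := charFun_equicontinuous_of_isTight hstart (ε / 2) (half_pos hε)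
  have hw : Tendsto (fun ξ : Eucl d => (r₂ - r₁) * waveModulus B ξ) (𝓝 0) (𝓝 0) := by
    have : Continuous fun ξ : Eucl d => (r₂ - r₁) * waveModulus B ξ := by
      unfold waveModulus
      fun_prop
    simpa [waveModulus] using this.tendsto 0
  obtain ⟨δ₂, hδ₂, h2⟩ := Metric.eventually_nhds_iff.1
    (hw.eventually_lt_const (half_pos hε))
  refine ⟨min δ₁ δ₂, lt_min hδ₁ hδ₂, ?_⟩
  rintro ξ hξ _ ⟨k, t, ht, rfl⟩
  have e1 := h1 ξ (hξ.trans_le (min_le_left _ _)) _ ⟨k, rfl⟩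
  have e2 := h2 (show dist ξ 0 < δ₂ by simpa using hξ.trans_le (min_le_right _ _))
  have e3 := hB.norm_charFun_sub_le hP hα hαU (hc k) hr₁ ht ξ
  have e4 : |t - r₁| * waveModulus B ξ ≤ (r₂ - r₁) * waveModulus B ξ := by
    refine mul_le_mul_of_nonneg_right ?_ (waveModulus_nonneg hB.1 ξ)
    rw [abs_of_nonneg (sub_nonneg.2 ht.1)]
    linarith [ht.2]
  have e5 : ‖1 - charFun (c k t : Measure (Eucl d)) ξ‖
      ≤ ‖1 - charFun (c k r₁ : Measure (Eucl d)) ξ‖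
        + ‖charFun (c k t : Measure (Eucl d)) ξ - charFun (c k r₁ : Measure (Eucl d)) ξ‖ := by
    rw [show 1 - charFun (c k t : Measure (Eucl d)) ξ
      = (1 - charFun (c k r₁ : Measure (Eucl d)) ξ)
        - (charFun (c k t : Measure (Eucl d)) ξ - charFun (c k r₁ : Measure (Eucl d)) ξ) by ring]
    exact norm_sub_le _ _
  linarith

/-- Weak limits of solutions for a fixed control are solutions. -/
theorem Standing.isFPSolution_of_tendsto (hP : P.Standing) {α : ℝ → Eucl k₁} (hα : Measurable α)
    {r₁ r₂ : ℝ} (h12 : r₁ ≤ r₂) (hαU : ∀ t ∈ Icc r₁ r₂, α t ∈ Prod.fst '' P.U)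
    {c : ℕ → ℝ → Prob d} (hc : ∀ k, P.IsFPSolution α r₁ r₂ (c k)) {c' : ℝ → Prob d}
    (hc' : ∀ t ∈ Icc r₁ r₂, Tendsto (fun k => c k t) atTop (𝓝 (c' t))) :
    P.IsFPSolution α r₁ r₂ c' := by
  obtain ⟨B, hB⟩ := hP.exists_genBound
  have hr₁ : r₁ ∈ Icc r₁ r₂ := ⟨le_rfl, h12⟩
  have hcont : ContinuousOn c' (Icc r₁ r₂) := by
    intro t ht
    rw [ContinuousWithinAt, tendsto_iff_seq_tendsto]
    intro x hx
    have hx1 : Tendsto x atTop (𝓝 t) := hx.mono_right nhdsWithin_le_nhds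
    have hx2 : ∀ᶠ k in atTop, x k ∈ Icc r₁ r₂ := hx.eventually self_mem_nhdsWithin
    refine ProbabilityMeasure.tendsto_of_tendsto_charFun fun ξ => ?_
    rw [← tendsto_sub_nhds_zero_iff]
    have hw : Tendsto (fun k => |x k - t| * waveModulus B ξ) atTop (𝓝 0) := by
      simpa using ((hx1.sub_const t).abs).mul_const (waveModulus B ξ)
    refine squeeze_zero_norm' ?_ hw
    filter_upwards [hx2] with k hk
    exact le_of_tendsto
      ((tendsto_charFun_eval (hc' _ hk) ξ).sub (tendsto_charFun_eval (hc' t ht) ξ)).norm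
      (Eventually.of_forall fun j => hB.norm_charFun_sub_le hP hα hαU (hc j) ht hk ξ)
  refine ⟨hcont, fun f hf t ht => ?_⟩
  obtain ⟨hf2, C, hC⟩ := id hf
  have hCf : ∀ x, ‖fderiv ℝ f x‖ ≤ C ∧ ‖fderiv ℝ (fderiv ℝ f) x‖ ≤ C := fun x => (hC x).2
  have hlim : ∀ s ∈ Icc r₁ r₂, Tendsto (fun k => ∫ x, f x ∂(c k s : Measure (Eucl d))) atTop
      (𝓝 (∫ x, f x ∂(c' s : Measure (Eucl d)))) := fun s hs =>
    (ProbabilityMeasure.tendsto_iff_forall_integral_tendsto.1 (hc' s hs))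
      (BoundedContinuousFunction.ofNormedAddCommGroup f hf2.continuous C fun x => (hC x).1)
  have hsub : uIoc r₁ t ⊆ Icc r₁ r₂ := by
    rw [uIoc_of_le ht.1]
    exact fun r hr => ⟨hr.1.le, hr.2.trans ht.2⟩
  have hint : Tendsto (fun k => ∫ r in r₁..t, P.adjPair (α r) (c k r) f) atTop
      (𝓝 (∫ r in r₁..t, P.adjPair (α r) (c' r) f)) := by
    refine intervalIntegral.tendsto_integral_filter_of_dominated_convergence
      (fun _ => B * (C + C)) (Eventually.of_forall fun k => ?_)
      (Eventually.of_forall fun k => ?_) intervalIntegrable_const ?_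
    · exact (intervalIntegrable_iff.1
        (hP.intervalIntegrable_adjPair hα hαU (hc k).1 hf hr₁ ht)).aestronglyMeasurable
    · exact Eventually.of_forall fun r hr => hB.abs_adjPair_le (hαU r (hsub hr)) _ hCf
    · refine Eventually.of_forall fun r hr => ?_
      obtain ⟨u, hu, hur⟩ := hαU r (hsub hr)
      have := hP.tendsto_adjPair_sub (fun _ : ℕ => (⟨u, hu⟩ : P.U)) (hc' r (hsub hr))
        (p := fun _ => f) hf2 hCf (Eventually.of_forall fun _ => hf2)
        (Eventually.of_forall fun _ => hCf)
        (fun x => ((continuous_fderiv_of_contDiff_two hf2).tendsto x).comp tendsto_snd)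
        (fun x => ((continuous_fderiv_fderiv_of_contDiff_two hf2).tendsto x).comp tendsto_snd)
      rw [← hur]
      exact tendsto_sub_nhds_zero_iff.1 this
  refine tendsto_nhds_unique (hlim t ht) (((hlim r₁ hr₁).add hint).congr fun k => ?_)
  exact ((hc k).2 f hf t ht).symm

/-- Compactness of solutions: along a subsequence they converge, at all times, to a solution. The
subsequence is chosen to converge at a dense sequence of times; the uniform Lipschitz bound for
characteristic functions carries the convergence over to all times. -/
theorem Standing.exists_subseq_fp_tendsto (hP : P.Standing) {α : ℝ → Eucl k₁} (hα : Measurable α)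
    {r₁ r₂ : ℝ} (h12 : r₁ ≤ r₂) (hαU : ∀ t ∈ Icc r₁ r₂, α t ∈ Prod.fst '' P.U)
    {c : ℕ → ℝ → Prob d} (hc : ∀ k, P.IsFPSolution α r₁ r₂ (c k)) {ν : Prob d}
    (hν : Tendsto (fun k => c k r₁) atTop (𝓝 ν)) :
    ∃ φ : ℕ → ℕ, StrictMono φ ∧ ∃ c' : ℝ → Prob d, P.IsFPSolution α r₁ r₂ c' ∧ c' r₁ = ν ∧
      ∀ t ∈ Icc r₁ r₂, Tendsto (fun k => c (φ k) t) atTop (𝓝 (c' t)) := by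
  obtain ⟨B, hB⟩ := hP.exists_genBound
  have hr₁ : r₁ ∈ Icc r₁ r₂ := ⟨le_rfl, h12⟩
  have : Nonempty (Icc r₁ r₂) := ⟨⟨r₁, hr₁⟩⟩
  set D : ℕ → Icc r₁ r₂ := TopologicalSpace.denseSeq (Icc r₁ r₂) with hD
  set S := {m | ∃ k, ∃ t ∈ Icc r₁ r₂, m = c k t} with hS
  have hK := hP.isCompact_closure_fp hα h12 hαU hc hν
  have hcS : ∀ k, ∀ t ∈ Icc r₁ r₂, c k t ∈ closure S := fun k t ht =>
    subset_closure ⟨k, t, ht, rfl⟩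
  -- Tychonoff's theorem in place of a diagonal argument
  obtain ⟨x, -, φ, hφ, hx⟩ := (isCompact_univ_pi fun _ : ℕ => hK).isSeqCompact
    (x := fun k j => c k (D j)) fun k j _ => hcS k _ (D j).2
  rw [tendsto_pi_nhds] at hx
  have hcauchy : ∀ t ∈ Icc r₁ r₂, ∀ ξ,
      CauchySeq fun k => charFun (c (φ k) t : Measure (Eucl d)) ξ := by
    intro t ht ξ
    rw [Metric.cauchySeq_iff]
    intro ε hε
    have hw := waveModulus_nonneg hB.1 ξ
    have hδ : 0 < ε / (3 * (waveModulus B ξ + 1)) := by positivity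
    obtain ⟨j, hj⟩ := (TopologicalSpace.denseRange_denseSeq (Icc r₁ r₂)).exists_dist_lt
      ⟨t, ht⟩ hδ
    have hjt : |t - D j| * waveModulus B ξ < ε / 3 := by
      have h1 : |t - D j| < ε / (3 * (waveModulus B ξ + 1)) := hj
      calc |t - D j| * waveModulus B ξ ≤ |t - D j| * (waveModulus B ξ + 1) :=
            mul_le_mul_of_nonneg_left (by linarith) (abs_nonneg _)
        _ < ε / (3 * (waveModulus B ξ + 1)) * (waveModulus B ξ + 1) :=
            mul_lt_mul_of_pos_right h1 (by linarith)
        _ = ε / 3 := by field_simp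
    obtain ⟨N, hN⟩ := Metric.cauchySeq_iff.1 (tendsto_charFun_eval (hx j) ξ).cauchySeq (ε / 3)
      (by positivity)
    refine ⟨N, fun a ha b hb => ?_⟩
    have e1 := hB.norm_charFun_sub_le hP hα hαU (hc (φ a)) (D j).2 ht ξ
    have e2 := hB.norm_charFun_sub_le hP hα hαU (hc (φ b)) (D j).2 ht ξ
    have e3 := hN a ha b hb
    rw [← dist_eq_norm] at e1 e2
    rw [dist_comm] at e2
    have e4 := dist_triangle4 (charFun (c (φ a) t : Measure (Eucl d)) ξ)
      (charFun (c (φ a) (D j) : Measure (Eucl d)) ξ)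
      (charFun (c (φ b) (D j) : Measure (Eucl d)) ξ) (charFun (c (φ b) t : Measure (Eucl d)) ξ)
    simp only [Function.comp_def] at e3
    linarith
  -- by compactness there is a limit point at each time, and it is unique by Lévy's theorem
  have hlim : ∀ t ∈ Icc r₁ r₂, ∃ m, Tendsto (fun k => c (φ k) t) atTop (𝓝 m) := by
    intro t ht
    obtain ⟨m, -, ψ, hψ, hm⟩ := hK.isSeqCompact fun k => hcS (φ k) t ht
    refine ⟨m, ProbabilityMeasure.tendsto_of_tendsto_charFun fun ξ => ?_⟩
    exact tendsto_nhds_of_cauchySeq_of_subseq (hcauchy t ht ξ) hψ.tendsto_atTop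
      (tendsto_charFun_eval hm ξ)
  choose! c' hc' using hlim
  refine ⟨φ, hφ, c', ?_, ?_, hc'⟩
  · exact hP.isFPSolution_of_tendsto hα h12 hαU (fun k => hc (φ k)) hc'
  · exact tendsto_nhds_unique (hc' r₁ hr₁) (hν.comp hφ.tendsto_atTop)

/-- Continuous dependence of the solution on the initial measure, by compactness and uniqueness. -/
theorem Standing.fp_tendsto (hP : P.Standing) {α : ℝ → Eucl k₁} (hα : Measurable α)
    {r₁ r₂ : ℝ} (h0 : 0 ≤ r₁) (h12 : r₁ < r₂) (hT : r₂ ≤ P.T)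
    (hαU : ∀ t ∈ Icc r₁ r₂, α t ∈ Prod.fst '' P.U)
    {c : ℕ → ℝ → Prob d} (hc : ∀ k, P.IsFPSolution α r₁ r₂ (c k)) {c' : ℝ → Prob d}
    (hc' : P.IsFPSolution α r₁ r₂ c') (hν : Tendsto (fun k => c k r₁) atTop (𝓝 (c' r₁)))
    {t : ℝ} (ht : t ∈ Icc r₁ r₂) : Tendsto (fun k => c k t) atTop (𝓝 (c' t)) := by
  refine tendsto_of_subseq_tendsto fun ns hns => ?_
  obtain ⟨φ, -, c'', h1, h2, h3⟩ := hP.exists_subseq_fp_tendsto hα h12.le hαU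
    (c := fun k => c (ns k)) (fun k => hc (ns k)) (hν.comp hns)
  refine ⟨φ, ?_⟩
  rw [hP.fp_unique r₁ r₂ h0 h12 hT α hα hαU c' c'' hc' h1 h2.symm ht]
  exact h3 t ht

/-! ### The flow of a deterministic control -/

/-- A deterministic (open loop) control on `[r₁, r₂]`. -/
structure OpenLoop (P : ObsControl d k₁ k₂ n G Y) (r₁ r₂ : ℝ) where
  α : ℝ → Eucl k₁
  meas : Measurable α
  mem : ∀ t ∈ Icc r₁ r₂, α t ∈ Prod.fst '' P.U

/-- `[r₁, r₂]` is a nondegenerate time interval inside `[0, T]`. -/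
structure IsTimeSpan (P : ObsControl d k₁ k₂ n G Y) (r₁ r₂ : ℝ) : Prop where
  nonneg : 0 ≤ r₁
  lt : r₁ < r₂
  le_T : r₂ ≤ P.T

/-- The solution of the Fokker–Planck equation on `[r₁, r₂]` started from `ν` and driven by `a`,
extended constantly beyond the end points. -/
def flow (hP : P.Standing) {r₁ r₂ : ℝ} (hr : P.IsTimeSpan r₁ r₂) (a : P.OpenLoop r₁ r₂)
    (ν : Prob d) (t : ℝ) : Prob d :=
  (hP.fp_exists r₁ r₂ hr.nonneg hr.lt hr.le_T ν a.α a.meas a.mem).choose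
    (projIcc r₁ r₂ hr.lt.le t)

theorem isFPSolution_flow (hP : P.Standing) {r₁ r₂ : ℝ} (hr : P.IsTimeSpan r₁ r₂)
    (a : P.OpenLoop r₁ r₂) (ν : Prob d) : P.IsFPSolution a.α r₁ r₂ (flow hP hr a ν) := by
  refine (hP.fp_exists r₁ r₂ hr.nonneg hr.lt hr.le_T ν a.α a.meas a.mem).choose_spec.1.congr
    (fun _ _ => rfl) fun t ht => ?_
  simp only [flow, projIcc_of_mem hr.lt.le ht]

theorem flow_start (hP : P.Standing) {r₁ r₂ : ℝ} (hr : P.IsTimeSpan r₁ r₂)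
    (a : P.OpenLoop r₁ r₂) (ν : Prob d) : flow hP hr a ν r₁ = ν := by
  simpa only [flow, projIcc_left] using
    (hP.fp_exists r₁ r₂ hr.nonneg hr.lt hr.le_T ν a.α a.meas a.mem).choose_spec.2

theorem flow_eq (hP : P.Standing) {r₁ r₂ : ℝ} (hr : P.IsTimeSpan r₁ r₂)
    (a : P.OpenLoop r₁ r₂) {ν : Prob d} {c : ℝ → Prob d} (hc : P.IsFPSolution a.α r₁ r₂ c)
    (hν : c r₁ = ν) : EqOn (flow hP hr a ν) c (Icc r₁ r₂) :=
  hP.fp_unique r₁ r₂ hr.nonneg hr.lt hr.le_T a.α a.meas a.mem _ _ (isFPSolution_flow hP hr a ν) hc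
    (by rw [flow_start, hν])

theorem continuous_flow_time (hP : P.Standing) {r₁ r₂ : ℝ} (hr : P.IsTimeSpan r₁ r₂)
    (a : P.OpenLoop r₁ r₂) (ν : Prob d) : Continuous (flow hP hr a ν) :=
  (hP.fp_exists r₁ r₂ hr.nonneg hr.lt hr.le_T ν a.α a.meas a.mem).choose_spec.1.1.comp_continuous
    (continuous_subtype_val.comp continuous_projIcc) fun _ => Subtype.prop _

theorem continuous_flow_start (hP : P.Standing) {r₁ r₂ : ℝ} (hr : P.IsTimeSpan r₁ r₂)
    (a : P.OpenLoop r₁ r₂) (t : ℝ) : Continuous fun ν => flow hP hr a ν t := by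
  have h1 : ∀ s ∈ Icc r₁ r₂, Continuous fun ν => flow hP hr a ν s := by
    intro s hs
    rw [continuous_iff_seqContinuous]
    intro x ν hx
    refine hP.fp_tendsto a.meas hr.nonneg hr.lt hr.le_T a.mem
      (fun k => isFPSolution_flow hP hr a (x k)) (isFPSolution_flow hP hr a ν) ?_ hs
    simpa only [flow_start] using hx
  have h2 : ∀ ν, flow hP hr a ν t = flow hP hr a ν (projIcc r₁ r₂ hr.lt.le t) := fun ν => by
    simp only [flow, projIcc_val]
  simp_rw [h2]
  exact h1 _ (Subtype.prop _)

theorem measurable_flow (hP : P.Standing) {r₁ r₂ : ℝ} (hr : P.IsTimeSpan r₁ r₂)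
    (a : P.OpenLoop r₁ r₂) : Measurable fun q : ℝ × Prob d => flow hP hr a q.2 q.1 :=
  measurable_uncurry_of_continuous_of_measurable (u := fun t ν => flow hP hr a ν t)
    (fun ν => continuous_flow_time hP hr a ν) fun t => (continuous_flow_start hP hr a t).measurable

-- only the properties above are needed from here on, and unfolding the choice of a solution would
-- slow down unification
attribute [irreducible] flow

end ObsControl

/-! ### Functions of class `S^{1,1}`: continuity of the pairings -/

/-- Uniform convergence in `b` as convergence along `l ×ˢ ⊤`. -/
theorem eventually_prod_top_iff {α β : Type*} {l : Filter α} {p : α × β → Prop} :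
    (∀ᶠ q in l ×ˢ (⊤ : Filter β), p q) ↔ ∀ᶠ a in l, ∀ b, p (a, b) := by
  rw [← principal_univ, eventually_prod_principal_iff]
  simp

section FlatDerivative

variable {d : ℕ} {I : Set ℝ} {Φ : ℝ → Prob d → ℝ} {D : ℝ → Prob d → Eucl d → ℝ} {t : ℝ}

theorem tendsto_triple {ι : Type*} {L : Filter ι} {s : ι → ℝ} {m : ι → Prob d} {μ : Prob d}
    (hs : Tendsto s L (𝓝[I] t)) (hm : Tendsto m L (𝓝 μ)) (x : Eucl d) :
    Tendsto (fun q : ι × Eucl d => (s q.1, m q.1, q.2)) (L ×ˢ 𝓝 x)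
      (𝓝[I ×ˢ univ] (t, μ, x)) := by
  rw [nhdsWithin_prod_eq, nhdsWithin_univ, nhds_prod_eq]
  exact (hs.comp tendsto_fst).prodMk ((hm.comp tendsto_fst).prodMk tendsto_snd)

namespace IsS11On

theorem isCb2 (h : IsS11On I Φ D) (ht : t ∈ I) (μ : Prob d) : IsCb2 (D t μ) := by
  obtain ⟨C, hC⟩ := h.bdd t ht μ
  exact ⟨h.contDiff t ht μ, C, hC.self_of_nhdsWithin ⟨ht, mem_univ _⟩⟩

theorem exists_bound (h : IsS11On I Φ D) (ht : t ∈ I) (μ : Prob d) {ι : Type*} {L : Filter ι}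
    {s : ι → ℝ} {m : ι → Prob d} (hs : Tendsto s L (𝓝[I] t)) (hm : Tendsto m L (𝓝 μ)) :
    ∃ C : ℝ, (∀ x, |D t μ x| ≤ C ∧ ‖fderiv ℝ (D t μ) x‖ ≤ C ∧
        ‖fderiv ℝ (fderiv ℝ (D t μ)) x‖ ≤ C) ∧
      ∀ᶠ i in L, ∀ x, |D (s i) (m i) x| ≤ C ∧ ‖fderiv ℝ (D (s i) (m i)) x‖ ≤ C ∧
        ‖fderiv ℝ (fderiv ℝ (D (s i) (m i))) x‖ ≤ C := by
  obtain ⟨C, hC⟩ := h.bdd t ht μ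
  refine ⟨C, hC.self_of_nhdsWithin ⟨ht, mem_univ _⟩, ?_⟩
  have hsm : Tendsto (fun i => (s i, m i)) L (𝓝[I ×ˢ univ] (t, μ)) := by
    rw [nhdsWithin_prod_eq, nhdsWithin_univ]
    exact hs.prodMk hm
  exact hsm.eventually hC

/-- `(t, m, c) ↦ ⟨c, D(t, m, ·)⟩` is jointly continuous. -/
theorem tendsto_integral (h : IsS11On I Φ D) (ht : t ∈ I) {ι : Type*} {L : Filter ι}
    {s : ι → ℝ} {m c : ι → Prob d} {μ c₀ : Prob d} (hs : Tendsto s L (𝓝[I] t))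
    (hm : Tendsto m L (𝓝 μ)) (hc : Tendsto c L (𝓝 c₀)) :
    Tendsto (fun i => ∫ x, D (s i) (m i) x ∂(c i : Measure (Eucl d))) L
      (𝓝 (∫ x, D t μ x ∂(c₀ : Measure (Eucl d)))) := by
  obtain ⟨C, hC₀, hC⟩ := h.exists_bound ht μ hs hm
  have hsI : ∀ᶠ i in L, s i ∈ I := hs.eventually self_mem_nhdsWithin
  have hcont : ∀ x, Tendsto (fun q : ι × Eucl d => D t μ q.2) (L ×ˢ 𝓝 x) (𝓝 (D t μ x)) :=
    fun x => ((h.contDiff t ht μ).continuous.tendsto x).comp tendsto_snd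
  rw [← tendsto_sub_nhds_zero_iff]
  refine tendsto_integral_sub_of_locally_close (C := C) hc (f := fun i => D (s i) (m i))
    (g := fun _ => D t μ) (hsI.mono fun i hi => (h.contDiff _ hi _).continuous.measurable)
    (Eventually.of_forall fun _ => (h.contDiff t ht μ).continuous.measurable)
    (hC.mono fun i hi x => (hi x).1) (Eventually.of_forall fun _ x => (hC₀ x).1)
    (fun x => ?_) (fun x => tendsto_sub_nhds_zero_iff.2 (hcont x))
  exact tendsto_sub_nhds_zero_iff.2
    ((h.cont (t, μ, x) ⟨ht, mem_univ _⟩).tendsto.comp (tendsto_triple hs hm x))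

/-- `(t, m, c) ↦ ⟨G(α)^* c, D(t, m, ·)⟩` is jointly continuous, uniformly in the control. -/
theorem tendsto_adjPair_sub {k₁ k₂ n : ℕ} {G Y : Type*} [MeasurableSpace G] [MeasurableSpace Y]
    {P : ObsControl d k₁ k₂ n G Y} (hP : P.Standing) (h : IsS11On I Φ D) (ht : t ∈ I)
    {ι : Type*} {L : Filter ι} (u : ι → P.U)
    {s : ι → ℝ} {m c : ι → Prob d} {μ c₀ : Prob d} (hs : Tendsto s L (𝓝[I] t))
    (hm : Tendsto m L (𝓝 μ)) (hc : Tendsto c L (𝓝 c₀)) :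
    Tendsto (fun i => P.adjPair (u i).1.1 (c i) (D (s i) (m i))
      - P.adjPair (u i).1.1 c₀ (D t μ)) L (𝓝 0) := by
  obtain ⟨C, hC₀, hC⟩ := h.exists_bound ht μ hs hm
  have hsI : ∀ᶠ i in L, s i ∈ I := hs.eventually self_mem_nhdsWithin
  exact hP.tendsto_adjPair_sub u hc (h.contDiff t ht μ) (fun x => (hC₀ x).2)
    (hsI.mono fun i hi => h.contDiff _ hi _) (hC.mono fun i hi x => (hi x).2)
    (fun x => (h.cont_fderiv (t, μ, x) ⟨ht, mem_univ _⟩).tendsto.comp (tendsto_triple hs hm x))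
    (fun x => (h.cont_fderiv2 (t, μ, x) ⟨ht, mem_univ _⟩).tendsto.comp (tendsto_triple hs hm x))

theorem continuous_integral_mixture (h : IsS11On I Φ D) (ht : t ∈ I) (m μ c : Prob d) :
    Continuous fun r => ∫ x, D t (mixture r m μ) x ∂(c : Measure (Eucl d)) := by
  refine continuous_iff_continuousAt.2 fun r => ?_
  exact h.tendsto_integral ht (tendsto_nhdsWithin_iff.2
    ⟨tendsto_const_nhds, Eventually.of_forall fun _ => ht⟩) ((continuous_mixture m μ).tendsto r)
    tendsto_const_nhds

/-- A function that is continuous in `t` and of class `S^{1,1}` is jointly continuous. -/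
theorem continuousOn (h : IsS11On I Φ D) (hΦ : ∀ μ, ContinuousOn (fun s => Φ s μ) I) :
    ContinuousOn (fun q : ℝ × Prob d => Φ q.1 q.2) (I ×ˢ univ) := by
  rintro ⟨t, μ⟩ ⟨ht, -⟩
  have ht' : t ∈ I := ht
  rw [ContinuousWithinAt, nhdsWithin_prod_eq, nhdsWithin_univ]
  have h1 : Tendsto (fun q : ℝ × Prob d => Φ q.1 q.2 - Φ q.1 μ) (𝓝[I] t ×ˢ 𝓝 μ) (𝓝 0) := by
    have hs : Tendsto (fun q : (ℝ × Prob d) × unitInterval => q.1.1)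
        ((𝓝[I] t ×ˢ 𝓝 μ) ×ˢ ⊤) (𝓝[I] t) := tendsto_fst.comp tendsto_fst
    have hm : Tendsto (fun q : (ℝ × Prob d) × unitInterval => q.1.2)
        ((𝓝[I] t ×ˢ 𝓝 μ) ×ˢ ⊤) (𝓝 μ) := tendsto_snd.comp tendsto_fst
    have hmix := tendsto_mixture hm fun q => q.2
    have h2 := (h.tendsto_integral ht' hs hmix hm).sub (h.tendsto_integral ht' hs hmix
      (c := fun _ => μ) (tendsto_const_nhds (x := μ)))
    rw [sub_self] at h2
    rw [Metric.tendsto_nhds]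
    intro ε hε
    have h3 := eventually_prod_top_iff.1 (Metric.tendsto_nhds.1 h2 (ε / 2) (half_pos hε))
    have h4 : ∀ᶠ q : ℝ × Prob d in 𝓝[I] t ×ˢ 𝓝 μ, q.1 ∈ I :=
      tendsto_fst.eventually self_mem_nhdsWithin
    filter_upwards [h3, h4] with q hq hqI
    rw [dist_zero_right, h.flat q.1 hqI q.2 μ]
    refine lt_of_le_of_lt ?_ (half_lt_self hε)
    have := norm_integral_le_of_norm_le_const (μ := (volume : Measure unitInterval))
      (f := fun r => (∫ x, D q.1 (mixture r q.2 μ) x ∂(q.2 : Measure (Eucl d)))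
        - ∫ x, D q.1 (mixture r q.2 μ) x ∂(μ : Measure (Eucl d))) (C := ε / 2)
      (Eventually.of_forall fun r => by simpa [dist_zero_right] using (hq r).le)
    simpa using this
  have h5 : Tendsto (fun q : ℝ × Prob d => Φ q.1 μ) (𝓝[I] t ×ˢ 𝓝 μ) (𝓝 (Φ t μ)) :=
    (hΦ μ t ht').tendsto.comp tendsto_fst
  simpa using h1.add h5

end IsS11On

end FlatDerivative

namespace ObsControl

variable {d k₁ k₂ n : ℕ} {G Y : Type*} [MeasurableSpace G] [MeasurableSpace Y]
  {P : ObsControl d k₁ k₂ n G Y}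

/-! ### Short-time behaviour along controlled paths -/

/-- On short time intervals controlled paths stay close to their starting point, uniformly in the
control and in starting points near `μ`. -/
theorem Standing.exists_short_time (hP : P.Standing) {μ : Prob d} {N : Set (Prob d)}
    (hN : N ∈ 𝓝 μ) : ∃ δ > 0, ∀ᶠ m : Prob d in 𝓝 μ, ∀ (α : ℝ → Eucl k₁) (r₁ r₂ : ℝ)
      (c : ℝ → Prob d), Measurable α → (∀ t ∈ Icc r₁ r₂, α t ∈ Prod.fst '' P.U) →
        P.IsFPSolution α r₁ r₂ c → c r₁ = m → ∀ q ∈ Icc r₁ r₂, q - r₁ ≤ δ → c q ∈ N := by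
  obtain ⟨B, hB⟩ := hP.exists_genBound
  obtain ⟨δ, hδ, h⟩ := exists_charFun_nhds μ hN (waveModulus B)
  refine ⟨δ, hδ, h.mono fun m hm α r₁ r₂ c hα hαU hc hcm q hq hqδ => hm _ fun ξ => ?_⟩
  rw [← hcm]
  refine (hB.norm_charFun_sub_le hP hα hαU hc ⟨le_rfl, hq.1.trans hq.2⟩ hq ξ).trans ?_
  refine mul_le_mul_of_nonneg_right ?_ (waveModulus_nonneg hB.1 ξ)
  rwa [abs_of_nonneg (sub_nonneg.2 hq.1)]

theorem Standing.slot_subset (hP : P.Standing) (i : Fin (n + 1)) : P.slot i ⊆ Ico 0 P.T := by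
  intro t ht
  refine ⟨?_, ht.2.trans_le (hP.τ_strictMono.monotone (Fin.le_last _))⟩
  rw [← hP.τ_zero]
  exact (hP.τ_strictMono.monotone (Fin.zero_le _)).trans ht.1

theorem Standing.isTimeSpan (hP : P.Standing) {i : Fin (n + 1)} {t : ℝ} (ht : t ∈ P.slot i) :
    P.IsTimeSpan t (P.τ i.succ) :=
  ⟨(hP.slot_subset i ht).1, ht.2, hP.τ_strictMono.monotone (Fin.le_last _)⟩

theorem slot_mem_nhdsWithin_Ioi {i : Fin (n + 1)} {t : ℝ} (ht : t ∈ P.slot i) :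
    P.slot i ∈ 𝓝[>] t := by
  filter_upwards [Ioo_mem_nhdsGT ht.2] with s hs using ⟨ht.1.trans hs.1.le, hs.2⟩

/-- The running cost is integrable along controlled paths. -/
theorem Standing.intervalIntegrable_ℓ (hP : P.Standing) {α : ℝ → Eucl k₁} (hα : Measurable α)
    {r₁ r₂ : ℝ} (h0 : 0 ≤ r₁) (hT : r₂ ≤ P.T) (hαU : ∀ t ∈ Icc r₁ r₂, α t ∈ Prod.fst '' P.U)
    {c : ℝ → Prob d} (hc : ContinuousOn c (Icc r₁ r₂)) {s t : ℝ}
    (hs : s ∈ Icc r₁ r₂) (ht : t ∈ Icc r₁ r₂) :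
    IntervalIntegrable (fun r => P.ℓ r (c r) (α r)) volume s t := by
  obtain ⟨C, hC⟩ := hP.ℓ_bdd
  have hr : r₁ ≤ r₂ := hs.1.trans hs.2
  have hc' : Continuous fun r => c (projIcc r₁ r₂ hr r) :=
    hc.comp_continuous (continuous_subtype_val.comp continuous_projIcc) fun r => Subtype.prop _
  have hmeas : Measurable fun r => P.ℓ r (c (projIcc r₁ r₂ hr r)) (α r) :=
    hP.ℓ_meas.comp (measurable_id.prodMk (hc'.measurable.prodMk hα))
  have hon : IntegrableOn (fun r => P.ℓ r (c r) (α r)) (Icc r₁ r₂) := by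
    have h1 : IntegrableOn (fun r => P.ℓ r (c (projIcc r₁ r₂ hr r)) (α r)) (Icc r₁ r₂) := by
      refine Measure.integrableOn_of_bounded (M := C) (by simp) hmeas.aestronglyMeasurable ?_
      refine (ae_restrict_iff' measurableSet_Icc).2 (Eventually.of_forall fun r hr' => ?_)
      obtain ⟨u, hu, hur⟩ := hαU r hr'
      rw [← hur]
      exact hC u hu r ⟨h0.trans hr'.1, hr'.2.trans hT⟩ _
    refine h1.congr_fun (fun r hr' => ?_) measurableSet_Icc
    simp only [projIcc_of_mem hr hr']
  refine (hon.mono_set ?_).intervalIntegrable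
  exact ordConnected_Icc.uIcc_subset hs ht

/-- The running cost is integrable also when time and state are frozen. -/
theorem Standing.intervalIntegrable_ℓ_const (hP : P.Standing) {α : ℝ → Eucl k₁}
    (hα : Measurable α) {t : ℝ} (ht : t ∈ Icc 0 P.T) (μ : Prob d) {r₁ r₂ : ℝ} (hr : r₁ ≤ r₂)
    (hαU : ∀ q ∈ Icc r₁ r₂, α q ∈ Prod.fst '' P.U) :
    IntervalIntegrable (fun q => P.ℓ t μ (α q)) volume r₁ r₂ := by
  obtain ⟨C, hC⟩ := hP.ℓ_bdd
  have hm : Measurable fun q => P.ℓ t μ (α q) :=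
    hP.ℓ_meas.comp (measurable_const.prodMk (measurable_const.prodMk hα))
  have hon : IntegrableOn (fun q => P.ℓ t μ (α q)) (Icc r₁ r₂) := by
    refine Measure.integrableOn_of_bounded (M := C) (by simp) hm.aestronglyMeasurable ?_
    refine (ae_restrict_iff' measurableSet_Icc).2 (Eventually.of_forall fun q hq => ?_)
    obtain ⟨u, hu, huq⟩ := hαU q hq
    rw [← huq]
    exact hC u hu t ht μ
  refine IntegrableOn.intervalIntegrable ?_
  rwa [uIcc_of_le hr]

/-- The Hamiltonian expression with `p = D(t, μ, ·)` is jointly continuous in `(t, μ)`, uniformly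
in the control. -/
theorem Standing.tendsto_hamArg_sub (hP : P.Standing) {Φ : ℝ → Prob d → ℝ}
    {D : ℝ → Prob d → Eucl d → ℝ} {i : Fin (n + 1)} (h : IsS11On (P.slot i) Φ D) {t : ℝ}
    (ht : t ∈ P.slot i) (μ : Prob d) :
    Tendsto (fun q : (ℝ × Prob d) × P.U => P.hamArg q.1.1 q.1.2 (D q.1.1 q.1.2) q.2.1
      - P.hamArg t μ (D t μ) q.2.1) ((𝓝[P.slot i] t ×ˢ 𝓝 μ) ×ˢ ⊤) (𝓝 0) := by
  have hs : Tendsto (fun q : (ℝ × Prob d) × P.U => q.1.1)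
      ((𝓝[P.slot i] t ×ˢ 𝓝 μ) ×ˢ ⊤) (𝓝[P.slot i] t) := tendsto_fst.comp tendsto_fst
  have hm : Tendsto (fun q : (ℝ × Prob d) × P.U => q.1.2)
      ((𝓝[P.slot i] t ×ˢ 𝓝 μ) ×ˢ ⊤) (𝓝 μ) := tendsto_snd.comp tendsto_fst
  have h1 := h.tendsto_adjPair_sub hP ht (fun q : (ℝ × Prob d) × P.U => q.2) hs hm hm
  have h2 : Tendsto (fun q : (ℝ × Prob d) × P.U => P.ℓ q.1.1 q.1.2 q.2.1.1 - P.ℓ t μ q.2.1.1)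
      ((𝓝[P.slot i] t ×ˢ 𝓝 μ) ×ˢ ⊤) (𝓝 0) := by
    rw [Metric.tendsto_nhds]
    intro ε hε
    refine eventually_prod_top_iff.2 ?_
    have hsub : P.slot i ⊆ Icc 0 P.T := (hP.slot_subset i).trans Ico_subset_Icc_self
    have h3 := hP.ℓ_cont (t, μ) ⟨hsub ht, mem_univ _⟩ _ (Metric.dist_mem_uniformity hε)
    rw [nhdsWithin_prod_eq, nhdsWithin_univ] at h3
    have h4 : 𝓝[P.slot i] t ×ˢ 𝓝 μ ≤ 𝓝[Icc 0 P.T] t ×ˢ 𝓝 μ :=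
      Filter.prod_mono_left _ (nhdsWithin_mono t hsub)
    filter_upwards [h4 h3] with q hq u
    have := hq u
    rwa [dist_zero_right, ← dist_eq_norm, dist_comm]
  have h5 := h1.add h2
  rw [add_zero] at h5
  refine h5.congr fun q => ?_
  simp only [hamArg]
  ring

/-- **Chain rule along controlled paths.** Along a path started from `(t, μ)` and driven by an
arbitrary control, the sum of the function `Φ` and of the running cost increases over `[t, s]` by
`(s - t) ∂_t Φ(t, μ)` plus the integral of the Hamiltonian expression frozen at `(t, μ)`, up to
`o(s - t)`, uniformly in the control. -/
theorem Standing.eventually_increment (hP : P.Standing) {Φ : ℝ → Prob d → ℝ}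
    {D : ℝ → Prob d → Eucl d → ℝ} {i : Fin (n + 1)} (h : IsS11On (P.slot i) Φ D) {t : ℝ}
    (ht : t ∈ P.slot i) (μ : Prob d)
    (hΦ : DifferentiableOn ℝ (fun s => Φ s μ) (P.slot i)) {ε : ℝ} (hε : 0 < ε) :
    ∀ᶠ s in 𝓝[>] t, ∀ (α : ℝ → Eucl k₁) (c : ℝ → Prob d), Measurable α →
      (∀ q ∈ Icc t s, α q ∈ Prod.fst '' P.U) → P.IsFPSolution α t s c → c t = μ →
        |Φ s (c s) + (∫ q in t..s, P.ℓ q (c q) (α q)) - Φ t μ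
          - (s - t) * derivWithin (fun r => Φ r μ) (P.slot i) t
          - ∫ q in t..s, P.hamArg t μ (D t μ) (α q, 0)| ≤ ε * (s - t) := by
  have hε3 : 0 < ε / 3 := by positivity
  -- a time span after which pairings, running cost, mixtures and path are still close to their values
  -- at `(t, μ)`, whatever the control
  have hpair : ∃ N ∈ 𝓝 μ, ∀ᶠ s in 𝓝[P.slot i] t, ∀ m ∈ N, ∀ c ∈ N, ∀ u : P.U,
      |P.adjPair u.1.1 c (D s m) - P.adjPair u.1.1 μ (D t μ)| < ε / 3 := by
    have h1 := h.tendsto_adjPair_sub hP ht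
      (fun q : (ℝ × Prob d × Prob d) × P.U => q.2) (L := (𝓝[P.slot i] t ×ˢ (𝓝 μ ×ˢ 𝓝 μ)) ×ˢ ⊤)
      (s := fun q => q.1.1) (m := fun q => q.1.2.1) (c := fun q => q.1.2.2)
      (tendsto_fst.comp tendsto_fst) (tendsto_fst.comp (tendsto_snd.comp tendsto_fst))
      (tendsto_snd.comp (tendsto_snd.comp tendsto_fst))
    have h2 := eventually_prod_top_iff.1 (Metric.tendsto_nhds.1 h1 (ε / 3) hε3)
    obtain ⟨A, hA, B, hB, hAB⟩ := eventually_prod_iff.1 h2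
    obtain ⟨N₁, hN₁, N₂, hN₂, hN⟩ := eventually_prod_iff.1 hB
    refine ⟨{m | N₁ m ∧ N₂ m}, hN₁.and hN₂, ?_⟩
    filter_upwards [hA] with s hs m hm c hc u
    have := hAB hs (hN hm.1 hc.2) u
    rwa [dist_zero_right, Real.norm_eq_abs] at this
  obtain ⟨N, hN, hNs⟩ := hpair
  obtain ⟨M, hM, hMN⟩ : ∃ M ∈ 𝓝 μ, ∀ m ∈ M, ∀ r, mixture r m μ ∈ N := by
    exact ⟨_, eventually_prod_top_iff.1 ((tendsto_mixture (L := 𝓝 μ ×ˢ ⊤) tendsto_fst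
      Prod.snd).eventually hN), fun m hm => hm⟩
  obtain ⟨O, hO, δ₁, hδ₁, hOℓ⟩ : ∃ O ∈ 𝓝 μ, ∃ δ > 0, ∀ q ∈ Icc 0 P.T, |q - t| < δ → ∀ m ∈ O,
      ∀ u : P.U, |P.ℓ q m u.1.1 - P.ℓ t μ u.1.1| < ε / 3 := by
    have h3 := hP.ℓ_cont (t, μ) ⟨Ico_subset_Icc_self (hP.slot_subset i ht), mem_univ _⟩ _
      (Metric.dist_mem_uniformity hε3)
    rw [nhdsWithin_prod_eq, nhdsWithin_univ] at h3
    obtain ⟨A, hA, B, hB, hAB⟩ := eventually_prod_iff.1 h3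
    obtain ⟨δ, hδ, hδA⟩ := Metric.mem_nhdsWithin_iff.1 hA
    refine ⟨{m | B m}, hB, δ, hδ, fun q hq hqt m hm u => ?_⟩
    have := hAB (hδA ⟨hqt, hq⟩) hm u
    rwa [← Real.dist_eq, dist_comm]
  obtain ⟨δ₂, hδ₂, hpath⟩ := hP.exists_short_time (inter_mem hN (inter_mem hM hO))
  have hpathμ := hpath.self_of_nhds
  have hderiv : ∀ᶠ s in 𝓝[P.slot i] t, |Φ s μ - Φ t μ
      - (s - t) * derivWithin (fun r => Φ r μ) (P.slot i) t| ≤ ε / 3 * |s - t| := by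
    have h1 := ((hΦ t ht).hasDerivWithinAt.isLittleO).def hε3
    filter_upwards [h1] with s hs
    simpa [Real.norm_eq_abs] using hs
  have hslot : 𝓝[>] t ≤ 𝓝[P.slot i] t := nhdsWithin_le_iff.2 (slot_mem_nhdsWithin_Ioi ht)
  have hsmall : ∀ᶠ s in 𝓝[>] t, s - t < min δ₁ δ₂ := by
    filter_upwards [Ioo_mem_nhdsGT (show t < t + min δ₁ δ₂ by
      linarith [lt_min hδ₁ hδ₂])] with s hs
    linarith [hs.2]
  filter_upwards [hslot hNs, hslot hderiv, hsmall, slot_mem_nhdsWithin_Ioi ht,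
    self_mem_nhdsWithin] with s hs1 hs2 hs3 hsslot hts α c hα hαU hc hcμ
  have hts' : t < s := hts
  have htI : t ∈ Icc t s := ⟨le_rfl, hts'.le⟩
  have hsI : s ∈ Icc t s := ⟨hts'.le, le_rfl⟩
  have hst : 0 < s - t := sub_pos.2 hts'
  have hcN : ∀ q ∈ Icc t s, c q ∈ N ∩ (M ∩ O) := fun q hq =>
    hpathμ α t s c hα hαU hc hcμ q hq (by
      linarith [hq.2, hs3.trans_le (min_le_right δ₁ δ₂)])
  have hμc : ContinuousOn (fun _ : ℝ => μ) (Icc t s) := continuousOn_const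
  have hsT : s ≤ P.T := (hP.slot_subset i hsslot).2.le
  have ht0 : 0 ≤ t := (hP.slot_subset i ht).1
  have iA := hP.intervalIntegrable_adjPair hα hαU hμc (h.isCb2 ht μ) htI hsI
  have iℓc := hP.intervalIntegrable_ℓ hα ht0 hsT hαU hc.1 htI hsI
  -- the running cost may be frozen at `(t, μ)`
  have iℓ := hP.intervalIntegrable_ℓ_const hα (Ico_subset_Icc_self (hP.slot_subset i ht)) μ
    hts'.le hαU
  have hℓ : |(∫ q in t..s, P.ℓ q (c q) (α q)) - ∫ q in t..s, P.ℓ t μ (α q)|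
      ≤ ε / 3 * (s - t) := by
    rw [← intervalIntegral.integral_sub iℓc iℓ, ← Real.norm_eq_abs]
    have := intervalIntegral.norm_integral_le_of_norm_le_const (a := t) (b := s) (C := ε / 3)
      (f := fun q => P.ℓ q (c q) (α q) - P.ℓ t μ (α q)) fun q hq => by
        rw [uIoc_of_le hts'.le] at hq
        have hq' : q ∈ Icc t s := ⟨hq.1.le, hq.2⟩
        obtain ⟨u, hu, hur⟩ := hαU q hq'
        rw [← hur, Real.norm_eq_abs]
        refine (hOℓ q ⟨ht0.trans hq'.1, hq'.2.trans hsT⟩ ?_ (c q) (hcN q hq').2.2 ⟨u, hu⟩).le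
        rw [abs_of_nonneg (sub_nonneg.2 hq'.1)]
        linarith [hq'.2, hs3.trans_le (min_le_left δ₁ δ₂)]
    rwa [abs_of_pos hst] at this
  -- the increment in the measure argument: at each point of the segment from `μ` to `c s` the flat
  -- derivative is a test function for the Fokker–Planck equation
  have hmeas : |Φ s (c s) - Φ s μ - ∫ q in t..s, P.adjPair (α q) μ (D t μ)|
      ≤ ε / 3 * (s - t) := by
    have hr : ∀ r, |((∫ x, D s (mixture r (c s) μ) x ∂(c s : Measure (Eucl d)))
        - ∫ x, D s (mixture r (c s) μ) x ∂(μ : Measure (Eucl d)))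
        - ∫ q in t..s, P.adjPair (α q) μ (D t μ)| ≤ ε / 3 * (s - t) := by
      intro r
      have hcb := h.isCb2 hsslot (mixture r (c s) μ)
      have e1 := hc.2 _ hcb s hsI
      rw [hcμ] at e1
      rw [e1, add_sub_cancel_left, ← intervalIntegral.integral_sub
        (hP.intervalIntegrable_adjPair hα hαU hc.1 hcb htI hsI) iA, ← Real.norm_eq_abs]
      have := intervalIntegral.norm_integral_le_of_norm_le_const (a := t) (b := s) (C := ε / 3)
        (f := fun q => P.adjPair (α q) (c q) (D s (mixture r (c s) μ))
          - P.adjPair (α q) μ (D t μ)) fun q hq => by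
          rw [uIoc_of_le hts'.le] at hq
          have hq' : q ∈ Icc t s := ⟨hq.1.le, hq.2⟩
          obtain ⟨u, hu, hur⟩ := hαU q hq'
          rw [← hur, Real.norm_eq_abs]
          exact (hs1 _ (hMN _ (hcN s hsI).2.1 r) _ (hcN q hq').1 ⟨u, hu⟩).le
      rwa [abs_of_pos hst] at this
    have hcont : Continuous fun r => (∫ x, D s (mixture r (c s) μ) x ∂(c s : Measure (Eucl d)))
        - ∫ x, D s (mixture r (c s) μ) x ∂(μ : Measure (Eucl d)) :=
      (h.continuous_integral_mixture hsslot _ _ _).sub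
        (h.continuous_integral_mixture hsslot _ _ _)
    have hint : Integrable (fun r => (∫ x, D s (mixture r (c s) μ) x ∂(c s : Measure (Eucl d)))
        - ∫ x, D s (mixture r (c s) μ) x ∂(μ : Measure (Eucl d)))
        (volume : Measure unitInterval) :=
      (integrableOn_univ).1 (hcont.continuousOn.integrableOn_compact isCompact_univ)
    rw [h.flat s hsslot (c s) μ]
    have e2 : ∀ A : ℝ, A = ∫ _r : unitInterval, A := fun A => by simp
    rw [e2 (∫ q in t..s, P.adjPair (α q) μ (D t μ)), ← integral_sub hint (integrable_const _),
      ← Real.norm_eq_abs]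
    have := norm_integral_le_of_norm_le_const (μ := (volume : Measure unitInterval))
      (f := fun r => ((∫ x, D s (mixture r (c s) μ) x ∂(c s : Measure (Eucl d)))
        - ∫ x, D s (mixture r (c s) μ) x ∂(μ : Measure (Eucl d)))
        - ∫ q in t..s, P.adjPair (α q) μ (D t μ)) (Eventually.of_forall hr)
    simpa using this
  have hham : ∫ q in t..s, P.hamArg t μ (D t μ) (α q, 0)
      = (∫ q in t..s, P.adjPair (α q) μ (D t μ)) + ∫ q in t..s, P.ℓ t μ (α q) :=
    intervalIntegral.integral_add iA iℓ
  rw [abs_of_pos hst] at hs2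
  rw [hham]
  rw [abs_le] at *
  constructor <;> linarith [hs2.1, hs2.2, hmeas.1, hmeas.2, hℓ.1, hℓ.2]

end ObsControl

/-! ### Time slots -/

namespace ObsControl

variable {d k₁ k₂ n : ℕ} {G Y : Type*} [MeasurableSpace G] [MeasurableSpace Y]
  {P : ObsControl d k₁ k₂ n G Y}

theorem obsTime_eq (P : ObsControl d k₁ k₂ n G Y) (j : Fin n) :
    P.obsTime j = P.τ j.castSucc.succ := rfl

/-- From a time in the slot `i`, the ends of the slots `i' ≥ i` are those still to come. -/
theorem Standing.lt_succ_iff (hP : P.Standing) {i i' : Fin (n + 1)} {s : ℝ} (hs : s ∈ P.slot i) :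
    s < P.τ i'.succ ↔ i ≤ i' := by
  constructor
  · intro h
    by_contra! hlt
    have h1 : i'.succ ≤ i.castSucc := by
      rw [Fin.le_def]
      simpa using hlt
    exact absurd ((hP.τ_strictMono.monotone h1).trans hs.1) (not_le.2 h)
  · intro h
    exact hs.2.trans_le (hP.τ_strictMono.monotone (Fin.succ_le_succ_iff.2 h))

theorem Standing.lt_obsTime_iff (hP : P.Standing) {i : Fin (n + 1)} {j : Fin n} {s : ℝ}
    (hs : s ∈ P.slot i) : s < P.obsTime j ↔ i ≤ j.castSucc := by
  rw [obsTime_eq, hP.lt_succ_iff hs]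

theorem Standing.obsTime_mem_slot (hP : P.Standing) (j : Fin n) :
    P.obsTime j ∈ P.slot j.succ :=
  ⟨le_rfl, hP.τ_strictMono (Fin.castSucc_lt_succ)⟩

theorem Standing.obsTime_lt_iff (hP : P.Standing) {i j : Fin n} :
    P.obsTime i < P.obsTime j ↔ i < j := by
  rw [hP.lt_obsTime_iff (hP.obsTime_mem_slot i)]
  simp only [Fin.le_def, Fin.lt_def, Fin.val_succ, Fin.val_castSucc]
  omega

theorem Standing.slot_unique (hP : P.Standing) {i i' : Fin (n + 1)} {s : ℝ} (hs : s ∈ P.slot i)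
    (hs' : s ∈ P.slot i') : i = i' :=
  le_antisymm ((hP.lt_succ_iff hs).1 hs'.2) ((hP.lt_succ_iff hs').1 hs.2)

theorem Standing.succ_le_castSucc (hP : P.Standing) {i i' : Fin (n + 1)} (h : i < i') :
    P.τ i.succ ≤ P.τ i'.castSucc :=
  hP.τ_strictMono.monotone (by
    rw [Fin.le_def]
    simpa using h)

theorem Standing.exists_slot (hP : P.Standing) {s : ℝ} (hs : s ∈ Ico 0 P.T) :
    ∃ i, s ∈ P.slot i := by
  by_contra! hcon
  have h : ∀ m : Fin (n + 2), P.τ m ≤ s := by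
    intro m
    induction m using Fin.induction with
    | zero => rw [hP.τ_zero]; exact hs.1
    | succ i ih =>
      by_contra! hlt
      exact hcon i ⟨ih, hlt⟩
  exact absurd (h (Fin.last _)) (not_le.2 hs.2)

/-! ### Payoffs -/

/-- The cost accumulated for the realization `ω` of the noise; the cost is its expectation. -/
def Trajectory.payoff {s : ℝ} {u : P.Control s} {μ : Prob d} (X : P.Trajectory u μ)
    (ω : Fin n → G) : ℝ :=
  (∑ i : Fin (n + 1), ∫ t in (max s (P.τ i.castSucc))..(max s (P.τ i.succ)),
      P.ℓ t (X.seg i t ω) (u.α t (X.record ω)))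
    + (∑ j : Fin n, if s < P.obsTime j then
        P.h (P.obsTime j) (X.seg j.castSucc (P.obsTime j) ω) (u.β j (X.record ω)) else 0)
    + P.g (X.seg (Fin.last n) P.T ω)

theorem Trajectory.cost_eq_integral_payoff {s : ℝ} {u : P.Control s} {μ : Prob d}
    (X : P.Trajectory u μ) : X.cost = ∫ ω, X.payoff ω ∂P.noise := rfl

instance isProbabilityMeasure_noise (P : ObsControl d k₁ k₂ n G Y) :
    IsProbabilityMeasure P.noise := by
  unfold noise
  infer_instance

theorem Trajectory.measurable_payoff (hP : P.Standing) {s : ℝ} {u : P.Control s} {μ : Prob d}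
    (X : P.Trajectory u μ) : Measurable X.payoff := by
  unfold payoff
  refine Measurable.add (Measurable.add ?_ ?_) ?_
  · refine Finset.measurable_sum _ fun i _ => ?_
    have hle : max s (P.τ i.castSucc) ≤ max s (P.τ i.succ) :=
      max_le_max le_rfl (hP.τ_strictMono.monotone (Fin.castSucc_lt_succ).le)
    simp_rw [intervalIntegral.integral_of_le hle]
    have hm : Measurable fun q : ℝ × (Fin n → G) =>
        P.ℓ q.1 (X.seg i q.1 q.2) (u.α q.1 (X.record q.2)) :=
      hP.ℓ_meas.comp (measurable_fst.prodMk ((X.seg_meas i).prodMk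
        (u.α_meas.comp (measurable_fst.prodMk (X.record_meas.comp measurable_snd)))))
    exact (hm.stronglyMeasurable.integral_prod_left
      (μ := volume.restrict (Ioc (max s (P.τ i.castSucc)) (max s (P.τ i.succ))))).measurable
  · refine Finset.measurable_sum _ fun j _ => ?_
    by_cases h : s < P.obsTime j
    · simp only [h, if_true]
      exact (hP.h_meas j).comp (((X.seg_meas j.castSucc).comp
        (measurable_const.prodMk measurable_id)).prodMk ((u.β_meas j).comp X.record_meas))
    · simp only [h, if_false]
      exact measurable_const
  · exact hP.g_cont.measurable.comp
      ((X.seg_meas (Fin.last n)).comp (measurable_const.prodMk measurable_id))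

theorem Standing.exists_payoff_bound (hP : P.Standing) : ∃ C, 0 ≤ C ∧ ∀ s ∈ Ico 0 P.T,
    ∀ (μ : Prob d) (u : P.Control s) (X : P.Trajectory u μ) (ω : Fin n → G),
      |X.payoff ω| ≤ C := by
  obtain ⟨Cℓ, hCℓ⟩ := hP.ℓ_bdd
  obtain ⟨Ch, hCh⟩ := hP.h_bdd
  obtain ⟨Cg, hCg⟩ := hP.g_bdd
  have hT0 : ∀ s ∈ Ico 0 P.T, 0 ≤ P.T := fun s hs => hs.1.trans hs.2.le
  by_cases hT : 0 ≤ P.T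
  swap
  · exact ⟨0, le_rfl, fun s hs => absurd (hT0 s hs) hT⟩
  refine ⟨(n + 1 : ℕ) * (|Cℓ| * P.T) + n * |Ch| + |Cg|, by positivity, ?_⟩
  intro s hs μ u X ω
  refine (abs_add_le _ _).trans (add_le_add ((abs_add_le _ _).trans (add_le_add ?_ ?_)) ?_)
  · refine (Finset.abs_sum_le_sum_abs _ _).trans ?_
    refine (Finset.sum_le_sum (g := fun _ => |Cℓ| * P.T) fun i _ => ?_).trans (by simp)
    have hle : max s (P.τ i.castSucc) ≤ max s (P.τ i.succ) :=
      max_le_max le_rfl (hP.τ_strictMono.monotone (Fin.castSucc_lt_succ).le)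
    have hb : max s (P.τ i.succ) ≤ P.T :=
      max_le hs.2.le (hP.τ_strictMono.monotone (Fin.le_last _))
    have := intervalIntegral.norm_integral_le_of_norm_le_const (C := |Cℓ|)
      (a := max s (P.τ i.castSucc)) (b := max s (P.τ i.succ))
      (f := fun t => P.ℓ t (X.seg i t ω) (u.α t (X.record ω))) fun t ht => by
        rw [uIoc_of_le hle] at ht
        have hst : s ≤ t := (le_max_left _ _).trans ht.1.le
        obtain ⟨v, hv, hvt⟩ := u.α_mem t ⟨hst, ht.2.trans hb⟩ (X.record ω)
        rw [← hvt]
        exact (hCℓ v hv t ⟨hs.1.trans hst, ht.2.trans hb⟩ _).trans (le_abs_self _)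
    refine this.trans (mul_le_mul_of_nonneg_left ?_ (abs_nonneg _))
    rw [abs_of_nonneg (sub_nonneg.2 hle)]
    linarith [hs.1, le_max_left s (P.τ i.castSucc)]
  · refine (Finset.abs_sum_le_sum_abs _ _).trans ?_
    refine (Finset.sum_le_sum (g := fun _ => |Ch|) fun j _ => ?_).trans (by simp)
    by_cases h : s < P.obsTime j
    · simp only [h, if_true]
      obtain ⟨v, hv, hvt⟩ := u.β_mem j h (X.record ω)
      rw [← hvt]
      exact (hCh v hv j _).trans (le_abs_self _)
    · simp [h]
  · exact (hCg _).trans (le_abs_self _)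

theorem Trajectory.integrable_payoff (hP : P.Standing) {s : ℝ} (hs : s ∈ Ico 0 P.T)
    {u : P.Control s} {μ : Prob d} (X : P.Trajectory u μ) : Integrable X.payoff P.noise := by
  obtain ⟨C, -, hC⟩ := hP.exists_payoff_bound
  exact Integrable.of_bound (X.measurable_payoff hP).aestronglyMeasurable C
    (Eventually.of_forall fun ω => hC s hs μ u X ω)

/-! ### Elementary bounds for the value function -/

theorem Standing.exists_cost_bound (hP : P.Standing) : ∃ C, 0 ≤ C ∧ ∀ s ∈ Ico 0 P.T,
    ∀ (μ : Prob d) (u : P.Control s) (X : P.Trajectory u μ), |X.cost| ≤ C := by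
  obtain ⟨C, hC0, hC⟩ := hP.exists_payoff_bound
  refine ⟨C, hC0, fun s hs μ u X => ?_⟩
  have := norm_integral_le_of_norm_le_const (μ := P.noise) (f := X.payoff) (C := C)
    (Eventually.of_forall fun ω => hC s hs μ u X ω)
  simpa [Trajectory.cost_eq_integral_payoff] using this

theorem Standing.value_le_cost (hP : P.Standing) {s : ℝ} (hs : s ∈ Ico 0 P.T) {μ : Prob d}
    {u : P.Control s} (X : P.Trajectory u μ) : P.value s μ ≤ X.cost := by
  obtain ⟨C, -, hC⟩ := hP.exists_cost_bound
  rw [value, if_pos hs.2]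
  refine csInf_le ⟨-C, ?_⟩ ⟨u, X, rfl⟩
  rintro _ ⟨u', X', rfl⟩
  exact (abs_le.1 (hC s hs μ u' X')).1

theorem Standing.exists_value_bound (hP : P.Standing) :
    ∃ C, ∀ s ∈ Ico 0 P.T, ∀ μ : Prob d, |P.value s μ| ≤ C := by
  obtain ⟨C, hC0, hC⟩ := hP.exists_cost_bound
  refine ⟨C, fun s hs μ => ?_⟩
  rw [value, if_pos hs.2]
  set S := {J | ∃ (u : P.Control s) (X : P.Trajectory u μ), J = X.cost}
  have hS : ∀ J ∈ S, |J| ≤ C := by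
    rintro _ ⟨u, X, rfl⟩
    exact hC s hs μ u X
  rcases S.eq_empty_or_nonempty with h | ⟨J, hJ⟩
  · simpa [h] using hC0
  · rw [abs_le]
    exact ⟨le_csInf ⟨J, hJ⟩ fun J' hJ' => (abs_le.1 (hS J' hJ')).1,
      (csInf_le ⟨-C, fun J' hJ' => (abs_le.1 (hS J' hJ')).1⟩ hJ).trans (abs_le.1 (hS J hJ)).2⟩

/-! ### Resampling one noise variable -/

theorem measurable_update_uncurry (j : Fin n) :
    Measurable fun p : G × (Fin n → G) => Function.update p.2 j p.1 := by
  refine measurable_pi_iff.2 fun i => ?_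
  by_cases h : i = j
  · subst h
    simpa using measurable_fst
  · simp only [Function.update_of_ne h]
    exact (measurable_pi_apply i).comp measurable_snd

/-- The noises are independent: replacing `Γ_j` by an independent copy preserves their law. -/
theorem map_update_noise (P : ObsControl d k₁ k₂ n G Y) (j : Fin n) :
    Measure.map (fun p : G × (Fin n → G) => Function.update p.2 j p.1)
      ((P.γ j : Measure G).prod P.noise) = P.noise := by
  refine (Measure.pi_eq fun s hs => ?_).symm
  rw [Measure.map_apply (measurable_update_uncurry j) (MeasurableSet.univ_pi hs)]
  have hpre : (fun p : G × (Fin n → G) => Function.update p.2 j p.1) ⁻¹' (univ.pi s)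
      = s j ×ˢ univ.pi (Function.update s j univ) := by
    ext ⟨w, ω⟩
    simp only [mem_preimage, Set.mem_pi, mem_univ, true_implies, mem_prod]
    constructor
    · intro h
      refine ⟨by simpa using h j, fun i => ?_⟩
      by_cases hi : i = j
      · subst hi
        simp
      · simpa [hi] using h i
    · rintro ⟨h1, h2⟩ i
      by_cases hi : i = j
      · subst hi
        simpa using h1
      · simpa [hi] using h2 i
  rw [hpre, Measure.prod_prod, noise, Measure.pi_pi,
    ← Finset.mul_prod_erase Finset.univ _ (Finset.mem_univ j),
    ← Finset.mul_prod_erase Finset.univ (fun i => (P.γ i : Measure G) (s i)) (Finset.mem_univ j)]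
  simp only [Function.update_self, measure_univ, one_mul]
  congr 1
  refine Finset.prod_congr rfl fun i hi => ?_
  rw [Function.update_of_ne (Finset.ne_of_mem_erase hi)]

/-- Conditioning an expectation on the noise `Γ_j`. -/
theorem integral_noise_eq (P : ObsControl d k₁ k₂ n G Y) (j : Fin n) {F : (Fin n → G) → ℝ}
    (hF : Integrable F P.noise) :
    Integrable (fun w => ∫ ω, F (Function.update ω j w) ∂P.noise) (P.γ j : Measure G) ∧
    ∫ ω, F ω ∂P.noise
      = ∫ w, ∫ ω, F (Function.update ω j w) ∂P.noise ∂(P.γ j : Measure G) := by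
  have hm := measurable_update_uncurry (G := G) j
  have hF' : Integrable F (Measure.map (fun p : G × (Fin n → G) => Function.update p.2 j p.1)
      ((P.γ j : Measure G).prod P.noise)) := by
    rwa [map_update_noise]
  have hi : Integrable (fun p : G × (Fin n → G) => F (Function.update p.2 j p.1))
      ((P.γ j : Measure G).prod P.noise) := hF'.comp_measurable hm
  refine ⟨hi.integral_prod_left, ?_⟩
  rw [← integral_prod _ hi]
  conv_lhs => rw [← map_update_noise P j]
  exact integral_map hm.aemeasurable hF'.aestronglyMeasurable

/-! ### Splitting the payoff at the next observation -/

/-- The payoff from `s` splits into the payoff up to the next observation time `t_j`, and the payoff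
from `t_j` on of a trajectory that follows the same path. -/
theorem Trajectory.payoff_split (hP : P.Standing) {j : Fin n} {s : ℝ}
    (hs : s ∈ P.slot j.castSucc) {u : P.Control s} {μ : Prob d} (X : P.Trajectory u μ)
    {u' : P.Control (P.obsTime j)} {μ' : Prob d} (X' : P.Trajectory u' μ') (ω ω' : Fin n → G)
    (hseg : ∀ i, j.castSucc < i → ∀ t, X.seg i t ω = X'.seg i t ω')
    (hα : ∀ t ∈ Icc (P.obsTime j) P.T, u.α t (X.record ω) = u'.α t (X'.record ω'))
    (hβ : ∀ i, j < i → u.β i (X.record ω) = u'.β i (X'.record ω')) :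
    X.payoff ω = (∫ t in s..P.obsTime j, P.ℓ t (X.seg j.castSucc t ω) (u.α t (X.record ω)))
      + P.h (P.obsTime j) (X.seg j.castSucc (P.obsTime j) ω) (u.β j (X.record ω))
      + X'.payoff ω' := by
  have hmono := hP.τ_strictMono.monotone
  have hj := hP.obsTime_mem_slot j
  -- both paths have the same running cost on every slot except that of `s`, which is over at `t_j`
  have h1 : ∀ i : Fin (n + 1),
      (∫ t in (max s (P.τ i.castSucc))..(max s (P.τ i.succ)),
        P.ℓ t (X.seg i t ω) (u.α t (X.record ω)))
      = (∫ t in (max (P.obsTime j) (P.τ i.castSucc))..(max (P.obsTime j) (P.τ i.succ)),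
          P.ℓ t (X'.seg i t ω') (u'.α t (X'.record ω')))
        + if i = j.castSucc then
            (∫ t in s..P.obsTime j, P.ℓ t (X.seg j.castSucc t ω) (u.α t (X.record ω))) else 0 := by
    intro i
    have hi := hmono (Fin.castSucc_lt_succ (i := i)).le
    rcases lt_trichotomy i j.castSucc with h | h | h
    · have e1 : P.τ i.succ ≤ s := (hP.succ_le_castSucc h).trans hs.1
      have e2 : P.τ i.succ ≤ P.obsTime j := e1.trans hs.2.le
      rw [max_eq_left e1, max_eq_left (hi.trans e1), max_eq_left e2, max_eq_left (hi.trans e2),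
        intervalIntegral.integral_same, intervalIntegral.integral_same, if_neg h.ne, add_zero]
    · subst h
      have e2 : P.τ j.castSucc.succ ≤ P.obsTime j := le_rfl
      rw [max_eq_left hs.1, max_eq_right hs.2.le, max_eq_left e2, max_eq_left (hi.trans e2),
        intervalIntegral.integral_same, if_pos rfl, zero_add]
      rfl
    · have e1 : P.obsTime j ≤ P.τ i.castSucc := hP.succ_le_castSucc h
      have e2 : s ≤ P.τ i.castSucc := hs.2.le.trans e1
      rw [max_eq_right e1, max_eq_right (e1.trans hi), max_eq_right e2, max_eq_right (e2.trans hi),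
        if_neg h.ne', add_zero]
      refine intervalIntegral.integral_congr fun t ht => ?_
      rw [uIcc_of_le hi] at ht
      rw [hseg i h t, hα t ⟨e1.trans ht.1, ht.2.trans (hmono (Fin.le_last _))⟩]
  have h2 : ∀ i : Fin n,
      (if s < P.obsTime i then
        P.h (P.obsTime i) (X.seg i.castSucc (P.obsTime i) ω) (u.β i (X.record ω)) else 0)
      = (if P.obsTime j < P.obsTime i then
          P.h (P.obsTime i) (X'.seg i.castSucc (P.obsTime i) ω') (u'.β i (X'.record ω')) else 0)
        + if i = j then
            P.h (P.obsTime j) (X.seg j.castSucc (P.obsTime j) ω) (u.β j (X.record ω)) else 0 := by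
    intro i
    rw [if_congr (hP.lt_obsTime_iff hs) rfl rfl, if_congr hP.obsTime_lt_iff rfl rfl]
    rcases lt_trichotomy i j with h | h | h
    · rw [if_neg (by simpa using h), if_neg h.not_gt, if_neg h.ne, add_zero]
    · subst h
      simp
    · rw [if_pos (by simpa using h.le), if_pos h, if_neg h.ne', add_zero,
        hseg i.castSucc (by simpa using h), hβ i h]
  have h3 : X.seg (Fin.last n) P.T ω = X'.seg (Fin.last n) P.T ω' :=
    hseg _ (Fin.castSucc_lt_last j) _
  unfold payoff
  simp_rw [h1, h2, h3, Finset.sum_add_distrib]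
  simp only [Finset.sum_ite_eq', Finset.mem_univ, if_true]
  ring

theorem Trajectory.payoff_last (hP : P.Standing) {s : ℝ} (hs : s ∈ P.slot (Fin.last n))
    {u : P.Control s} {μ : Prob d} (X : P.Trajectory u μ) (ω : Fin n → G) :
    X.payoff ω = (∫ t in s..P.T, P.ℓ t (X.seg (Fin.last n) t ω) (u.α t (X.record ω)))
      + P.g (X.seg (Fin.last n) P.T ω) := by
  have hmono := hP.τ_strictMono.monotone
  have h1 : ∀ i : Fin (n + 1),
      (∫ t in (max s (P.τ i.castSucc))..(max s (P.τ i.succ)),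
        P.ℓ t (X.seg i t ω) (u.α t (X.record ω)))
      = if i = Fin.last n then
            (∫ t in s..P.T, P.ℓ t (X.seg (Fin.last n) t ω) (u.α t (X.record ω))) else 0 := by
    intro i
    have hi := hmono (Fin.castSucc_lt_succ (i := i)).le
    rcases (Fin.le_last i).lt_or_eq with h | h
    · have e1 : P.τ i.succ ≤ s := (hP.succ_le_castSucc h).trans hs.1
      rw [max_eq_left e1, max_eq_left (hi.trans e1), intervalIntegral.integral_same, if_neg h.ne]
    · subst h
      rw [max_eq_left hs.1, max_eq_right hs.2.le, if_pos rfl]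
      rfl
  have h2 : ∀ i : Fin n, ¬ s < P.obsTime i := fun i => by
    rw [hP.lt_obsTime_iff hs]
    exact not_le.2 (Fin.castSucc_lt_last i)
  unfold payoff
  simp_rw [h1, h2]
  simp

/-- Conditioning the cost on the noise at the next observation time. -/
theorem Trajectory.cost_eq_of_payoff_update (hP : P.Standing) {s r : ℝ} (hs : s ∈ Ico 0 P.T)
    {u : P.Control s} {μ : Prob d} (X : P.Trajectory u μ) (j : Fin n) {A : ℝ}
    {u' : G → P.Control r} {μ' : G → Prob d} (X' : ∀ w, P.Trajectory (u' w) (μ' w))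
    (hr : r ∈ Ico 0 P.T)
    (h : ∀ w ω, X.payoff (Function.update ω j w) = A + (X' w).payoff ω) :
    Integrable (fun w => (X' w).cost) (P.γ j : Measure G) ∧
      X.cost = A + ∫ w, (X' w).cost ∂(P.γ j : Measure G) := by
  obtain ⟨h1, h2⟩ := P.integral_noise_eq j (X.integrable_payoff hP hs)
  have h3 : ∀ w, ∫ ω, X.payoff (Function.update ω j w) ∂P.noise = A + (X' w).cost := by
    intro w
    simp_rw [h w]
    rw [integral_add (integrable_const A) ((X' w).integrable_payoff hP hr)]
    simp [cost_eq_integral_payoff]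
  simp_rw [h3] at h1 h2
  have h4 : Integrable (fun w => (X' w).cost) (P.γ j : Measure G) := by
    exact (h1.sub (integrable_const A)).congr (Eventually.of_forall fun w => by simp)
  refine ⟨h4, ?_⟩
  rw [X.cost_eq_integral_payoff, h2, integral_add (integrable_const A) h4]
  simp

/-! ### Continuing a control after the next observation -/

theorem measurable_update_const {Z : Type*} [MeasurableSpace Z] (j : Fin n) (y : Z) :
    Measurable fun z : Fin n → Z => Function.update z j y :=
  (measurable_update_uncurry j).comp (measurable_const.prodMk measurable_id)

/-- The control `u` after the observation time `t_j`, when `y` has been observed at `t_j`. -/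
def Control.after (hP : P.Standing) {j : Fin n} {s : ℝ} (hs : s ∈ P.slot j.castSucc)
    (u : P.Control s) (y : Y) : P.Control (P.obsTime j) where
  α t z := u.α t (Function.update z j y)
  β i z := u.β i (Function.update z j y)
  α_meas := u.α_meas.comp
    (measurable_fst.prodMk ((measurable_update_const j y).comp measurable_snd))
  β_meas i := (u.β_meas i).comp (measurable_update_const j y)
  α_adapted t ht z z' h := by
    refine u.α_adapted t ⟨hs.2.le.trans ht.1, ht.2⟩ _ _ fun i hi hit => ?_
    by_cases hij : i = j
    · subst hij
      simp
    · rw [Function.update_of_ne hij, Function.update_of_ne hij]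
      refine h i (hP.obsTime_lt_iff.2 (lt_of_le_of_ne ?_ (Ne.symm hij))) hit
      simpa using (hP.lt_obsTime_iff hs).1 hi
  β_predictable k hk z z' h := by
    refine u.β_predictable k (hs.2.trans hk) _ _ fun i hi hik => ?_
    by_cases hij : i = j
    · subst hij
      simp
    · rw [Function.update_of_ne hij, Function.update_of_ne hij]
      refine h i (hP.obsTime_lt_iff.2 (lt_of_le_of_ne ?_ (Ne.symm hij))) hik
      simpa using (hP.lt_obsTime_iff hs).1 hi
  α_mem t ht _ := u.α_mem t ⟨hs.2.le.trans ht.1, ht.2⟩ _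
  β_mem k hk _ := u.β_mem k (hs.2.trans hk) _

section FirstLeg

variable {s : ℝ} {i : Fin (n + 1)} {u : P.Control s} {μ : Prob d}

/-- Before the next observation time the control does not depend on the observations. -/
theorem Control.α_eq_of_lt (hP : P.Standing) (hs : s ∈ P.slot i) (u : P.Control s) {t : ℝ}
    (ht : t ∈ Ico s (P.τ i.succ)) (y y' : Fin n → Y) : u.α t y = u.α t y' := by
  refine u.α_adapted t ⟨ht.1, ht.2.le.trans (hP.τ_strictMono.monotone (Fin.le_last _))⟩ _ _
    fun k hk hkt => ?_
  have h1 : t ∈ P.slot i := ⟨hs.1.trans ht.1, ht.2⟩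
  exact absurd hkt (not_le.2 ((hP.lt_obsTime_iff h1).2 ((hP.lt_obsTime_iff hs).1 hk)))

theorem Control.β_eq_of_next (hP : P.Standing) {j : Fin n} (hs : s ∈ P.slot j.castSucc)
    (u : P.Control s) (y y' : Fin n → Y) : u.β j y = u.β j y' := by
  refine u.β_predictable j hs.2 _ _ fun k hk hkj => ?_
  have h1 := (hP.lt_obsTime_iff hs).1 hk
  exact absurd (hP.obsTime_lt_iff.1 hkj) (not_lt.2 (by simpa using h1))

/-- The control with the observations frozen, as an open loop control up to `r ≤ T`. -/
def Control.toOpenLoop (u : P.Control s) (y : Fin n → Y) {r : ℝ} (hr : r ≤ P.T) :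
    P.OpenLoop s r where
  α t := u.α t y
  meas := u.α_meas.comp (measurable_id.prodMk measurable_const)
  mem t ht := u.α_mem t ⟨ht.1, ht.2.trans hr⟩ y

/-- Before the next observation time the path is the flow of an open loop control. -/
theorem Trajectory.seg_eq_flow (hP : P.Standing) (hs : s ∈ P.slot i) (X : P.Trajectory u μ)
    (y : Fin n → Y) (ω : Fin n → G) {t : ℝ} (ht : t ∈ Icc s (P.τ i.succ)) :
    X.seg i t ω = flow hP (hP.isTimeSpan hs) (u.toOpenLoop y (hP.isTimeSpan hs).le_T) μ t := by
  have h1 := X.evolve i hs.2 ω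
  rw [max_eq_left hs.1] at h1
  have h2 : P.IsFPSolution (u.toOpenLoop y (hP.isTimeSpan hs).le_T).α s (P.τ i.succ)
      fun t => X.seg i t ω :=
    h1.congr (fun t ht => u.α_eq_of_lt hP hs ht _ _) fun _ _ => rfl
  exact (flow_eq hP (hP.isTimeSpan hs) _ h2 (X.start i hs ω) ht).symm

end FirstLeg

/-- The trajectory `X` from the observation time `t_j` on, for the value `w` of the noise at `t_j`;
`ν` and `β` are the state and the measurement control at `t_j`. -/
def Trajectory.after (hP : P.Standing) {j : Fin n} {s : ℝ} (hs : s ∈ P.slot j.castSucc)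
    {u : P.Control s} {μ : Prob d} (X : P.Trajectory u μ) {ν : Prob d} {β : Eucl k₂}
    (hν : ∀ ω, X.seg j.castSucc (P.obsTime j) ω = ν) (hβ : ∀ ω, u.β j (X.record ω) = β) (w : G) :
    P.Trajectory (u.after hP hs (P.obs j ν β w)) (P.post β ν (P.obs j ν β w)) :=
  have hrec : ∀ ω, X.record (Function.update ω j w) j = P.obs j ν β w := fun ω => by
    rw [X.observe j hs.2, hν, hβ, Function.update_self]
  have hupd : ∀ ω, Function.update (X.record (Function.update ω j w)) j (P.obs j ν β w)
      = X.record (Function.update ω j w) := fun ω => by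
    rw [← hrec ω, Function.update_eq_self]
  have hm : Measurable fun ω : Fin n → G => Function.update ω j w := measurable_update_const j w
  { record := fun ω => X.record (Function.update ω j w)
    seg := fun i t ω => X.seg i t (Function.update ω j w)
    record_meas := X.record_meas.comp hm
    seg_meas := fun i => (X.seg_meas i).comp (measurable_fst.prodMk (hm.comp measurable_snd))
    start := fun i hi ω => by
      obtain rfl := hP.slot_unique (hP.obsTime_mem_slot j) hi
      rw [X.update j hs.2, hν, hβ, hrec]
    evolve := fun i hi ω => by
      have h1 := X.evolve i (hs.2.trans hi) (Function.update ω j w)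
      have h2 : j.succ ≤ i := (hP.lt_succ_iff (hP.obsTime_mem_slot j)).1 hi
      have h3 : P.obsTime j ≤ P.τ i.castSucc := hP.succ_le_castSucc (i := j.castSucc) (by
        rw [Fin.lt_def]
        rw [Fin.le_def] at h2
        simp only [Fin.val_succ, Fin.val_castSucc] at *
        omega)
      rw [max_eq_right (hs.2.le.trans h3)] at h1
      rw [max_eq_right h3]
      refine h1.congr (fun t _ => ?_) fun _ _ => rfl
      simp only [Control.after, hupd]
    observe := fun k hk ω => by
      have hkj : k ≠ j := (hP.obsTime_lt_iff.1 hk).ne'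
      rw [X.observe k (hs.2.trans hk), Function.update_of_ne hkj]
      simp only [Control.after, hupd]
    update := fun k hk ω => by
      rw [X.update k (hs.2.trans hk)]
      simp only [Control.after, hupd] }

/-- The cost of a trajectory, conditioned on the noise at the next observation time. -/
theorem Trajectory.cost_eq_after (hP : P.Standing) {j : Fin n} {s : ℝ}
    (hs : s ∈ P.slot j.castSucc) {u : P.Control s} {μ : Prob d} (X : P.Trajectory u μ)
    {ν : Prob d} {β : Eucl k₂} (hν : ∀ ω, X.seg j.castSucc (P.obsTime j) ω = ν)
    (hβ : ∀ ω, u.β j (X.record ω) = β) (y : Fin n → Y) :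
    Integrable (fun w => (X.after hP hs hν hβ w).cost) (P.γ j : Measure G) ∧
    X.cost = (∫ t in s..P.obsTime j, P.ℓ t (flow hP (hP.isTimeSpan hs)
        (u.toOpenLoop y (hP.isTimeSpan hs).le_T) μ t) (u.α t y))
      + P.h (P.obsTime j) ν β
      + ∫ w, (X.after hP hs hν hβ w).cost ∂(P.γ j : Measure G) := by
  refine X.cost_eq_of_payoff_update hP (hP.slot_subset _ hs) j
    (fun w => X.after hP hs hν hβ w) (hP.slot_subset _ (hP.obsTime_mem_slot j)) fun w ω => ?_
  have hrec : X.record (Function.update ω j w) j = P.obs j ν β w := by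
    rw [X.observe j hs.2, hν, hβ, Function.update_self]
  have hupd : Function.update (X.record (Function.update ω j w)) j (P.obs j ν β w)
      = X.record (Function.update ω j w) := by
    rw [← hrec, Function.update_eq_self]
  rw [X.payoff_split hP hs (X.after hP hs hν hβ w) (Function.update ω j w) ω
    (fun _ _ _ => rfl) (fun t _ => ?_) (fun i _ => ?_), hν, hβ]
  · congr 2
    have hle : s ≤ P.obsTime j := hs.2.le
    refine intervalIntegral.integral_congr_Ioo_of_le hle fun t ht => ?_
    rw [X.seg_eq_flow hP hs y _ ⟨ht.1.le, ht.2.le⟩,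
      u.α_eq_of_lt hP hs ⟨ht.1.le, ht.2⟩ _ y]
  · simp only [Control.after, Trajectory.after, hupd]
  · simp only [Control.after, Trajectory.after, hupd]

theorem Trajectory.cost_eq_last (hP : P.Standing) {s : ℝ} (hs : s ∈ P.slot (Fin.last n))
    {u : P.Control s} {μ : Prob d} (X : P.Trajectory u μ) (y : Fin n → Y) :
    X.cost = (∫ t in s..P.T, P.ℓ t (flow hP (hP.isTimeSpan hs)
        (u.toOpenLoop y (hP.isTimeSpan hs).le_T) μ t) (u.α t y))
      + P.g (flow hP (hP.isTimeSpan hs) (u.toOpenLoop y (hP.isTimeSpan hs).le_T) μ P.T) := by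
  have hle : s ≤ P.T := hs.2.le
  have h : ∀ ω, X.payoff ω = (∫ t in s..P.T, P.ℓ t (flow hP (hP.isTimeSpan hs)
        (u.toOpenLoop y (hP.isTimeSpan hs).le_T) μ t) (u.α t y))
      + P.g (flow hP (hP.isTimeSpan hs) (u.toOpenLoop y (hP.isTimeSpan hs).le_T) μ P.T) := by
    intro ω
    rw [X.payoff_last hP hs, X.seg_eq_flow hP hs y ω (t := P.T) ⟨hle, le_rfl⟩]
    congr 1
    refine intervalIntegral.integral_congr_Ioo_of_le hle fun t ht => ?_
    rw [X.seg_eq_flow hP hs y _ ⟨ht.1.le, ht.2.le⟩,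
      u.α_eq_of_lt hP hs ⟨ht.1.le, ht.2⟩ _ y]
  rw [X.cost_eq_integral_payoff]
  simp_rw [h]
  simp

/-- The continuation of a feedback control is a feedback control. -/
theorem Trajectory.IsFeedback.after (hP : P.Standing) {j : Fin n} {s : ℝ}
    (hs : s ∈ P.slot j.castSucc) {u : P.Control s} {μ : Prob d} {X : P.Trajectory u μ}
    {F : ℝ → Prob d → Eucl k₁ × Eucl k₂} (hF : X.IsFeedback F)
    {ν : Prob d} {β : Eucl k₂} (hν : ∀ ω, X.seg j.castSucc (P.obsTime j) ω = ν)
    (hβ : ∀ ω, u.β j (X.record ω) = β) (w : G) : (X.after hP hs hν hβ w).IsFeedback F := by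
  have hupd : ∀ ω, Function.update (X.record (Function.update ω j w)) j (P.obs j ν β w)
      = X.record (Function.update ω j w) := fun ω => by
    have hrec : X.record (Function.update ω j w) j = P.obs j ν β w := by
      rw [X.observe j hs.2, hν, hβ, Function.update_self]
    rw [← hrec, Function.update_eq_self]
  refine ⟨fun i t ht hjt hobs ω => ?_, fun k hk ω => ?_⟩
  · have := hF.α_eq i t ht (hs.2.le.trans hjt) hobs (Function.update ω j w)
    simpa only [Control.after, Trajectory.after, hupd] using this
  · have := hF.β_eq k (hs.2.trans hk) (Function.update ω j w)
    simpa only [Control.after, Trajectory.after, hupd] using this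

end ObsControl

/-! ### The cost up to the next observation -/

namespace ObsControl

variable {d k₁ k₂ n : ℕ} {G Y : Type*} [MeasurableSpace G] [MeasurableSpace Y]
  {P : ObsControl d k₁ k₂ n G Y}

theorem Standing.measurable_post (hP : P.Standing) :
    Measurable fun q : Eucl k₂ × Prob d × Y => P.post q.1 q.2.1 q.2.2 := by
  have hμ : Measurable fun q : Eucl k₂ × Prob d × Y => q.2.1 := by fun_prop
  have hK : Measurable fun p : (Eucl k₂ × Prob d × Y) × Eucl d =>
      (P.K p.1.1 p.1.2.1 p.1.2.2 p.2 : ℝ≥0∞) :=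
    (hP.K_meas.comp (by fun_prop : Measurable fun p : (Eucl k₂ × Prob d × Y) × Eucl d =>
      (p.1.1, p.1.2.1, p.1.2.2, p.2))).coe_nnreal_ennreal
  have hcond : MeasurableSet {q : Eucl k₂ × Prob d × Y |
      ∫⁻ x, (P.K q.1 q.2.1 q.2.2 x : ℝ≥0∞) ∂(q.2.1 : Measure (Eucl d)) = 1} :=
    measurableSet_eq_fun (measurable_lintegral_prob hμ hK) measurable_const
  have h : Measurable fun q : Eucl k₂ × Prob d × Y =>
      (P.post q.1 q.2.1 q.2.2 : Measure (Eucl d)) := by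
    refine Measure.measurable_of_measurable_coe _ fun A hA => ?_
    have hA' : Measurable fun q : Eucl k₂ × Prob d × Y =>
        ∫⁻ x, A.indicator (fun x => (P.K q.1 q.2.1 q.2.2 x : ℝ≥0∞)) x
          ∂(q.2.1 : Measure (Eucl d)) := by
      refine measurable_lintegral_prob hμ ?_
      exact hK.indicator (measurable_snd hA)
    have hμA : Measurable fun q : Eucl k₂ × Prob d × Y => (q.2.1 : Measure (Eucl d)) A :=
      (Measure.measurable_coe hA).comp (measurable_subtype_coe.comp hμ)
    convert Measurable.ite hcond hA' hμA using 1
    funext q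
    by_cases hq : ∫⁻ x, (P.K q.1 q.2.1 q.2.2 x : ℝ≥0∞) ∂(q.2.1 : Measure (Eucl d)) = 1
    · have e : (P.post q.1 q.2.1 q.2.2 : Measure (Eucl d))
          = (q.2.1 : Measure (Eucl d)).withDensity fun x => (P.K q.1 q.2.1 q.2.2 x : ℝ≥0∞) :=
        congrArg Subtype.val (dif_pos hq)
      rw [if_pos hq, e, withDensity_apply _ hA, lintegral_indicator hA]
    · simp [post, hq]
    · exact Classical.decPred _
  exact h.subtype_mk

theorem Standing.measurable_post_obs (hP : P.Standing) (j : Fin n) (ν : Prob d) (β : Eucl k₂) :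
    Measurable fun w => P.post β ν (P.obs j ν β w) :=
  hP.measurable_post.comp (measurable_const.prodMk (measurable_const.prodMk
    ((hP.obs_meas j).comp (measurable_const.prodMk (measurable_const.prodMk measurable_id)))))

theorem Standing.integrable_value_post (hP : P.Standing)
    (hV : ∀ s ∈ Ico 0 P.T, Continuous (P.value s)) (j : Fin n) (ν : Prob d) (β : Eucl k₂) :
    Integrable (fun w => P.value (P.obsTime j) (P.post β ν (P.obs j ν β w)))
      (P.γ j : Measure G) := by
  obtain ⟨C, hC⟩ := hP.exists_value_bound
  have hj := hP.slot_subset _ (hP.obsTime_mem_slot j)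
  exact Integrable.of_bound
    ((hV _ hj).measurable.comp (hP.measurable_post_obs j ν β)).aestronglyMeasurable C
    (Eventually.of_forall fun w => hC _ hj _)

/-- The cost incurred at the end of `[t_i, t_{i+1})` from the state `ν` on: the expression
`h + E[V]` minimized by the impulse operator, or the terminal cost on the last interval. -/
def exitCost (P : ObsControl d k₁ k₂ n G Y) (i : Fin (n + 1)) (ν : Prob d)
    (v : Eucl k₁ × Eucl k₂) : ℝ :=
  Fin.lastCases (motive := fun _ => ℝ) (P.g ν) (fun j => P.impulseArg j ν v) i

@[simp]
theorem exitCost_last (ν : Prob d) (v : Eucl k₁ × Eucl k₂) :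
    P.exitCost (Fin.last n) ν v = P.g ν := by
  simp [exitCost]

@[simp]
theorem exitCost_castSucc (j : Fin n) (ν : Prob d) (v : Eucl k₁ × Eucl k₂) :
    P.exitCost j.castSucc ν v = P.impulseArg j ν v := by
  simp [exitCost]

theorem Standing.equicontinuous_exitCost (hP : P.Standing)
    (hV : ∀ s ∈ Ico 0 P.T, Continuous (P.value s)) (i : Fin (n + 1)) :
    Equicontinuous fun (v : P.U) (ν : Prob d) => P.exitCost i ν v := by
  obtain ⟨C, hC⟩ := hP.exists_value_bound
  cases i using Fin.lastCases with
  | last =>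
    intro ν
    rw [Metric.equicontinuousAt_iff_right]
    intro ε hε
    filter_upwards [Metric.tendsto_nhds.1 (hP.g_cont.tendsto ν) ε hε] with m hm v
    simpa [dist_comm] using hm
  | cast j =>
    have hj := hP.slot_subset _ (hP.obsTime_mem_slot j)
    intro ν
    have h1 := hP.h_cont j ν
    have h2 := hP.update_cont j
      (BoundedContinuousFunction.ofNormedAddCommGroup _ (hV _ hj) C (hC _ hj)) ν
    rw [Metric.equicontinuousAt_iff_right] at *
    intro ε hε
    filter_upwards [h1 (ε / 2) (half_pos hε), h2 (ε / 2) (half_pos hε)] with m hm1 hm2 v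
    have := dist_add_add_le (P.h (P.obsTime j) ν v.1.2)
      (∫ w, P.value (P.obsTime j) (P.post v.1.2 ν (P.obs j ν v.1.2 w)) ∂(P.γ j : Measure G))
      (P.h (P.obsTime j) m v.1.2)
      (∫ w, P.value (P.obsTime j) (P.post v.1.2 m (P.obs j m v.1.2 w)) ∂(P.γ j : Measure G))
    simp only [exitCost_castSucc, impulseArg]
    refine this.trans_lt ?_
    have e1 := hm1 v
    have e2 := hm2 v
    simp only [BoundedContinuousFunction.coe_ofNormedAddCommGroup] at e2
    linarith

theorem Standing.exists_exitCost_bound (hP : P.Standing) (i : Fin (n + 1)) :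
    ∃ C, ∀ ν : Prob d, ∀ v ∈ P.U, |P.exitCost i ν v| ≤ C := by
  obtain ⟨C, hC⟩ := hP.exists_value_bound
  obtain ⟨Ch, hCh⟩ := hP.h_bdd
  cases i using Fin.lastCases with
  | last =>
    obtain ⟨Cg, hCg⟩ := hP.g_bdd
    exact ⟨Cg, fun ν v _ => by simpa using hCg ν⟩
  | cast j =>
    refine ⟨Ch + C, fun ν v hv => ?_⟩
    have hj := hP.slot_subset _ (hP.obsTime_mem_slot j)
    simp only [exitCost_castSucc, impulseArg]
    refine (abs_add_le _ _).trans (add_le_add (hCh v hv j ν) ?_)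
    simpa using norm_integral_le_of_norm_le_const (μ := (P.γ j : Measure G))
      (f := fun w => P.value (P.obsTime j) (P.post v.2 ν (P.obs j ν v.2 w)))
      (Eventually.of_forall fun w => hC _ hj _)

/-- The cost of using `a` until the end of the slot, and then paying the exit cost for `v`. -/
def legCost (hP : P.Standing) {i : Fin (n + 1)} {s : ℝ} (hs : s ∈ P.slot i)
    (a : P.OpenLoop s (P.τ i.succ)) (ν : Prob d) (v : Eucl k₁ × Eucl k₂) : ℝ :=
  (∫ t in s..P.τ i.succ, P.ℓ t (flow hP (hP.isTimeSpan hs) a ν t) (a.α t))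
    + P.exitCost i (flow hP (hP.isTimeSpan hs) a ν (P.τ i.succ)) v

theorem continuous_integral_ℓ_flow (hP : P.Standing) {r₁ r₂ : ℝ} (hr : P.IsTimeSpan r₁ r₂)
    (a : P.OpenLoop r₁ r₂) :
    Continuous fun ν => ∫ t in r₁..r₂, P.ℓ t (flow hP hr a ν t) (a.α t) := by
  obtain ⟨C, hC⟩ := hP.ℓ_bdd
  refine intervalIntegral.continuous_of_dominated_interval (bound := fun _ => C)
    (fun ν => ?_) (fun ν => ?_) intervalIntegrable_const ?_
  · exact (hP.ℓ_meas.comp (measurable_id.prodMk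
      ((continuous_flow_time hP hr a ν).measurable.prodMk a.meas))).aestronglyMeasurable
  · refine Eventually.of_forall fun t ht => ?_
    rw [uIoc_of_le hr.lt.le] at ht
    obtain ⟨v, hv, hvt⟩ := a.mem t ⟨ht.1.le, ht.2⟩
    rw [← hvt]
    exact hC v hv t ⟨hr.nonneg.trans ht.1.le, ht.2.trans hr.le_T⟩ _
  · refine Eventually.of_forall fun t ht => ?_
    rw [uIoc_of_le hr.lt.le] at ht
    obtain ⟨v, hv, hvt⟩ := a.mem t ⟨ht.1.le, ht.2⟩
    have ht' : t ∈ Icc 0 P.T := ⟨hr.nonneg.trans ht.1.le, ht.2.trans hr.le_T⟩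
    have h1 : ContinuousOn (fun q : ℝ × Prob d => P.ℓ q.1 q.2 v.1) (Icc 0 P.T ×ˢ univ) :=
      hP.ℓ_cont.continuousOn ⟨v, hv⟩
    have h2 : Continuous fun m : Prob d => P.ℓ t m v.1 :=
      h1.comp_continuous (f := fun m : Prob d => (t, m)) (by fun_prop) fun m => ⟨ht', mem_univ _⟩
    rw [← hvt]
    exact h2.comp (continuous_flow_start hP hr a t)

theorem continuous_legCost (hP : P.Standing) (hV : ∀ s ∈ Ico 0 P.T, Continuous (P.value s))
    {i : Fin (n + 1)} {s : ℝ} (hs : s ∈ P.slot i) (a : P.OpenLoop s (P.τ i.succ))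
    {v : Eucl k₁ × Eucl k₂} (hv : v ∈ P.U) : Continuous fun ν => legCost hP hs a ν v :=
  (continuous_integral_ℓ_flow hP _ a).add
    (((hP.equicontinuous_exitCost hV i).continuous ⟨v, hv⟩).comp (continuous_flow_start hP _ a _))

/-- Every admissible control is at least as costly as its part before the next observation followed
by the value function. -/
theorem Trajectory.exists_legCost_le (hP : P.Standing)
    (hV : ∀ s ∈ Ico 0 P.T, Continuous (P.value s)) {i : Fin (n + 1)} {s : ℝ}
    (hs : s ∈ P.slot i) {u : P.Control s} {μ : Prob d} (X : P.Trajectory u μ) :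
    ∃ a : P.OpenLoop s (P.τ i.succ), ∃ v ∈ P.U, legCost hP hs a μ v ≤ X.cost := by
  obtain ⟨ω₀⟩ : Nonempty (Fin n → G) := P.noise.nonempty_of_neZero
  refine ⟨u.toOpenLoop (X.record ω₀) (hP.isTimeSpan hs).le_T, ?_⟩
  cases i using Fin.lastCases with
  | last =>
    obtain ⟨v, hv⟩ := hP.U_nonempty
    refine ⟨v, hv, ?_⟩
    rw [X.cost_eq_last hP hs (X.record ω₀), legCost, exitCost_last]
    exact le_rfl
  | cast j =>
    obtain ⟨v, hv, hvβ⟩ := u.β_mem j hs.2 (X.record ω₀)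
    refine ⟨v, hv, ?_⟩
    obtain ⟨h1, h2⟩ := X.cost_eq_after hP hs
      (fun ω => X.seg_eq_flow hP hs (X.record ω₀) ω ⟨hs.2.le, le_rfl⟩)
      (fun ω => u.β_eq_of_next hP hs _ (X.record ω₀)) (X.record ω₀)
    rw [h2, legCost, exitCost_castSucc, impulseArg, ← add_assoc, hvβ]
    refine add_le_add le_rfl ?_
    exact integral_mono (hP.integrable_value_post hV _ _ _) h1 fun w =>
      hP.value_le_cost (hP.slot_subset _ (hP.obsTime_mem_slot j)) _

end ObsControl

/-! ### Measurable families of controls -/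

namespace ObsControl

variable {d k₁ k₂ n : ℕ} {G Y : Type*} [MeasurableSpace G] [MeasurableSpace Y]
  {P : ObsControl d k₁ k₂ n G Y}

/-- Controls on `[s, T]` for all initial states at once, with their trajectories, depending jointly
measurably on the initial state. The trajectories are required to depend only on the noises after
time `s`: their records may contain arbitrary entries for the observations up to `s`. -/
structure Family (P : ObsControl d k₁ k₂ n G Y) (s : ℝ) where
  ctrl : Prob d → P.Control s
  traj : ∀ ν, P.Trajectory (ctrl ν) ν
  α_meas : Measurable fun q : ℝ × Prob d × (Fin n → Y) => (ctrl q.2.1).α q.1 q.2.2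
  β_meas : ∀ j, Measurable fun q : Prob d × (Fin n → Y) => (ctrl q.1).β j q.2
  record_meas : Measurable fun q : Prob d × (Fin n → G) => (traj q.1).record q.2
  seg_meas : ∀ i, Measurable fun q : ℝ × Prob d × (Fin n → G) => (traj q.2.1).seg i q.1 q.2.2
  record_congr : ∀ ν ω ω', (∀ i, s < P.obsTime i → ω i = ω' i) →
    (traj ν).record ω = (traj ν).record ω'
  seg_congr : ∀ ν i t ω ω', (∀ i, s < P.obsTime i → ω i = ω' i) →
    (traj ν).seg i t ω = (traj ν).seg i t ω'

theorem Family.payoff_congr {s : ℝ} (F : P.Family s) (ν : Prob d) {ω ω' : Fin n → G}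
    (h : ∀ i, s < P.obsTime i → ω i = ω' i) : (F.traj ν).payoff ω = (F.traj ν).payoff ω' := by
  simp only [Trajectory.payoff, F.record_congr ν ω ω' h, F.seg_congr ν _ _ ω ω' h]

/-- A choice of an open loop control from `s` to the end of the slot, and of a measurement control
to be used there, for every initial state and depending measurably on it. -/
structure Leg (hP : P.Standing) {i : Fin (n + 1)} {s : ℝ} (hs : s ∈ P.slot i) where
  ctrl : Prob d → P.OpenLoop s (P.τ i.succ)
  β : Prob d → Eucl k₂
  α_meas : Measurable fun q : ℝ × Prob d => (ctrl q.2).α q.1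
  flow_meas : Measurable fun q : ℝ × Prob d => flow hP (hP.isTimeSpan hs) (ctrl q.2) q.2 q.1
  β_meas : Measurable β
  β_mem : ∀ ν, β ν ∈ Prod.snd '' P.U

/-- The choice among countably many pairs of controls by a measurable index. -/
def Leg.ofCountable (hP : P.Standing) {i : Fin (n + 1)} {s : ℝ} (hs : s ∈ P.slot i)
    {κ : Prob d → ℕ} (hκ : Measurable κ) (a : ℕ → P.OpenLoop s (P.τ i.succ)) (v : ℕ → P.U) :
    Leg hP hs where
  ctrl ν := a (κ ν)
  β ν := (v (κ ν)).1.2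
  α_meas := by
    have h : Measurable fun p : ℝ × ℕ => (a p.2).α p.1 :=
      measurable_from_prod_countable_left fun k => (a k).meas
    exact h.comp (g := fun p : ℝ × ℕ => (a p.2).α p.1) (f := fun q : ℝ × Prob d => (q.1, κ q.2))
      (measurable_fst.prodMk (hκ.comp measurable_snd))
  flow_meas := by
    have h : Measurable fun p : (ℝ × Prob d) × ℕ =>
        flow hP (hP.isTimeSpan hs) (a p.2) p.1.2 p.1.1 :=
      measurable_from_prod_countable_left fun k => measurable_flow hP _ (a k)
    exact h.comp (g := fun p : (ℝ × Prob d) × ℕ => flow hP (hP.isTimeSpan hs) (a p.2) p.1.2 p.1.1)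
      (f := fun q : ℝ × Prob d => (q, κ q.2)) (measurable_id.prodMk (hκ.comp measurable_snd))
  β_meas := (measurable_from_nat (f := fun k => (v k).1.2)).comp hκ
  β_mem ν := ⟨_, (v (κ ν)).2, rfl⟩

/-- On the last time interval a leg is a family of controls. -/
def Leg.toFamily (hP : P.Standing) {s : ℝ} (hs : s ∈ P.slot (Fin.last n))
    (L : Leg hP hs) (y : Fin n → Y) : P.Family s :=
  have hno : ∀ j, ¬ s < P.obsTime j := fun j => by
    rw [hP.lt_obsTime_iff hs]
    exact not_le.2 (Fin.castSucc_lt_last j)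
  { ctrl := fun ν =>
      { α := fun t _ => (L.ctrl ν).α t
        β := fun _ _ => 0
        α_meas := (L.ctrl ν).meas.comp measurable_fst
        β_meas := fun _ => measurable_const
        α_adapted := fun _ _ _ _ _ => rfl
        β_predictable := fun _ _ _ _ _ => rfl
        α_mem := fun t ht _ => (L.ctrl ν).mem t ht
        β_mem := fun j hj => absurd hj (hno j) }
    traj := fun ν =>
      { record := fun _ => y
        seg := fun _ t _ => flow hP (hP.isTimeSpan hs) (L.ctrl ν) ν t
        record_meas := measurable_const
        seg_meas := fun _ => (continuous_flow_time hP _ _ ν).measurable.comp measurable_fst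
        start := fun _ _ _ => flow_start hP _ _ ν
        evolve := fun i hi ω => by
          obtain rfl := (Fin.last_le_iff).1 ((hP.lt_succ_iff hs).1 hi)
          rw [max_eq_left hs.1]
          exact isFPSolution_flow hP _ _ ν
        observe := fun j hj => absurd hj (hno j)
        update := fun j hj => absurd hj (hno j) }
    α_meas := L.α_meas.comp (measurable_fst.prodMk measurable_snd.fst)
    β_meas := fun _ => measurable_const
    record_meas := measurable_const
    seg_meas := fun _ => L.flow_meas.comp (measurable_fst.prodMk measurable_snd.fst)
    record_congr := fun _ _ _ _ => rfl
    seg_congr := fun _ _ _ _ _ _ => rfl }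

/-- A control after `t_j` ignores the entry of the record for the observation at `t_j`. -/
theorem Control.α_update (hP : P.Standing) {j : Fin n} (u : P.Control (P.obsTime j)) {t : ℝ}
    (ht : t ∈ Icc (P.obsTime j) P.T) (z : Fin n → Y) (y : Y) :
    u.α t (Function.update z j y) = u.α t z :=
  u.α_adapted t ht _ _ fun _ hi _ => Function.update_of_ne (hP.obsTime_lt_iff.1 hi).ne' _ _

theorem Control.β_update (hP : P.Standing) {j k : Fin n} (u : P.Control (P.obsTime j))
    (hk : P.obsTime j < P.obsTime k) (z : Fin n → Y) (y : Y) :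
    u.β k (Function.update z j y) = u.β k z :=
  u.β_predictable k hk _ _ fun _ hi _ => Function.update_of_ne (hP.obsTime_lt_iff.1 hi).ne' _ _

section Step

variable {hP : P.Standing} {j : Fin n} {s : ℝ} {hs : s ∈ P.slot j.castSucc}

/-- The state just before the observation at the end of the leg. -/
def Leg.prior (L : Leg hP hs) (ν : Prob d) : Prob d :=
  flow hP (hP.isTimeSpan hs) (L.ctrl ν) ν (P.obsTime j)

/-- The state just after the observation `y` at the end of the leg. -/
def Leg.posterior (L : Leg hP hs) (ν : Prob d) (y : Y) : Prob d :=
  P.post (L.β ν) (L.prior ν) y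

/-- The observation at the end of the leg. -/
def Leg.outcome (L : Leg hP hs) (ν : Prob d) (w : G) : Y :=
  P.obs j (L.prior ν) (L.β ν) w

variable (L : Leg hP hs)

theorem Leg.measurable_prior : Measurable L.prior :=
  L.flow_meas.comp measurable_prodMk_left

theorem Leg.measurable_posterior :
    Measurable fun q : Prob d × Y => L.posterior q.1 q.2 :=
  hP.measurable_post.comp ((L.β_meas.comp measurable_fst).prodMk
    ((L.measurable_prior.comp measurable_fst).prodMk measurable_snd))

theorem Leg.measurable_outcome : Measurable fun q : Prob d × G => L.outcome q.1 q.2 :=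
  (hP.obs_meas j).comp ((L.measurable_prior.comp measurable_fst).prodMk
    ((L.β_meas.comp measurable_fst).prodMk measurable_snd))

variable (F : P.Family (P.obsTime j))

/-- Use the leg up to the next observation, and then the member of the family that belongs to the
state reached. -/
def Leg.stepCtrl (ν : Prob d) : P.Control s where
  α t y := if t < P.obsTime j then (L.ctrl ν).α t else (F.ctrl (L.posterior ν (y j))).α t y
  β k y := if k = j then L.β ν else (F.ctrl (L.posterior ν (y j))).β k y
  α_meas := Measurable.ite (measurableSet_lt measurable_fst measurable_const)
    ((L.ctrl ν).meas.comp measurable_fst)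
    (F.α_meas.comp (measurable_fst.prodMk ((L.measurable_posterior.comp
      (measurable_const.prodMk ((measurable_pi_apply j).comp measurable_snd))).prodMk
        measurable_snd)))
  β_meas k := by
    by_cases hk : k = j
    · simp only [hk, if_true, measurable_const]
    · simp only [hk, if_false]
      exact (F.β_meas k).comp ((L.measurable_posterior.comp
        (measurable_const.prodMk (measurable_pi_apply j))).prodMk measurable_id)
  α_adapted t ht y y' h := by
    by_cases htj : t < P.obsTime j
    · simp only [htj, if_true]
    · simp only [htj, if_false]
      rw [h j hs.2 (not_lt.1 htj)]
      exact (F.ctrl _).α_adapted t ⟨not_lt.1 htj, ht.2⟩ _ _ fun i hi => h i (hs.2.trans hi)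
  β_predictable k hk y y' h := by
    by_cases hkj : k = j
    · simp only [hkj, if_true]
    · have hjk : P.obsTime j < P.obsTime k := hP.obsTime_lt_iff.2 (lt_of_le_of_ne
        (by simpa using (hP.lt_obsTime_iff hs).1 hk) (Ne.symm hkj))
      simp only [hkj, if_false]
      rw [h j hs.2 hjk]
      exact (F.ctrl _).β_predictable k hjk _ _ fun i hi => h i (hs.2.trans hi)
  α_mem t ht y := by
    by_cases htj : t < P.obsTime j
    · simp only [htj, if_true]
      exact (L.ctrl ν).mem t ⟨ht.1, htj.le⟩
    · simp only [htj, if_false]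
      exact (F.ctrl _).α_mem t ⟨not_lt.1 htj, ht.2⟩ y
  β_mem k hk y := by
    by_cases hkj : k = j
    · simp only [hkj, if_true]
      exact L.β_mem ν
    · have hjk : P.obsTime j < P.obsTime k := hP.obsTime_lt_iff.2 (lt_of_le_of_ne
        (by simpa using (hP.lt_obsTime_iff hs).1 hk) (Ne.symm hkj))
      simp only [hkj, if_false]
      exact (F.ctrl _).β_mem k hjk y

/-- The trajectory of the family from the observation time `t_j` on, when the noise takes the value
`w` there. -/
def Leg.tail (ν : Prob d) (w : G) :
    P.Trajectory (F.ctrl (L.posterior ν (L.outcome ν w))) (L.posterior ν (L.outcome ν w)) :=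
  F.traj _

/-- The record of the observations along the concatenated trajectory. -/
def Leg.stepRecord (ν : Prob d) (ω : Fin n → G) : Fin n → Y :=
  Function.update ((L.tail F ν (ω j)).record ω) j (L.outcome ν (ω j))

/-- The path of the concatenated trajectory. -/
def Leg.stepSeg (ν : Prob d) (i : Fin (n + 1)) (t : ℝ) (ω : Fin n → G) : Prob d :=
  if j.castSucc < i then (L.tail F ν (ω j)).seg i t ω
  else flow hP (hP.isTimeSpan hs) (L.ctrl ν) ν t

theorem Leg.stepCtrl_α_of_lt (ν : Prob d) {t : ℝ} (ht : t < P.obsTime j) (y : Fin n → Y) :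
    (L.stepCtrl F ν).α t y = (L.ctrl ν).α t :=
  if_pos ht

theorem Leg.stepCtrl_α_record (ν : Prob d) {t : ℝ} (ht : t ∈ Icc (P.obsTime j) P.T)
    (ω : Fin n → G) : (L.stepCtrl F ν).α t (L.stepRecord F ν ω)
      = (F.ctrl (L.posterior ν (L.outcome ν (ω j)))).α t ((L.tail F ν (ω j)).record ω) := by
  simp only [stepCtrl, stepRecord, Function.update_self, if_neg ht.1.not_gt]
  exact Control.α_update hP _ ht _ _

theorem Leg.stepCtrl_β_self (ν : Prob d) (y : Fin n → Y) : (L.stepCtrl F ν).β j y = L.β ν :=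
  if_pos rfl

theorem Leg.stepCtrl_β_record (ν : Prob d) {k : Fin n} (hk : j < k) (ω : Fin n → G) :
    (L.stepCtrl F ν).β k (L.stepRecord F ν ω)
      = (F.ctrl (L.posterior ν (L.outcome ν (ω j)))).β k ((L.tail F ν (ω j)).record ω) := by
  simp only [stepCtrl, stepRecord, Function.update_self, if_neg hk.ne']
  exact Control.β_update hP _ (hP.obsTime_lt_iff.2 hk) _ _

theorem Leg.measurable_tail_start :
    Measurable fun q : Prob d × (Fin n → G) => L.posterior q.1 (L.outcome q.1 (q.2 j)) :=
  L.measurable_posterior.comp (measurable_fst.prodMk (L.measurable_outcome.comp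
    (measurable_fst.prodMk ((measurable_pi_apply j).comp measurable_snd))))

theorem Leg.measurable_stepRecord :
    Measurable fun q : Prob d × (Fin n → G) => L.stepRecord F q.1 q.2 :=
  (measurable_update_uncurry j).comp ((L.measurable_outcome.comp
    (measurable_fst.prodMk ((measurable_pi_apply j).comp measurable_snd))).prodMk
      (F.record_meas.comp (L.measurable_tail_start.prodMk measurable_snd)))

theorem Leg.measurable_stepSeg (i : Fin (n + 1)) :
    Measurable fun q : ℝ × Prob d × (Fin n → G) => L.stepSeg F q.2.1 i q.1 q.2.2 := by
  by_cases h : j.castSucc < i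
  · simp only [stepSeg, h, if_true]
    exact (F.seg_meas i).comp (measurable_fst.prodMk
      ((L.measurable_tail_start.comp measurable_snd).prodMk measurable_snd.snd))
  · simp only [stepSeg, h, if_false]
    exact L.flow_meas.comp (measurable_fst.prodMk measurable_snd.fst)

/-- The concatenation of a leg with a family of controls from the next observation time on. -/
def Leg.stepTraj (ν : Prob d) : P.Trajectory (L.stepCtrl F ν) ν where
  record := L.stepRecord F ν
  seg i t ω := L.stepSeg F ν i t ω
  record_meas := (L.measurable_stepRecord F).comp (measurable_const.prodMk measurable_id)
  seg_meas i := (L.measurable_stepSeg F i).comp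
    (measurable_fst.prodMk (measurable_const.prodMk measurable_snd))
  start i hi ω := by
    obtain rfl := hP.slot_unique hs hi
    simp only [stepSeg, lt_irrefl, if_false]
    exact flow_start hP _ _ ν
  evolve i hi ω := by
    rcases ((hP.lt_succ_iff hs).1 hi).eq_or_lt with rfl | hlt
    · rw [max_eq_left hs.1]
      refine (isFPSolution_flow hP (hP.isTimeSpan hs) (L.ctrl ν) ν).congr (fun t ht => ?_)
        fun t _ => ?_
      · exact (L.stepCtrl_α_of_lt F ν ht.2 _).symm
      · simp only [stepSeg, lt_irrefl, if_false]
    · have h1 : P.obsTime j ≤ P.τ i.castSucc := hP.succ_le_castSucc hlt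
      have h2 := (L.tail F ν (ω j)).evolve i
        (h1.trans_lt (hP.τ_strictMono Fin.castSucc_lt_succ)) ω
      rw [max_eq_right h1] at h2
      rw [max_eq_right (hs.2.le.trans h1)]
      refine h2.congr (fun t ht => ?_) fun t _ => ?_
      · exact (L.stepCtrl_α_record F ν ⟨h1.trans ht.1,
          ht.2.le.trans (hP.τ_strictMono.monotone (Fin.le_last _))⟩ ω).symm
      · simp only [stepSeg, hlt, if_true]
  observe k hk ω := by
    rcases (show j ≤ k by simpa using (hP.lt_obsTime_iff hs).1 hk).eq_or_lt with rfl | hlt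
    · simp only [stepSeg, lt_irrefl, if_false, L.stepCtrl_β_self, stepRecord,
        Function.update_self]
      rfl
    · rw [L.stepCtrl_β_record F ν hlt]
      simp only [stepSeg, Fin.castSucc_lt_castSucc_iff, hlt, if_true, stepRecord]
      rw [Function.update_of_ne hlt.ne']
      exact (L.tail F ν (ω j)).observe k (hP.obsTime_lt_iff.2 hlt) ω
  update k hk ω := by
    rcases (show j ≤ k by simpa using (hP.lt_obsTime_iff hs).1 hk).eq_or_lt with rfl | hlt
    · simp only [stepSeg, lt_irrefl, if_false, L.stepCtrl_β_self, stepRecord,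
        Function.update_self, Fin.castSucc_lt_succ, if_true]
      exact (L.tail F ν (ω j)).start _ (hP.obsTime_mem_slot j) ω
    · rw [L.stepCtrl_β_record F ν hlt]
      have h3 : j.castSucc < k.succ := (Fin.castSucc_lt_castSucc_iff.2 hlt).trans
        Fin.castSucc_lt_succ
      simp only [stepSeg, Fin.castSucc_lt_castSucc_iff, hlt, h3, if_true, stepRecord]
      rw [Function.update_of_ne hlt.ne']
      exact (L.tail F ν (ω j)).update k (hP.obsTime_lt_iff.2 hlt) ω

/-- The cost of the concatenated control, conditioned on the noise at the observation in between. -/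
theorem Leg.stepTraj_cost (ν : Prob d) :
    Integrable (fun w => (L.tail F ν w).cost) (P.γ j : Measure G) ∧
    (L.stepTraj F ν).cost
      = (∫ t in s..P.obsTime j, P.ℓ t (flow hP (hP.isTimeSpan hs) (L.ctrl ν) ν t)
          ((L.ctrl ν).α t))
        + P.h (P.obsTime j) (L.prior ν) (L.β ν)
        + ∫ w, (L.tail F ν w).cost ∂(P.γ j : Measure G) := by
  refine (L.stepTraj F ν).cost_eq_of_payoff_update hP (hP.slot_subset _ hs) j (L.tail F ν)
    (hP.slot_subset _ (hP.obsTime_mem_slot j)) fun w ω => ?_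
  have hcongr : ∀ k, P.obsTime j < P.obsTime k → Function.update ω j w k = ω k := fun k hk =>
    Function.update_of_ne (hP.obsTime_lt_iff.1 hk).ne' _ _
  have hw : ∀ w', w' = w →
      (L.tail F ν w').payoff (Function.update ω j w) = (L.tail F ν w).payoff ω := by
    rintro _ rfl
    exact F.payoff_congr _ hcongr
  have e1 : (L.stepTraj F ν).payoff (Function.update ω j w) = _ :=
    (L.stepTraj F ν).payoff_split hP hs (L.tail F ν (Function.update ω j w j)) _
      (Function.update ω j w) (fun i hi t => if_pos hi)
      (fun t ht => L.stepCtrl_α_record F ν ht _) (fun i hi => L.stepCtrl_β_record F ν hi _)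
  rw [e1, hw _ (Function.update_self _ _ _), L.stepCtrl_β_self]
  have hseg : ∀ t, (L.stepTraj F ν).seg j.castSucc t (Function.update ω j w)
      = flow hP (hP.isTimeSpan hs) (L.ctrl ν) ν t := fun t => if_neg (lt_irrefl _)
  simp only [hseg]
  congr 2
  have hle : s ≤ P.obsTime j := hs.2.le
  refine intervalIntegral.integral_congr_Ioo_of_le hle fun t ht => ?_
  simp only [L.stepCtrl_α_of_lt F ν ht.2]

/-- The family of the concatenated controls. -/
def Leg.step : P.Family s where
  ctrl := L.stepCtrl F
  traj := L.stepTraj F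
  α_meas := Measurable.ite (measurableSet_lt measurable_fst measurable_const)
    (L.α_meas.comp (measurable_fst.prodMk measurable_snd.fst))
    (F.α_meas.comp (measurable_fst.prodMk ((L.measurable_posterior.comp
      (measurable_snd.fst.prodMk ((measurable_pi_apply j).comp measurable_snd.snd))).prodMk
        measurable_snd.snd)))
  β_meas k := by
    by_cases hk : k = j
    · simp only [stepCtrl, hk, if_true]
      exact L.β_meas.comp measurable_fst
    · simp only [stepCtrl, hk, if_false]
      exact (F.β_meas k).comp ((L.measurable_posterior.comp
        (measurable_fst.prodMk ((measurable_pi_apply j).comp measurable_snd))).prodMk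
          measurable_snd)
  record_meas := L.measurable_stepRecord F
  seg_meas := L.measurable_stepSeg F
  record_congr ν ω ω' h := by
    have e : ∀ w', w' = ω' j → Function.update ((L.tail F ν w').record ω) j (L.outcome ν w')
        = L.stepRecord F ν ω' := by
      rintro _ rfl
      exact congrArg (fun z => Function.update z j (L.outcome ν (ω' j)))
        (F.record_congr _ ω ω' fun i hi => h i (hs.2.trans hi))
    exact e _ (h j hs.2)
  seg_congr ν i t ω ω' h := by
    have e : ∀ w', w' = ω' j → (if j.castSucc < i then (L.tail F ν w').seg i t ω
        else flow hP (hP.isTimeSpan hs) (L.ctrl ν) ν t) = L.stepSeg F ν i t ω' := by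
      rintro _ rfl
      exact if_congr Iff.rfl (F.seg_congr _ i t ω ω' fun i hi => h i (hs.2.trans hi)) rfl
    exact e _ (h j hs.2)

end Step

/-! ### Nearly optimal families and dynamic programming -/

theorem exists_openLoop (hP : P.Standing) (s r : ℝ) : Nonempty (P.OpenLoop s r) := by
  obtain ⟨v, hv⟩ := hP.U_nonempty
  exact ⟨⟨fun _ => v.1, measurable_const, fun _ _ => ⟨v, hv, rfl⟩⟩⟩

/-- If every leg can be continued to a family at a small loss, then there is a family of nearly
optimal controls: choose nearly optimal legs, which is possible measurably since the cost of a leg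
is continuous in the initial state and the space of states is Lindelöf. -/
theorem exists_nearly_optimal_family (hP : P.Standing)
    (hV : ∀ s ∈ Ico 0 P.T, Continuous (P.value s)) {i : Fin (n + 1)} {s : ℝ} (hs : s ∈ P.slot i)
    (h : ∀ ε > 0, ∀ (κ : Prob d → ℕ) (_ : Measurable κ) (a : ℕ → P.OpenLoop s (P.τ i.succ))
      (v : ℕ → P.U), ∃ F : P.Family s, ∀ ν,
        (F.traj ν).cost ≤ legCost hP hs (a (κ ν)) ν (v (κ ν)) + ε) {ε : ℝ} (hε : 0 < ε) :
    ∃ F : P.Family s, ∀ ν, (F.traj ν).cost ≤ P.value s ν + ε := by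
  obtain ⟨a₀⟩ := exists_openLoop hP s (P.τ i.succ)
  obtain ⟨v₀⟩ := hP.U_nonempty.to_subtype
  obtain ⟨F₀, -⟩ := h 1 one_pos (fun _ => 0) measurable_const (fun _ => a₀) fun _ => v₀
  let O : P.OpenLoop s (P.τ i.succ) × P.U → Set (Prob d) := fun p =>
    {ν | legCost hP hs p.1 ν p.2 < P.value s ν + ε / 2}
  have hO : ∀ p, IsOpen (O p) := fun p => isOpen_lt (continuous_legCost hP hV hs p.1 p.2.2)
    ((hV s (hP.slot_subset i hs)).add continuous_const)
  -- `F₀` shows that the infimum in the value function is over a nonempty set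
  have hcov : ∀ ν, ∃ p, ν ∈ O p := by
    intro ν
    have hlt : sInf {J | ∃ (u : P.Control s) (X : P.Trajectory u ν), J = X.cost}
        < P.value s ν + ε / 2 := by
      rw [value, if_pos (hP.slot_subset i hs).2]
      linarith
    have hne : {J | ∃ (u : P.Control s) (X : P.Trajectory u ν), J = X.cost}.Nonempty :=
      ⟨_, F₀.ctrl ν, F₀.traj ν, rfl⟩
    obtain ⟨_, ⟨u, X, rfl⟩, hJ⟩ := exists_lt_of_csInf_lt hne hlt
    obtain ⟨a, v, hv, hav⟩ := X.exists_legCost_le hP hV hs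
    exact ⟨(a, ⟨v, hv⟩), hav.trans_lt hJ⟩
  obtain ⟨S, hS, hSU⟩ := TopologicalSpace.isOpen_iUnion_countable O hO
  have hcov' : ∀ ν, ∃ p ∈ S, ν ∈ O p := by
    intro ν
    have : ν ∈ ⋃ p ∈ S, O p := by
      rw [hSU]
      exact mem_iUnion.2 (hcov ν)
    simpa using this
  obtain ⟨p₀, hp₀, -⟩ := hcov' ⟨Measure.dirac 0, inferInstance⟩
  obtain ⟨e, rfl⟩ := hS.exists_eq_range ⟨p₀, hp₀⟩
  have hcov'' : ∀ ν, ∃ k, ν ∈ O (e k) := fun ν => by simpa using hcov' ν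
  classical
  obtain ⟨F, hF⟩ := h (ε / 2) (half_pos hε) (fun ν => Nat.find (hcov'' ν))
    (measurable_find hcov'' fun k => (hO (e k)).measurableSet) (fun k => (e k).1) fun k => (e k).2
  refine ⟨F, fun ν => (hF ν).trans ?_⟩
  have : legCost hP hs (e (Nat.find (hcov'' ν))).1 ν (e (Nat.find (hcov'' ν))).2
    < P.value s ν + ε / 2 := Nat.find_spec (hcov'' ν)
  linarith

/-- Every measurable choice of legs can be continued to a family of controls, nearly optimally. -/
theorem exists_family_le_legCost (hP : P.Standing)
    (hV : ∀ s ∈ Ico 0 P.T, Continuous (P.value s)) (i : Fin (n + 1)) :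
    ∀ (s : ℝ) (hs : s ∈ P.slot i), ∀ ε > 0, ∀ (κ : Prob d → ℕ) (_ : Measurable κ)
      (a : ℕ → P.OpenLoop s (P.τ i.succ)) (v : ℕ → P.U), ∃ F : P.Family s, ∀ ν,
        (F.traj ν).cost ≤ legCost hP hs (a (κ ν)) ν (v (κ ν)) + ε := by
  induction i using Fin.reverseInduction with
  | last =>
    intro s hs ε hε κ hκ a v
    obtain ⟨ω₀⟩ : Nonempty (Fin n → G) := P.noise.nonempty_of_neZero
    let y : Fin n → Y := fun j => P.obs j ⟨Measure.dirac 0, inferInstance⟩ 0 (ω₀ j)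
    refine ⟨(Leg.ofCountable hP hs hκ a v).toFamily hP hs y, fun ν => ?_⟩
    rw [Trajectory.cost_eq_last hP hs _ y, legCost, exitCost_last]
    exact le_add_of_nonneg_right hε.le
  | cast j ih =>
    intro s hs ε hε κ hκ a v
    obtain ⟨F', hF'⟩ := exists_nearly_optimal_family hP hV (hP.obsTime_mem_slot j)
      (ih _ (hP.obsTime_mem_slot j)) hε
    let L := Leg.ofCountable hP hs hκ a v
    refine ⟨L.step F', fun ν => ?_⟩
    obtain ⟨h1, h2⟩ := L.stepTraj_cost F' ν
    have h3 := integral_mono h1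
      ((hP.integrable_value_post hV j (L.prior ν) (L.β ν)).add (integrable_const ε))
      fun w => hF' _
    simp only [Pi.add_apply] at h3
    rw [integral_add (hP.integrable_value_post hV j (L.prior ν) (L.β ν)) (integrable_const ε)]
      at h3
    simp only [integral_const, probReal_univ, one_smul] at h3
    have h4 : ((L.step F').traj ν).cost = (L.stepTraj F' ν).cost := rfl
    rw [h4, h2, legCost, exitCost_castSucc, impulseArg]
    refine (add_le_add le_rfl h3).trans (le_of_eq ?_)
    rw [← add_assoc, ← add_assoc]
    rfl

/-- The value function is at most the cost of a leg followed by the value function. -/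
theorem value_le_legCost (hP : P.Standing) (hV : ∀ s ∈ Ico 0 P.T, Continuous (P.value s))
    {i : Fin (n + 1)} {s : ℝ} (hs : s ∈ P.slot i) (a : P.OpenLoop s (P.τ i.succ)) (ν : Prob d)
    {v : Eucl k₁ × Eucl k₂} (hv : v ∈ P.U) : P.value s ν ≤ legCost hP hs a ν v := by
  refine le_of_forall_pos_le_add fun ε hε => ?_
  obtain ⟨F, hF⟩ := exists_family_le_legCost hP hV i s hs ε hε (fun _ => 0) measurable_const
    (fun _ => a) fun _ => ⟨v, hv⟩
  exact (hP.value_le_cost (hP.slot_subset i hs) (F.traj ν)).trans (hF ν)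

/-- There are legs which, followed by the value function, are nearly optimal. -/
theorem exists_legCost_le_value_add (hP : P.Standing)
    (hV : ∀ s ∈ Ico 0 P.T, Continuous (P.value s)) {i : Fin (n + 1)} {s : ℝ} (hs : s ∈ P.slot i)
    (ν : Prob d) {ε : ℝ} (hε : 0 < ε) :
    ∃ a : P.OpenLoop s (P.τ i.succ), ∃ v ∈ P.U, legCost hP hs a ν v ≤ P.value s ν + ε := by
  obtain ⟨F, hF⟩ := exists_nearly_optimal_family hP hV hs
    (exists_family_le_legCost hP hV i s hs) hε
  obtain ⟨a, v, hv, h⟩ := (F.traj ν).exists_legCost_le hP hV hs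
  exact ⟨a, v, hv, h.trans (hF ν)⟩

end ObsControl

/-! ### Dynamic programming between observations -/

namespace ObsControl

variable {d k₁ k₂ n : ℕ} {G Y : Type*} [MeasurableSpace G] [MeasurableSpace Y]
  {P : ObsControl d k₁ k₂ n G Y}

/-- The cost of a leg splits at an intermediate time `t`; `c` is its path up to `t`. -/
theorem legCost_split (hP : P.Standing) {i : Fin (n + 1)} {s t : ℝ} (hs : s ∈ P.slot i)
    (ht : t ∈ P.slot i) (hst : s < t) (a : P.OpenLoop s (P.τ i.succ))
    (a' : P.OpenLoop t (P.τ i.succ)) (haa' : EqOn a.α a'.α (Ico t (P.τ i.succ)))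
    {α : ℝ → Eucl k₁} (hα : EqOn a.α α (Ico s t)) {c : ℝ → Prob d} (hc : P.IsFPSolution α s t c)
    (v : Eucl k₁ × Eucl k₂) :
    legCost hP hs a (c s) v = (∫ q in s..t, P.ℓ q (c q) (α q)) + legCost hP ht a' (c t) v := by
  set c' := flow hP (hP.isTimeSpan ht) a' (c t) with hc'_def
  have hc' : P.IsFPSolution a.α t (P.τ i.succ) c' :=
    (isFPSolution_flow hP (hP.isTimeSpan ht) a' (c t)).congr (fun q hq => (haa' hq).symm)
      fun _ _ => rfl
  have hc₀ : P.IsFPSolution a.α s t c := hc.congr (fun q hq => (hα hq).symm) fun _ _ => rfl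
  have hglue := hc₀.glue hP a.meas hst.le ht.2.le a.mem hc' (flow_start hP _ _ _).symm
  have hflow := flow_eq hP (hP.isTimeSpan hs) a hglue (ν := c s) (if_pos hst.le)
  have e1 : EqOn (flow hP (hP.isTimeSpan hs) a (c s)) c (Icc s t) := fun q hq =>
    (hflow ⟨hq.1, hq.2.trans ht.2.le⟩).trans (if_pos hq.2)
  have e2 : EqOn (flow hP (hP.isTimeSpan hs) a (c s)) c' (Ioc t (P.τ i.succ)) := fun q hq =>
    (hflow ⟨hst.le.trans hq.1.le, hq.2⟩).trans (if_neg hq.1.not_ge)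
  have hint : ∀ {x y : ℝ}, x ∈ Icc s (P.τ i.succ) → y ∈ Icc s (P.τ i.succ) →
      IntervalIntegrable (fun q => P.ℓ q (flow hP (hP.isTimeSpan hs) a (c s) q) (a.α q))
        volume x y := fun hx hy =>
    hP.intervalIntegrable_ℓ a.meas (hP.isTimeSpan hs).nonneg (hP.isTimeSpan hs).le_T a.mem
      (continuous_flow_time hP _ a _).continuousOn hx hy
  have ht' : t ∈ Icc s (P.τ i.succ) := ⟨hst.le, ht.2.le⟩
  have h1 : ∫ q in s..t, P.ℓ q (flow hP (hP.isTimeSpan hs) a (c s) q) (a.α q)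
      = ∫ q in s..t, P.ℓ q (c q) (α q) := by
    refine intervalIntegral.integral_congr_Ioo_of_le hst.le fun q hq => ?_
    simp only [e1 ⟨hq.1.le, hq.2.le⟩, hα ⟨hq.1.le, hq.2⟩]
  have h2 : ∫ q in t..P.τ i.succ, P.ℓ q (flow hP (hP.isTimeSpan hs) a (c s) q) (a.α q)
      = ∫ q in t..P.τ i.succ, P.ℓ q (c' q) (a'.α q) := by
    refine intervalIntegral.integral_congr_Ioo_of_le ht.2.le fun q hq => ?_
    simp only [e2 ⟨hq.1, hq.2.le⟩, haa' ⟨hq.1.le, hq.2⟩]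
  have hend : flow hP (hP.isTimeSpan hs) a (c s) (P.τ i.succ) = c' (P.τ i.succ) :=
    e2 ⟨ht.2, le_rfl⟩
  rw [legCost, legCost, ← intervalIntegral.integral_add_adjacent_intervals
    (hint ⟨le_rfl, hs.2.le⟩ ht') (hint ht' ⟨hs.2.le, le_rfl⟩), h1, h2, hend, add_assoc]

/-- The value function is at most the cost of any control on `[s, t]`, followed by the value
function. -/
theorem value_le_of_isFPSolution (hP : P.Standing)
    (hV : ∀ s ∈ Ico 0 P.T, Continuous (P.value s)) {i : Fin (n + 1)} {s t : ℝ}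
    (hs : s ∈ P.slot i) (ht : t ∈ P.slot i) (hst : s < t) {α : ℝ → Eucl k₁} (hα : Measurable α)
    (hαU : ∀ q ∈ Icc s t, α q ∈ Prod.fst '' P.U) {c : ℝ → Prob d} (hc : P.IsFPSolution α s t c) :
    P.value s (c s) ≤ (∫ q in s..t, P.ℓ q (c q) (α q)) + P.value t (c t) := by
  refine le_of_forall_pos_le_add fun ε hε => ?_
  obtain ⟨a', v, hv, h⟩ := exists_legCost_le_value_add hP hV ht (c t) hε
  let a : P.OpenLoop s (P.τ i.succ) :=
    { α := fun q => if q < t then α q else a'.α q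
      meas := Measurable.ite (measurableSet_lt measurable_id measurable_const) hα a'.meas
      mem := fun q hq => by
        by_cases hqt : q < t
        · simpa only [hqt, if_true] using hαU q ⟨hq.1, hqt.le⟩
        · simpa only [hqt, if_false] using a'.mem q ⟨not_lt.1 hqt, hq.2⟩ }
  have h1 := legCost_split hP hs ht hst a a' (fun q hq => if_neg hq.1.not_gt)
    (fun q hq => if_pos hq.2) hc v
  linarith [value_le_legCost hP hV hs a (c s) hv]

/-- There are controls on `[s, t]` which, followed by the value function, are nearly optimal. -/
theorem exists_isFPSolution_le_value_add (hP : P.Standing)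
    (hV : ∀ s ∈ Ico 0 P.T, Continuous (P.value s)) {i : Fin (n + 1)} {s t : ℝ}
    (hs : s ∈ P.slot i) (ht : t ∈ P.slot i) (hst : s < t) (ν : Prob d) {ε : ℝ} (hε : 0 < ε) :
    ∃ (α : ℝ → Eucl k₁) (c : ℝ → Prob d), Measurable α ∧
      (∀ q ∈ Icc s t, α q ∈ Prod.fst '' P.U) ∧ P.IsFPSolution α s t c ∧ c s = ν ∧
        (∫ q in s..t, P.ℓ q (c q) (α q)) + P.value t (c t) ≤ P.value s ν + ε := by
  obtain ⟨a, v, hv, h⟩ := exists_legCost_le_value_add hP hV hs ν hε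
  let a' : P.OpenLoop t (P.τ i.succ) := ⟨a.α, a.meas, fun q hq => a.mem q ⟨hst.le.trans hq.1, hq.2⟩⟩
  have hc := (isFPSolution_flow hP (hP.isTimeSpan hs) a ν).restrict hP a.meas a.mem le_rfl ht.2.le
  have hcs := flow_start hP (hP.isTimeSpan hs) a ν
  refine ⟨a.α, _, a.meas, fun q hq => a.mem q ⟨hq.1, hq.2.trans ht.2.le⟩, hc, hcs, ?_⟩
  have h1 := legCost_split hP hs ht hst a a' (fun _ _ => rfl) (fun _ _ => rfl) hc v
  rw [hcs] at h1
  linarith [value_le_legCost hP hV ht a' (flow hP (hP.isTimeSpan hs) a ν t) hv]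

/-! ### The Hamilton–Jacobi–Bellman equation -/

section HJB

variable {D : ℝ → Prob d → Eucl d → ℝ} {i : Fin (n + 1)} {t : ℝ}

theorem Standing.bddBelow_hamArg (hP : P.Standing) (hD : IsS11On (P.slot i) P.value D)
    (ht : t ∈ P.slot i) (μ : Prob d) :
    BddBelow (range fun u : P.U => P.hamArg t μ (D t μ) u) := by
  obtain ⟨B, hB⟩ := hP.exists_genBound
  obtain ⟨Cℓ, hCℓ⟩ := hP.ℓ_bdd
  obtain ⟨-, C, hC⟩ := hD.isCb2 ht μ
  refine ⟨-(B * (C + C)) - Cℓ, ?_⟩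
  rintro _ ⟨⟨u, hu⟩, rfl⟩
  have h1 := hB.abs_adjPair_le ⟨u, hu, rfl⟩ μ fun x => (hC x).2
  have h2 := hCℓ u hu t (Ico_subset_Icc_self (hP.slot_subset i ht)) μ
  simp only [hamArg]
  linarith [(abs_le.1 h1).1, (abs_le.1 h2).1]

theorem Standing.hamiltonian_le (hP : P.Standing) (hD : IsS11On (P.slot i) P.value D)
    (ht : t ∈ P.slot i) (μ : Prob d) {α : Eucl k₁} (hα : α ∈ Prod.fst '' P.U) :
    P.hamiltonian t μ (D t μ) ≤ P.hamArg t μ (D t μ) (α, 0) := by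
  obtain ⟨u, hu, rfl⟩ := hα
  exact ciInf_le (hP.bddBelow_hamArg hD ht μ) ⟨u, hu⟩

theorem Standing.intervalIntegrable_hamArg (hP : P.Standing) (hD : IsS11On (P.slot i) P.value D)
    (ht : t ∈ P.slot i) (μ : Prob d) {α : ℝ → Eucl k₁} (hα : Measurable α) {r₁ r₂ : ℝ}
    (hr : r₁ ≤ r₂) (hαU : ∀ q ∈ Icc r₁ r₂, α q ∈ Prod.fst '' P.U) :
    IntervalIntegrable (fun q => P.hamArg t μ (D t μ) (α q, 0)) volume r₁ r₂ := by
  exact (hP.intervalIntegrable_adjPair hα hαU (c := fun _ => μ) continuousOn_const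
    (hD.isCb2 ht μ) ⟨le_rfl, hr⟩ ⟨hr, le_rfl⟩).add
      (hP.intervalIntegrable_ℓ_const hα (Ico_subset_Icc_self (hP.slot_subset i ht)) μ hr hαU)

theorem Standing.hamiltonian_mul_le (hP : P.Standing) (hD : IsS11On (P.slot i) P.value D)
    (ht : t ∈ P.slot i) (μ : Prob d) {α : ℝ → Eucl k₁} (hα : Measurable α) {r₁ r₂ : ℝ}
    (hr : r₁ ≤ r₂) (hαU : ∀ q ∈ Icc r₁ r₂, α q ∈ Prod.fst '' P.U) :
    (r₂ - r₁) * P.hamiltonian t μ (D t μ) ≤ ∫ q in r₁..r₂, P.hamArg t μ (D t μ) (α q, 0) := by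
  have := intervalIntegral.integral_mono_on hr intervalIntegrable_const
    (hP.intervalIntegrable_hamArg hD ht μ hα hr hαU)
    fun q hq => hP.hamiltonian_le hD ht μ (hαU q hq)
  simpa using this

/-- The Hamilton–Jacobi–Bellman equation: dynamic programming on short intervals, in the limit. -/
theorem Standing.hjb (hP : P.Standing) (hV : ∀ s ∈ Ico 0 P.T, Continuous (P.value s))
    (hVt : ∀ μ, DifferentiableOn ℝ (fun t => P.value t μ) (P.slot i))
    (hD : IsS11On (P.slot i) P.value D) (ht : t ∈ P.slot i) (μ : Prob d) :
    derivWithin (fun r => P.value r μ) (P.slot i) t + P.hamiltonian t μ (D t μ) = 0 := by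
  have : Nonempty P.U := hP.U_nonempty.to_subtype
  set δ := derivWithin (fun r => P.value r μ) (P.slot i) t with hδ
  refine le_antisymm ?_ ?_
  -- a control on a short interval `[t, s]` that is optimal up to `ε * (s - t) / 2`
  · refine le_of_forall_pos_le_add fun ε hε => ?_
    obtain ⟨s, ⟨hs, hslot⟩, hts⟩ := ((hP.eventually_increment hD ht μ (hVt μ) (half_pos hε)).and
      (slot_mem_nhdsWithin_Ioi ht)).and self_mem_nhdsWithin |>.exists
    have hts' : 0 < s - t := sub_pos.2 hts
    obtain ⟨α, c, hα, hαU, hc, hcμ, hopt⟩ := exists_isFPSolution_le_value_add hP hV ht hslot hts μ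
      (mul_pos (half_pos hε) hts')
    have h1 := (abs_le.1 (hs α c hα hαU hc hcμ)).1
    have h2 := hP.hamiltonian_mul_le hD ht μ hα (le_of_lt hts) hαU
    have h3 : (s - t) * (δ + P.hamiltonian t μ (D t μ)) ≤ (s - t) * (0 + ε) := by
      rw [← hδ] at h1
      linarith
    exact le_of_mul_le_mul_left h3 hts'
  -- constant controls on a short interval `[t, s]`
  · suffices h : -δ ≤ P.hamiltonian t μ (D t μ) by linarith
    refine le_ciInf fun u => le_of_forall_pos_le_add fun ε hε => ?_
    obtain ⟨s, ⟨hs, hslot⟩, hts⟩ := ((hP.eventually_increment hD ht μ (hVt μ) hε).and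
      (slot_mem_nhdsWithin_Ioi ht)).and self_mem_nhdsWithin |>.exists
    have hts' : 0 < s - t := sub_pos.2 hts
    have hT := hP.slot_subset i hslot
    have huU : ∀ q ∈ Icc t s, u.1.1 ∈ Prod.fst '' P.U := fun _ _ => ⟨u.1, u.2, rfl⟩
    obtain ⟨c, hc, hcμ⟩ := hP.fp_exists t s (hP.slot_subset i ht).1 hts hT.2.le μ
      (fun _ => u.1.1) measurable_const huU
    have h1 := (abs_le.1 (hs _ c measurable_const huU hc hcμ)).2
    have h2 := value_le_of_isFPSolution hP hV ht hslot hts measurable_const huU hc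
    rw [hcμ] at h2
    have h4 : P.hamArg t μ (D t μ) (u.1.1, 0) = P.hamArg t μ (D t μ) u := rfl
    rw [intervalIntegral.integral_const, smul_eq_mul, ← hδ, h4] at h1
    have h3 : (s - t) * -δ ≤ (s - t) * (P.hamArg t μ (D t μ) u + ε) := by linarith
    exact le_of_mul_le_mul_left h3 hts'

end HJB

/-! ### The value function at the end of a slot -/

/-- Near the end of a slot the value function is close to the minimal exit cost, jointly in time and
state: the remaining time is too short to move the state or to accumulate running cost. -/
theorem Standing.tendsto_value (hP : P.Standing) (hV : ∀ s ∈ Ico 0 P.T, Continuous (P.value s))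
    (i : Fin (n + 1)) (μ : Prob d) :
    Tendsto (fun q : ℝ × Prob d => P.value q.1 q.2) (𝓝[<] (P.τ i.succ) ×ˢ 𝓝 μ)
      (𝓝 (⨅ v : P.U, P.exitCost i μ v)) := by
  have : Nonempty P.U := hP.U_nonempty.to_subtype
  obtain ⟨Cℓ, hCℓ⟩ := hP.ℓ_bdd
  obtain ⟨C, hC⟩ := hP.exists_exitCost_bound i
  have hbdd : BddBelow (range fun v : P.U => P.exitCost i μ v) := by
    refine ⟨-C, ?_⟩
    rintro _ ⟨v, rfl⟩
    exact (abs_le.1 (hC μ v v.2)).1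
  rw [Metric.tendsto_nhds]
  intro ε hε
  have hε4 : 0 < ε / 4 := by positivity
  have hN := (Metric.equicontinuousAt_iff_right.1
    (hP.equicontinuous_exitCost hV i μ)) (ε / 4) hε4
  obtain ⟨δ, hδ, hshort⟩ := hP.exists_short_time hN
  have hlt : P.τ i.castSucc < P.τ i.succ := hP.τ_strictMono Fin.castSucc_lt_succ
  have htime : ∀ᶠ t in 𝓝[<] (P.τ i.succ), t ∈ P.slot i ∧ P.τ i.succ - t ≤ δ ∧
      |Cℓ| * (P.τ i.succ - t) ≤ ε / 4 := by
    have h1 : Tendsto (fun t => P.τ i.succ - t) (𝓝[<] (P.τ i.succ)) (𝓝 0) := by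
      have : Tendsto (fun t => P.τ i.succ - t) (𝓝 (P.τ i.succ))
          (𝓝 (P.τ i.succ - P.τ i.succ)) := tendsto_const_nhds.sub tendsto_id
      rw [sub_self] at this
      exact this.mono_left nhdsWithin_le_nhds
    have h2 : Tendsto (fun t => |Cℓ| * (P.τ i.succ - t)) (𝓝[<] (P.τ i.succ)) (𝓝 0) := by
      simpa using h1.const_mul |Cℓ|
    filter_upwards [Ico_mem_nhdsLT hlt, h1.eventually (ge_mem_nhds hδ),
      h2.eventually (ge_mem_nhds hε4)] with t ht1 ht2 ht3 using ⟨ht1, ht2, ht3⟩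
  filter_upwards [htime.prod_mk hshort] with q hq
  obtain ⟨⟨ht, htδ, hℓ⟩, hpath⟩ := hq
  set E := ⨅ v : P.U, P.exitCost i μ v with hE
  have key : ∀ (a : P.OpenLoop q.1 (P.τ i.succ)) (v : P.U),
      |legCost hP ht a q.2 v - P.exitCost i μ v| ≤ ε / 2 := by
    intro a v
    have h1 := hpath a.α q.1 (P.τ i.succ) _ a.meas a.mem
      (isFPSolution_flow hP (hP.isTimeSpan ht) a q.2) (flow_start hP _ _ _) (P.τ i.succ)
      ⟨ht.2.le, le_rfl⟩ htδ v
    have h2 := intervalIntegral.norm_integral_le_of_norm_le_const (C := |Cℓ|)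
      (a := q.1) (b := P.τ i.succ)
      (f := fun r => P.ℓ r (flow hP (hP.isTimeSpan ht) a q.2 r) (a.α r)) fun r hr => by
        rw [uIoc_of_le ht.2.le] at hr
        obtain ⟨u, hu, hur⟩ := a.mem r ⟨hr.1.le, hr.2⟩
        rw [← hur]
        exact (hCℓ u hu r ⟨(hP.slot_subset i ht).1.trans hr.1.le,
          hr.2.trans (hP.isTimeSpan ht).le_T⟩ _).trans (le_abs_self _)
    rw [abs_of_nonneg (sub_nonneg.2 ht.2.le), Real.norm_eq_abs] at h2
    rw [dist_comm, Real.dist_eq] at h1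
    have h3 := abs_add_le (∫ r in q.1..P.τ i.succ,
        P.ℓ r (flow hP (hP.isTimeSpan ht) a q.2 r) (a.α r))
      (P.exitCost i (flow hP (hP.isTimeSpan ht) a q.2 (P.τ i.succ)) v - P.exitCost i μ v)
    rw [legCost, add_sub_assoc]
    linarith
  have hup : P.value q.1 q.2 ≤ E + 3 * (ε / 4) := by
    obtain ⟨v, hv⟩ := exists_lt_of_ciInf_lt (show E < E + ε / 4 by linarith)
    obtain ⟨a⟩ := exists_openLoop hP q.1 (P.τ i.succ)
    linarith [value_le_legCost hP hV ht a q.2 v.2, (abs_le.1 (key a v)).2]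
  have hlow : E - 3 * (ε / 4) ≤ P.value q.1 q.2 := by
    obtain ⟨a, v, hv, h⟩ := exists_legCost_le_value_add hP hV ht q.2 hε4
    linarith [ciInf_le hbdd ⟨v, hv⟩, (abs_le.1 (key a ⟨v, hv⟩)).1]
  rw [Real.dist_eq, abs_lt]
  constructor <;> linarith

end ObsControl

/-! ### Optimality of feedback controls -/

namespace ObsControl

variable {d k₁ k₂ n : ℕ} {G Y : Type*} [MeasurableSpace G] [MeasurableSpace Y]
  {P : ObsControl d k₁ k₂ n G Y} {D : ℝ → Prob d → Eucl d → ℝ} {i : Fin (n + 1)}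

/-- Minimizers of the Hamiltonian expression at nearby times and states are nearly minimizers. -/
theorem Standing.eventually_hamArg_le (hP : P.Standing) (hD : IsS11On (P.slot i) P.value D)
    {t : ℝ} (ht : t ∈ P.slot i) (μ : Prob d) {ε : ℝ} (hε : 0 < ε) :
    ∀ᶠ q in 𝓝[P.slot i] t ×ˢ 𝓝 μ, ∀ u ∈ P.U, IsMinOn (P.hamArg q.1 q.2 (D q.1 q.2)) P.U u →
      P.hamArg t μ (D t μ) u ≤ P.hamiltonian t μ (D t μ) + ε := by
  have : Nonempty P.U := hP.U_nonempty.to_subtype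
  have h := eventually_prod_top_iff.1
    (Metric.tendsto_nhds.1 (hP.tendsto_hamArg_sub hD ht μ) (ε / 2) (half_pos hε))
  filter_upwards [h] with q hq u hu hmin
  have h1 : ∀ v : P.U, |P.hamArg q.1 q.2 (D q.1 q.2) v - P.hamArg t μ (D t μ) v| < ε / 2 :=
    fun v => by simpa [Real.dist_eq] using hq v
  rw [← sub_le_iff_le_add]
  refine le_ciInf fun v => ?_
  linarith [(abs_lt.1 (h1 ⟨u, hu⟩)).1, (abs_lt.1 (h1 v)).2, isMinOn_iff.1 hmin v v.2]

/-- Only the left end point of a slot can be an observation time. -/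
theorem Standing.ne_obsTime (hP : P.Standing) {s t : ℝ} (hs : s ∈ P.slot i)
    (ht : t ∈ Ioo s (P.τ i.succ)) (j : Fin n) : t ≠ P.obsTime j := by
  rintro rfl
  obtain rfl := hP.slot_unique (i' := i) (hP.obsTime_mem_slot j) ⟨hs.1.trans ht.1.le, ht.2⟩
  exact absurd ht.1 (not_lt.2 hs.1)

/-- Along a path driven by minimizers of the Hamiltonian expression, the sum of the value function
and of the cost accumulated is constant up to the end of the slot. Nothing is assumed about the
control at time `s` itself, which may be an observation time. -/
theorem Standing.value_eq_of_minimizing (hP : P.Standing)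
    (hV : ∀ s ∈ Ico 0 P.T, Continuous (P.value s))
    (hVt : ∀ μ, DifferentiableOn ℝ (fun t => P.value t μ) (P.slot i))
    (hD : IsS11On (P.slot i) P.value D) {F : ℝ → Prob d → Eucl k₁ × Eucl k₂}
    (hF : P.IsArgminMap D F) {s : ℝ} (hs : s ∈ P.slot i) (a : P.OpenLoop s (P.τ i.succ))
    (μ : Prob d) (haF : ∀ t ∈ Ioo s (P.τ i.succ),
      a.α t = (F t (flow hP (hP.isTimeSpan hs) a μ t)).1) :
    P.value s μ = (∫ t in s..P.τ i.succ, P.ℓ t (flow hP (hP.isTimeSpan hs) a μ t) (a.α t))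
      + ⨅ v : P.U, P.exitCost i (flow hP (hP.isTimeSpan hs) a μ (P.τ i.succ)) v := by
  set c := flow hP (hP.isTimeSpan hs) a μ with hc_def
  have hspan := hP.isTimeSpan hs
  have hcont : Continuous c := continuous_flow_time hP _ a μ
  have hc : P.IsFPSolution a.α s (P.τ i.succ) c := isFPSolution_flow hP _ a μ
  have hcs : c s = μ := flow_start hP _ a μ
  have hint : ∀ {x y : ℝ}, x ∈ Icc s (P.τ i.succ) → y ∈ Icc s (P.τ i.succ) →
      IntervalIntegrable (fun q => P.ℓ q (c q) (a.α q)) volume x y := fun hx hy =>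
    hP.intervalIntegrable_ℓ a.meas hspan.nonneg hspan.le_T a.mem hcont.continuousOn hx hy
  have hslot : ∀ {t}, t ∈ Ico s (P.τ i.succ) → t ∈ P.slot i := fun ht => ⟨hs.1.trans ht.1, ht.2⟩
  have hprim : ContinuousOn (fun t => ∫ q in s..t, P.ℓ q (c q) (a.α q)) (Icc s (P.τ i.succ)) := by
    have := intervalIntegral.continuousOn_primitive_interval' (hint ⟨le_rfl, hspan.lt.le⟩
      ⟨hspan.lt.le, le_rfl⟩) (a := s) left_mem_uIcc
    rwa [uIcc_of_le hspan.lt.le] at this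
  have hderiv : ∀ t ∈ Ico s (P.τ i.succ), HasDerivWithinAt
      (fun t => P.value t (c t) + ∫ q in s..t, P.ℓ q (c q) (a.α q)) 0 (Ici t) t := by
    intro t ht
    rw [hasDerivWithinAt_iff_isLittleO, Asymptotics.isLittleO_iff]
    intro ε hε
    rw [← Ioi_insert, nhdsWithin_insert, eventually_sup]
    -- by the chain rule the increment over `[t, x]` is `(x - t) ∂_t V + ∫ hamArg` up to a small error;
    -- the integrand is close to the Hamiltonian, and the equation makes both terms cancel
    refine ⟨by simp, ?_⟩
    have h1 := hP.eventually_increment hD (hslot ht) (c t) (hVt (c t)) (half_pos hε)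
    have h2 : ∀ᶠ q in 𝓝[>] t, ∀ u ∈ P.U, IsMinOn (P.hamArg q (c q) (D q (c q))) P.U u →
        P.hamArg t (c t) (D t (c t)) u ≤ P.hamiltonian t (c t) (D t (c t)) + ε / 2 := by
      have h3 : Tendsto (fun q => (q, c q)) (𝓝[>] t) (𝓝[P.slot i] t ×ˢ 𝓝 (c t)) :=
        Tendsto.prodMk (nhdsWithin_le_iff.2 (slot_mem_nhdsWithin_Ioi (hslot ht)))
          ((hcont.tendsto t).mono_left nhdsWithin_le_nhds)
      exact h3.eventually (hP.eventually_hamArg_le hD (hslot ht) (c t) (half_pos hε))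
    obtain ⟨b, hb, hbs⟩ := (mem_nhdsGT_iff_exists_Ioc_subset).1 h2
    filter_upwards [h1, Ioo_mem_nhdsGT (lt_min hb ht.2)] with x hx1 hx2
    have htx : t < x := hx2.1
    have hxr : x < P.τ i.succ := hx2.2.trans_le (min_le_right _ _)
    have hxb : x < b := hx2.2.trans_le (min_le_left _ _)
    have hmem : ∀ q ∈ Icc t x, a.α q ∈ Prod.fst '' P.U := fun q hq =>
      a.mem q ⟨ht.1.trans hq.1, hq.2.trans hxr.le⟩
    have h4 := hx1 a.α c a.meas hmem (hc.restrict hP a.meas a.mem ht.1 hxr.le) rfl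
    have h5 := hP.hamiltonian_mul_le hD (hslot ht) (c t) a.meas htx.le hmem
    have h6 : ∫ q in t..x, P.hamArg t (c t) (D t (c t)) (a.α q, 0)
        ≤ (x - t) * (P.hamiltonian t (c t) (D t (c t)) + ε / 2) := by
      have := intervalIntegral.integral_mono_on_of_le_Ioo htx.le
        (hP.intervalIntegrable_hamArg hD (hslot ht) (c t) a.meas htx.le hmem)
        (intervalIntegrable_const (c := P.hamiltonian t (c t) (D t (c t)) + ε / 2))
        fun q hq => by
          have hqs : q ∈ Ioo s (P.τ i.succ) := ⟨ht.1.trans_lt hq.1, hq.2.trans hxr⟩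
          have hq0 := hP.slot_subset i (hslot ⟨hqs.1.le, hqs.2⟩)
          rw [haF q hqs]
          exact hbs ⟨hq.1, (hq.2.trans hxb).le⟩ (F q (c q)) (hF.mem q hq0 _)
            (hF.ham q hq0 (fun j => hP.ne_obsTime hs hqs j) _)
      rwa [intervalIntegral.integral_const, smul_eq_mul] at this
    have h7 := hP.hjb hV hVt hD (hslot ht) (c t)
    have h8 := intervalIntegral.integral_add_adjacent_intervals
      (hint ⟨le_rfl, hspan.lt.le⟩ ⟨ht.1, ht.2.le⟩)
      (hint (x := t) (y := x) ⟨ht.1, ht.2.le⟩ ⟨ht.1.trans htx.le, hxr.le⟩)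
    have hd : derivWithin (fun r => P.value r (c t)) (P.slot i) t
        = -P.hamiltonian t (c t) (D t (c t)) := by linarith
    rw [hd] at h4
    have h9 := abs_le.1 h4
    have htx' : 0 ≤ x - t := (sub_pos.2 htx).le
    rw [← h8, smul_zero, sub_zero, Real.norm_eq_abs, Real.norm_eq_abs, abs_of_nonneg htx', abs_le]
    constructor <;> nlinarith [h9.1, h9.2]
  have hconst : ∀ t ∈ Ico s (P.τ i.succ),
      P.value t (c t) + ∫ q in s..t, P.ℓ q (c q) (a.α q) = P.value s μ := by
    intro t ht
    have hsub : Icc s t ⊆ Ico s (P.τ i.succ) := fun q hq => ⟨hq.1, hq.2.trans_lt ht.2⟩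
    have h1 : ContinuousOn (fun t => P.value t (c t)) (Icc s t) :=
      (hD.continuousOn fun μ => (hVt μ).continuousOn).comp
        (f := fun q : ℝ => (q, c q)) (by fun_prop) fun q hq => ⟨hslot (hsub hq), mem_univ _⟩
    have h2 := constant_of_has_deriv_right_zero
      (h1.add (hprim.mono (hsub.trans Ico_subset_Icc_self)))
      (fun q hq => hderiv q (hsub (Ico_subset_Icc_self hq))) t ⟨ht.1, le_rfl⟩
    simpa [hcs] using h2
  have hlim₁ : Tendsto (fun t => P.value t (c t)) (𝓝[<] (P.τ i.succ))
      (𝓝 (⨅ v : P.U, P.exitCost i (c (P.τ i.succ)) v)) :=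
    (hP.tendsto_value hV i (c (P.τ i.succ))).comp
      (Tendsto.prodMk tendsto_id ((hcont.tendsto (P.τ i.succ)).mono_left nhdsWithin_le_nhds))
  have hlim₂ : Tendsto (fun t => ∫ q in s..t, P.ℓ q (c q) (a.α q)) (𝓝[<] (P.τ i.succ))
      (𝓝 (∫ q in s..P.τ i.succ, P.ℓ q (c q) (a.α q))) := by
    have h1 := hprim (P.τ i.succ) ⟨hspan.lt.le, le_rfl⟩
    refine h1.tendsto.mono_left (nhdsWithin_le_iff.2 ?_)
    filter_upwards [Ico_mem_nhdsLT hspan.lt] with t ht using ⟨ht.1, ht.2.le⟩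
  have hlim₃ := (hlim₁.add hlim₂).congr' (f₂ := fun _ => P.value s μ) (by
    filter_upwards [Ico_mem_nhdsLT hspan.lt] with t ht using hconst t ht)
  rw [tendsto_nhds_unique tendsto_const_nhds hlim₃, add_comm]

/-- The cost of a feedback control given by the minimizers is the value function. -/
theorem Trajectory.IsFeedback.cost_eq (hP : P.Standing)
    (hV : ∀ s ∈ Ico 0 P.T, Continuous (P.value s))
    (hVt : ∀ i μ, DifferentiableOn ℝ (fun t => P.value t μ) (P.slot i))
    (hD : ∀ i, IsS11On (P.slot i) P.value D) {F : ℝ → Prob d → Eucl k₁ × Eucl k₂}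
    (hF : P.IsArgminMap D F) (i : Fin (n + 1)) : ∀ {s : ℝ}, s ∈ P.slot i →
      ∀ {μ : Prob d} {u : P.Control s} {X : P.Trajectory u μ}, X.IsFeedback F →
        X.cost = P.value s μ := by
  have : Nonempty P.U := hP.U_nonempty.to_subtype
  obtain ⟨ω₀⟩ : Nonempty (Fin n → G) := P.noise.nonempty_of_neZero
  have hleg : ∀ {i : Fin (n + 1)} {s : ℝ} (hs : s ∈ P.slot i) {μ : Prob d} {u : P.Control s}
      {X : P.Trajectory u μ}, X.IsFeedback F → ∀ t ∈ Ioo s (P.τ i.succ),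
        u.α t (X.record ω₀) = (F t (flow hP (hP.isTimeSpan hs)
          (u.toOpenLoop (X.record ω₀) (hP.isTimeSpan hs).le_T) μ t)).1 := by
    intro i s hs μ u X hX t ht
    rw [← X.seg_eq_flow hP hs (X.record ω₀) ω₀ (Ioo_subset_Icc_self ht)]
    exact hX.α_eq i t ⟨hs.1.trans ht.1.le, ht.2⟩ ht.1.le (hP.ne_obsTime hs ht) ω₀
  induction i using Fin.reverseInduction with
  | last =>
    intro s hs μ u X hX
    rw [X.cost_eq_last hP hs (X.record ω₀),
      hP.value_eq_of_minimizing hV (hVt _) (hD _) hF hs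
        (u.toOpenLoop (X.record ω₀) (hP.isTimeSpan hs).le_T) μ (hleg hs hX)]
    simp only [exitCost_last, ciInf_const]
    rfl
  | cast j ih =>
    intro s hs μ u X hX
    have hβ : ∀ ω, u.β j (X.record ω) = u.β j (X.record ω₀) := fun ω =>
      u.β_eq_of_next hP hs _ _
    have hν := fun ω => X.seg_eq_flow hP hs (X.record ω₀) ω
      (t := P.obsTime j) ⟨hs.2.le, le_rfl⟩
    set ν := flow hP (hP.isTimeSpan hs) (u.toOpenLoop (X.record ω₀) (hP.isTimeSpan hs).le_T) μ
      (P.obsTime j) with hν_def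
    rw [(X.cost_eq_after hP hs hν hβ (X.record ω₀)).2,
      hP.value_eq_of_minimizing hV (hVt _) (hD _) hF hs
        (u.toOpenLoop (X.record ω₀) (hP.isTimeSpan hs).le_T) μ (hleg hs hX)]
    have hinf : ⨅ v : P.U, P.exitCost j.castSucc ν v
        = P.impulseArg j ν (F (P.obsTime j) ν) := by
      have hFU := hF.mem _ (hP.slot_subset _ (hP.obsTime_mem_slot j)) ν
      simp only [exitCost_castSucc]
      refine le_antisymm (ciInf_le ⟨P.impulseArg j ν (F (P.obsTime j) ν), ?_⟩
        (⟨_, hFU⟩ : P.U)) (le_ciInf fun v => isMinOn_iff.1 (hF.imp j ν) v v.2)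
      rintro _ ⟨v, rfl⟩
      exact isMinOn_iff.1 (hF.imp j ν) v v.2
    have hβF : u.β j (X.record ω₀) = (F (P.obsTime j) ν).2 := by
      rw [hX.β_eq j hs.2 ω₀, hν ω₀]
    have hcost : ∀ w, (X.after hP hs hν hβ w).cost = P.value (P.obsTime j)
        (P.post (F (P.obsTime j) ν).2 ν (P.obs j ν (F (P.obsTime j) ν).2 w)) := fun w => by
      rw [ih (hP.obsTime_mem_slot j) (hX.after hP hs hν hβ w), hβF]
    simp_rw [hcost]
    rw [hβF, add_assoc]
    exact congrArg _ hinf.symm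

end ObsControl

end

theorem theorem3p4 {d k₁ k₂ n : ℕ} {G Y : Type*} [MeasurableSpace G] [MeasurableSpace Y]
    (P : ObsControl d k₁ k₂ n G Y) (hP : P.Standing)
    (D : ℝ → Prob d → Eucl d → ℝ)
    (hVt : ∀ (i : Fin (n + 1)) (μ : Prob d),
      DifferentiableOn ℝ (fun t => P.value t μ) (P.slot i))
    (hVμ : ∀ i : Fin (n + 1), IsS11On (P.slot i) P.value D) :
    (∀ i : Fin (n + 1), ∀ t ∈ P.slot i, ∀ μ : Prob d,
      derivWithin (fun r => P.value r μ) (P.slot i) t + P.hamiltonian t μ (D t μ) = 0) ∧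
    (∀ (j : Fin n) (μ : Prob d),
      Tendsto (fun t => P.value t μ) (𝓝[<] (P.obsTime j)) (𝓝 (P.impulse j μ))) ∧
    (∀ μ : Prob d, P.value P.T μ = P.g μ ∧
      Tendsto (fun t => P.value t μ) (𝓝[<] P.T) (𝓝 (P.g μ))) ∧
    (∀ F : ℝ → Prob d → Eucl k₁ × Eucl k₂, P.IsArgminMap D F →
      ∀ s ∈ Ico 0 P.T, ∀ (μ : Prob d) (u : P.Control s) (X : P.Trajectory u μ),
        X.IsFeedback F → X.IsOptimal) := by
  have : Nonempty P.U := hP.U_nonempty.to_subtype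
  have hV : ∀ s ∈ Ico 0 P.T, Continuous (P.value s) := by
    intro s hs
    obtain ⟨i, hi⟩ := hP.exists_slot hs
    exact ((hVμ i).continuousOn fun μ => (hVt i μ).continuousOn).comp_continuous
      (f := fun μ : Prob d => (s, μ)) (by fun_prop) fun μ => ⟨hi, mem_univ _⟩
  -- both jump conditions are instances of the limit at the end of a slot
  have hlim : ∀ (i : Fin (n + 1)) (μ : Prob d), Tendsto (fun t => P.value t μ)
      (𝓝[<] (P.τ i.succ)) (𝓝 (⨅ v : P.U, P.exitCost i μ v)) := fun i μ =>
    (hP.tendsto_value hV i μ).comp (tendsto_id.prodMk tendsto_const_nhds)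
  refine ⟨fun i t ht μ => hP.hjb hV (hVt i) (hVμ i) ht μ, fun j μ => ?_, fun μ => ⟨?_, ?_⟩, ?_⟩
  · have h := hlim j.castSucc μ
    simp only [ObsControl.exitCost_castSucc] at h
    exact h
  · exact if_neg (lt_irrefl _)
  · have h := hlim (Fin.last n) μ
    simp only [ObsControl.exitCost_last, ciInf_const] at h
    exact h
  · intro F hF s hs μ u X hX u' X'
    obtain ⟨i, hi⟩ := hP.exists_slot hs
    rw [hX.cost_eq hP hV hVt hVμ hF i hi]
    exact hP.value_le_cost hs X'
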